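/- Let $n\ge 3$, let $M$ be a $C^\infty$ $n$-manifold, and let $\mathcal E$ be a smooth real vector bundle of rank $n$ over $M$ with a smooth positive definite fibre metric $\langle\,,\rangle$, a smooth metric connection $D$, and a smooth bundle homomorphism $\phi\colon TM\to\mathcal E$ such that $$D_X\phi(Y)-D_Y\phi(X)-\phi([X,Y])=0$$ for all smooth vector fields $X,Y$ on $M$. Let $g=\phi^*\langle\,,\rangle$, and let $\mathcal R$ be the set of points $p\in M$ at which $\phi_p\colon T_pM\to\mathcal E_p$ is injective, so that $g$ is a Riemannian metric on $\mathcal R$. A Riemannian metric $h$ on an open set $U$ is called conformally flat if every point of $U$ has an open neighbourhood $W\subset U$ with a smooth function $\sigma$ on $W$ such that $e^{2\sigma}h$ has vanishing sectional curvature on $W$. The Schouten tensor of $h$ is $$\frac1{n-2}\sum_{i,j}\Bigl(R_{ij}-\frac{S}{2(n-1)}h_{ij}\Bigr)\,du^i\otimes du^j,$$ where $(R_{ij})$ is the Ricci tensor and $S$ the scalar curvature of $h$. Assume that $(M,\mathcal E,\langle\,,\rangle,D,\phi)$ is a generalized conformally flat manifold (GCF-manifold), that is, $\mathcal R$ is dense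 in $M$ and $g$ is conformally flat on $\mathcal R$. Let $A$ be the Schouten tensor of $g$ on $\mathcal R$, and let $\mathcal R^*\subset\mathcal R$ be the set of non-parabolic points, i.e. the points of $\mathcal R$ at which the bilinear form $A$ is non-degenerate. Then $\mathcal R^*$ is open in $M$, and the tensor given in local coordinates $(u^1,\dots,u^n)$ by $$\check g=\sum_{i,j,a,b}A_{ia}A_{jb}\,g^{ab}\,du^i\otimes du^j,\qquad (g^{ab})=(g_{ij})^{-1},$$ is well defined, independently of the choice of coordinates, and is a smooth, conformally flat Riemannian metric on $\mathcal R^*$. Moreover, the Schouten tensor of $\check g$ coincides with $A$ on $\mathcal R^*$. -/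

import Mathlib

open Bundle
open scoped Manifold ContDiff

noncomputable section

/-! ### Curvature of a metric in local coordinates

`G u` is the matrix `(g_{ij})` of a metric at the point with coordinates `u`. -/

/-- The partial derivative `∂_i f` of a function on `ℝⁿ`. -/
def partialDeriv {n : ℕ} (i : Fin n) (f : EuclideanSpace ℝ (Fin n) → ℝ)
    (u : EuclideanSpace ℝ (Fin n)) : ℝ :=
  fderiv ℝ f u (EuclideanSpace.single i 1)

/-- The Christoffel symbols `Γ^k_{ij}` of the Levi-Civita connection. -/
def christoffel {n : ℕ} (G : EuclideanSpace ℝ (Fin n) → Matrix (Fin n) (Fin n) ℝ)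
    (k i j : Fin n) (u : EuclideanSpace ℝ (Fin n)) : ℝ :=
  (1 / 2) * ∑ l, (G u)⁻¹ k l *
    (partialDeriv i (fun x => G x j l) u + partialDeriv j (fun x => G x i l) u
      - partialDeriv l (fun x => G x i j) u)

/-- The curvature components `R_{ijk}^l`, where `R(∂_i, ∂_j) ∂_k = ∑ l, R_{ijk}^l ∂_l` and
`R(X, Y) Z = ∇_X ∇_Y Z - ∇_Y ∇_X Z - ∇_{[X, Y]} Z`. -/
def riemannCoord {n : ℕ} (G : EuclideanSpace ℝ (Fin n) → Matrix (Fin n) (Fin n) ℝ)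
    (i j k l : Fin n) (u : EuclideanSpace ℝ (Fin n)) : ℝ :=
  partialDeriv i (christoffel G l j k) u - partialDeriv j (christoffel G l i k) u
    + ∑ m, (christoffel G m j k u * christoffel G l i m u
      - christoffel G m i k u * christoffel G l j m u)

/-- The Ricci tensor `R_{jk}`, the trace of `X ↦ R(X, ∂_j) ∂_k`. -/
def ricciCoord {n : ℕ} (G : EuclideanSpace ℝ (Fin n) → Matrix (Fin n) (Fin n) ℝ)
    (j k : Fin n) (u : EuclideanSpace ℝ (Fin n)) : ℝ :=
  ∑ i, riemannCoord G i j k i u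

/-- The scalar curvature. -/
def scalarCoord {n : ℕ} (G : EuclideanSpace ℝ (Fin n) → Matrix (Fin n) (Fin n) ℝ)
    (u : EuclideanSpace ℝ (Fin n)) : ℝ :=
  ∑ j, ∑ k, (G u)⁻¹ j k * ricciCoord G j k u

/-- The components `A_{ij} = (R_{ij} - S g_{ij} / (2 (n - 1))) / (n - 2)` of the Schouten
tensor. -/
def schoutenCoord {n : ℕ} (G : EuclideanSpace ℝ (Fin n) → Matrix (Fin n) (Fin n) ℝ)
    (u : EuclideanSpace ℝ (Fin n)) : Matrix (Fin n) (Fin n) ℝ :=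
  Matrix.of fun i j => (1 / ((n : ℝ) - 2)) *
    (ricciCoord G i j u - scalarCoord G u / (2 * ((n : ℝ) - 1)) * G u i j)

/-- The sectional curvature `g(R(v, w) w, v) / (g(v, v) g(w, w) - g(v, w)²)` of the plane spanned
by the vectors with components `v` and `w`. -/
def sectionalCoord {n : ℕ} (G : EuclideanSpace ℝ (Fin n) → Matrix (Fin n) (Fin n) ℝ)
    (u v w : EuclideanSpace ℝ (Fin n)) : ℝ :=
  (∑ i, ∑ j, ∑ k, ∑ l, ∑ m, riemannCoord G i j k l u * v i * w j * w k * G u l m * v m) /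
    ((∑ i, ∑ j, G u i j * v i * v j) * (∑ i, ∑ j, G u i j * w i * w j)
      - (∑ i, ∑ j, G u i j * v i * w j) ^ 2)

/-- The bilinear form `(v, w) ↦ ∑ B i j * v i * w j` on `ℝⁿ`. -/
def bilinOfMatrix {n : ℕ} (B : Matrix (Fin n) (Fin n) ℝ) :
    EuclideanSpace ℝ (Fin n) →L[ℝ] EuclideanSpace ℝ (Fin n) →L[ℝ] ℝ :=
  ∑ i, ∑ j, B i j • (EuclideanSpace.proj i : EuclideanSpace ℝ (Fin n) →L[ℝ] ℝ).smulRight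
    (EuclideanSpace.proj j : EuclideanSpace ℝ (Fin n) →L[ℝ] ℝ)

theorem bilinOfMatrix_apply {n : ℕ} (B : Matrix (Fin n) (Fin n) ℝ)
    (v w : EuclideanSpace ℝ (Fin n)) :
    bilinOfMatrix B v w = ∑ i, ∑ j, B i j * v i * w j := by
  simp [bilinOfMatrix, mul_assoc]

/-! ### Covariant 2-tensors on a manifold -/

/-- A (not necessarily smooth) field of bilinear forms on the tangent spaces of `M`. -/
abbrev TwoTensor (n : ℕ) (M : Type*) [TopologicalSpace M]
    [ChartedSpace (EuclideanSpace ℝ (Fin n)) M] : Type _ :=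
  ∀ p : M, TangentSpace (𝓡 n) p →L[ℝ] TangentSpace (𝓡 n) p →L[ℝ] ℝ

section Tensors

variable {n : ℕ} {M : Type*} [TopologicalSpace M] [ChartedSpace (EuclideanSpace ℝ (Fin n)) M]

/-- The coordinate vector field `∂/∂u^i` of the chart `e`, at the point with coordinates `u`. -/
def coordVector (e : OpenPartialHomeomorph M (EuclideanSpace ℝ (Fin n)))
    (i : Fin n) (u : EuclideanSpace ℝ (Fin n)) : TangentSpace (𝓡 n) (e.symm u) :=
  mfderiv (𝓡 n) (𝓡 n) e.symm u (EuclideanSpace.single i (1 : ℝ) : EuclideanSpace ℝ (Fin n))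

/-- The components `T_{ij}` of a 2-tensor in the chart `e`, as functions of the coordinates. -/
def tensorCoord (e : OpenPartialHomeomorph M (EuclideanSpace ℝ (Fin n))) (T : TwoTensor n M)
    (u : EuclideanSpace ℝ (Fin n)) : Matrix (Fin n) (Fin n) ℝ :=
  Matrix.of fun i j => T (e.symm u) (coordVector e i u) (coordVector e j u)

/-- The Schouten tensor of `g`. Mathlib identifies `T_p M` with `ℝⁿ` through the preferred chart at
`p`, so that the coordinate vectors of that chart at `p` are the standard basis. -/
def schoutenTensor (g : TwoTensor n M) : TwoTensor n M := fun p =>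
  bilinOfMatrix (schoutenCoord (tensorCoord (chartAt (EuclideanSpace ℝ (Fin n)) p) g)
    (chartAt (EuclideanSpace ℝ (Fin n)) p p))

/-- The sectional curvature of `g` at `p` of the plane spanned by `v` and `w`. -/
def sectionalCurvature (g : TwoTensor n M) (p : M) (v w : TangentSpace (𝓡 n) p) : ℝ :=
  sectionalCoord (tensorCoord (chartAt (EuclideanSpace ℝ (Fin n)) p) g)
    (chartAt (EuclideanSpace ℝ (Fin n)) p p) v w

/-- The tensor `∑ A_{ia} A_{jb} g^{ab} du^i ⊗ du^j`, where `A` is the Schouten tensor of `g`. -/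
def dualTensor (g : TwoTensor n M) : TwoTensor n M := fun p =>
  let e := chartAt (EuclideanSpace ℝ (Fin n)) p
  let A := tensorCoord e (schoutenTensor g) (e p)
  let G := tensorCoord e g (e p)
  bilinOfMatrix (Matrix.of fun i j => ∑ a, ∑ b, A i a * A j b * G⁻¹ a b)

/-- `g` is a smooth Riemannian metric on the open set `U`. -/
structure IsRiemannianMetricOn [IsManifold (𝓡 n) ∞ M] (g : TwoTensor n M) (U : Set M) :
    Prop where
  isOpen : IsOpen U
  symm : ∀ p ∈ U, ∀ v w : TangentSpace (𝓡 n) p, g p v w = g p w v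
  pos : ∀ p ∈ U, ∀ v : TangentSpace (𝓡 n) p, v ≠ 0 → 0 < g p v v
  smooth : ContMDiffOn (𝓡 n) ((𝓡 n).prod 𝓘(ℝ, EuclideanSpace ℝ (Fin n) →L[ℝ]
      EuclideanSpace ℝ (Fin n) →L[ℝ] ℝ)) ∞
    (fun p => TotalSpace.mk' (EuclideanSpace ℝ (Fin n) →L[ℝ] EuclideanSpace ℝ (Fin n) →L[ℝ] ℝ)
      (E := fun p : M => TangentSpace (𝓡 n) p →L[ℝ] TangentSpace (𝓡 n) p →L[ℝ] ℝ) p (g p)) U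

/-- The metric `g` on the open set `U` is conformally flat: near every point of `U` some conformal
rescaling `e^{2σ} g` with a smooth `σ` has vanishing sectional curvature. -/
def IsConformallyFlatOn (g : TwoTensor n M) (U : Set M) : Prop :=
  ∀ p ∈ U, ∃ W : Set M, IsOpen W ∧ p ∈ W ∧ W ⊆ U ∧
    ∃ σ : M → ℝ, ContMDiffOn (𝓡 n) 𝓘(ℝ, ℝ) ∞ σ W ∧
      ∀ q ∈ W, ∀ v w : TangentSpace (𝓡 n) q, LinearIndependent ℝ ![v, w] →
        sectionalCurvature (fun x => Real.exp (2 * σ x) • g x) q v w = 0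

end Tensors

/-! ### Coherent tangent bundles -/

/-- A coherent tangent bundle structure over the `n`-manifold `M` on the smooth vector bundle `V`
with smooth fibre metric: a smooth metric connection `D` and a smooth bundle homomorphism
`φ : TM → V` with `D_X φ(Y) - D_Y φ(X) - φ([X, Y]) = 0`. -/
structure CoherentTangentBundle (n : ℕ) (M : Type*) [TopologicalSpace M]
    [ChartedSpace (EuclideanSpace ℝ (Fin n)) M] [IsManifold (𝓡 n) ∞ M]
    (F : Type*) [NormedAddCommGroup F] [NormedSpace ℝ F] [FiniteDimensional ℝ F]
    (V : M → Type*) [TopologicalSpace (TotalSpace F V)]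
    [∀ p, NormedAddCommGroup (V p)] [∀ p, InnerProductSpace ℝ (V p)]
    [FiberBundle F V] [VectorBundle ℝ F V] [ContMDiffVectorBundle ∞ F V (𝓡 n)]
    [IsContMDiffRiemannianBundle (𝓡 n) ∞ F V] where
  /-- The rank of the bundle is `n`. -/
  rank_eq : Module.finrank ℝ F = n
  /-- The connection: `D σ p v` is the derivative of the section `σ` in the direction `v`. -/
  D : CovariantDerivative (𝓡 n) F V
  smooth_D : CovariantDerivative.ContMDiffCovariantDerivative D ∞
  metric_D : D.IsMetricCompatible
  /-- The bundle homomorphism. -/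
  φ : ∀ p : M, TangentSpace (𝓡 n) p →L[ℝ] V p
  smooth_φ : ContMDiff (𝓡 n) ((𝓡 n).prod 𝓘(ℝ, EuclideanSpace ℝ (Fin n) →L[ℝ] F)) ∞
    (fun p => TotalSpace.mk' (EuclideanSpace ℝ (Fin n) →L[ℝ] F)
      (E := fun p : M => TangentSpace (𝓡 n) p →L[ℝ] V p) p (φ p))
  coherent : ∀ X Y : ∀ p : M, TangentSpace (𝓡 n) p,
    ContMDiff (𝓡 n) (𝓡 n).tangent ∞ (fun p => (X p : TangentBundle (𝓡 n) M)) →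
    ContMDiff (𝓡 n) (𝓡 n).tangent ∞ (fun p => (Y p : TangentBundle (𝓡 n) M)) →
    ∀ p : M, D (fun q => φ q (Y q)) p (X p) - D (fun q => φ q (X q)) p (Y p)
      - φ p (VectorField.mlieBracket (𝓡 n) X Y p) = 0

namespace CoherentTangentBundle

variable {n : ℕ} {M : Type*} [TopologicalSpace M]
  [ChartedSpace (EuclideanSpace ℝ (Fin n)) M] [IsManifold (𝓡 n) ∞ M]
  {F : Type*} [NormedAddCommGroup F] [NormedSpace ℝ F] [FiniteDimensional ℝ F]
  {V : M → Type*} [TopologicalSpace (TotalSpace F V)]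
  [∀ p, NormedAddCommGroup (V p)] [∀ p, InnerProductSpace ℝ (V p)]
  [FiberBundle F V] [VectorBundle ℝ F V] [ContMDiffVectorBundle ∞ F V (𝓡 n)]
  [IsContMDiffRiemannianBundle (𝓡 n) ∞ F V]

/-- The induced tensor `g = φ^*⟨ , ⟩`, that is, `g(v, w) = ⟨φ v, φ w⟩`. -/
def inducedMetric (B : CoherentTangentBundle n M F V) : TwoTensor n M := fun p =>
  (ContinuousLinearMap.precomp ℝ (B.φ p)).comp
    ((innerSL ℝ : V p →L[ℝ] V p →L[ℝ] ℝ).comp (B.φ p))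

theorem inducedMetric_apply (B : CoherentTangentBundle n M F V) (p : M)
    (v w : TangentSpace (𝓡 n) p) : B.inducedMetric p v w = inner ℝ (B.φ p v) (B.φ p w) :=
  rfl

/-- The set of regular points of `φ`. -/
def regularSet (B : CoherentTangentBundle n M F V) : Set M :=
  {p | Function.Injective (B.φ p)}

/-- A coherent tangent bundle is a generalized conformally flat (GCF) manifold if the regular set
is dense and the induced metric is conformally flat on it. -/
structure IsGCF (B : CoherentTangentBundle n M F V) : Prop where
  dense : Dense B.regularSet
  conformallyFlat : IsConformallyFlatOn B.inducedMetric B.regularSet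

/-- The set of non-parabolic points: the regular points at which the Schouten tensor of the induced
metric is non-degenerate. -/
def nonParabolicSet (B : CoherentTangentBundle n M F V) : Set M :=
  {p | p ∈ B.regularSet ∧ ∀ v : TangentSpace (𝓡 n) p,
    (∀ w : TangentSpace (𝓡 n) p, schoutenTensor B.inducedMetric p v w = 0) → v = 0}

end CoherentTangentBundle

end

open Bundle
open scoped Manifold ContDiff

noncomputable section

/-! ### Frobenius theorem for linear systems, by Picard iteration along rays -/

section Frobenius

open Set Metric Filter Topology MeasureTheory

/-! Everything is local. Near a regular point, conformal flatness gives flat coordinates `ψ`, with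
Jacobian `J`, and a function `s` such that `G = e^{2s} Jᵀ J`. Let `w` be the gradient of `s` in the
coordinates `ψ`, so that `ds = Jᵀ w`, and let `K` be the matrix of the `∂_i w_a`. The conformal
change formula for the Schouten tensor then reads `A = (Jᵀ w)(Jᵀ w)ᵀ - Jᵀ K - (|w|²/2) Jᵀ J`
(`IsConformalChart.schoutenCoord_eq`).

Where `w ≠ 0`, let `R = 1 - 2 w wᵀ / |w|²` be the reflection along `w`, and replace `ψ` by `ψ + 2 w
/ |w|²`. The derivative of `w ↦ w / |w|²` is `|w|⁻² R`, so the new map has Jacobian `L = J + (2 /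
|w|²) R K`, and `R² = 1` turns the formula for `A` into the product `A = -(|w|²/2) Jᵀ R L`
(`schoutenCoord_eq_mul_dual`). Non-degeneracy of `A` makes `L` invertible. In `A G⁻¹ Aᵀ` the
matrices `J` and `R` cancel, leaving `(|w|⁴/4) e^{-2s} Lᵀ L`: the dual metric is conformally flat,
with factor `log |w|² - s - log 2`. Since `R w = -w`, the gradient of this factor in the new
coordinates is `-w`. The duality thus sends `(ψ, s, w)` to `(ψ + 2 w / |w|², log |w|² - s - log 2,
-w)`, and the Schouten formula for the new triple evaluates to `-(|w|²/2) Lᵀ R J = Aᵀ = A` (`dual`,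
`schoutenCoord_dual`).

If `w` vanishes at the point, composing `ψ` with an inversion changes `w` to a nonzero vector there
(`exists_grad_ne_zero`).

Two classical facts carry the passage from the definition to such coordinates. Vanishing sectional
curvature forces the curvature tensor to vanish, by polarization and the first Bianchi identity
(`connCurv_eq_zero_of_sectional`). A flat metric is locally Euclidean (`exists_flat_coordinates`): a
parallel orthonormal coframe exists by the Frobenius theorem `exists_parallel_of_flat`, and it is
closed because the connection is torsion free. Naturality of the Levi-Civita connection under
transition maps then gives independence of the chart and carries the coordinate statements over to
the manifold. -/

theorem eventually_norm_lt_add_one {X Z : Type*} [TopologicalSpace X] [NormedAddCommGroup Z]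
    {Ω : Set X} (hΩ : IsOpen Ω) {f : X → Z} (hf : ContinuousOn f Ω) {x : X} (hx : x ∈ Ω) :
    ∀ᶠ y in 𝓝 x, ‖f y‖ < ‖f x‖ + 1 :=
  Filter.Tendsto.eventually_lt_const (lt_add_one _) (hf.continuousAt (hΩ.mem_nhds hx)).norm

theorem smul_mem_ball_zero {E : Type*} [NormedAddCommGroup E] [NormedSpace ℝ E] {r t : ℝ}
    {x : E} (hx : x ∈ ball (0 : E) r) (ht : t ∈ Icc (0 : ℝ) 1) :
    t • x ∈ ball (0 : E) r := by
  rw [mem_ball_zero_iff] at hx ⊢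
  rw [norm_smul, Real.norm_of_nonneg ht.1]
  nlinarith [norm_nonneg x, ht.2, ht.1]

/-- Compactness of a slightly smaller closed ball times `[0, 1]` supplies the constant dominating
function needed for continuity and differentiation under the integral sign. -/
theorem exists_bound_on_ball_prod {E W : Type*} [NormedAddCommGroup E] [ProperSpace E]
    [NormedAddCommGroup W] {r : ℝ} {φ : E → ℝ → W}
    (hφ : ContinuousOn (fun p : E × ℝ => φ p.1 p.2) (ball 0 r ×ˢ Icc 0 1)) {x : E}
    (hx : x ∈ ball (0 : E) r) :
    ∃ C : ℝ, ∃ ρ : ℝ, ‖x‖ < ρ ∧ ball (0 : E) ρ ⊆ ball 0 r ∧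
      ∀ y ∈ ball (0 : E) ρ, ∀ t ∈ Icc (0 : ℝ) 1, ‖φ y t‖ ≤ C := by
  obtain ⟨ρ, h1, h2⟩ := exists_between (mem_ball_zero_iff.1 hx)
  have hK : IsCompact (closedBall (0 : E) ρ ×ˢ Icc (0 : ℝ) 1) :=
    (isCompact_closedBall _ _).prod isCompact_Icc
  obtain ⟨C, hC⟩ := hK.exists_bound_of_continuousOn
    (hφ.mono (prod_mono (closedBall_subset_ball h2) le_rfl))
  exact ⟨C, ρ, h1, ball_subset_ball h2.le,
    fun y hy t ht => hC (y, t) ⟨ball_subset_closedBall hy, ht⟩⟩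

theorem intervalIntegrable_of_continuousOn_prod {E W : Type*} [NormedAddCommGroup E]
    [NormedAddCommGroup W] {r : ℝ} {φ : E → ℝ → W}
    (hφ : ContinuousOn (fun p : E × ℝ => φ p.1 p.2) (ball 0 r ×ˢ Icc 0 1)) {x : E}
    (hx : x ∈ ball (0 : E) r) : IntervalIntegrable (φ x) volume 0 1 := by
  apply ContinuousOn.intervalIntegrable
  rw [uIcc_of_le zero_le_one]
  exact hφ.comp (f := fun t : ℝ => (x, t)) (by fun_prop) fun t ht => ⟨hx, ht⟩

theorem aestronglyMeasurable_of_continuousOn_prod {E W : Type*} [NormedAddCommGroup E]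
    [NormedAddCommGroup W] {r : ℝ} {φ : E → ℝ → W}
    (hφ : ContinuousOn (fun p : E × ℝ => φ p.1 p.2) (ball 0 r ×ˢ Icc 0 1)) {x : E}
    (hx : x ∈ ball (0 : E) r) :
    AEStronglyMeasurable (φ x) (volume.restrict (uIoc (0 : ℝ) 1)) := by
  have := (intervalIntegrable_of_continuousOn_prod hφ hx).aestronglyMeasurable
  rwa [uIoc_of_le zero_le_one]

variable {E W : Type*} [NormedAddCommGroup E] [NormedSpace ℝ E] [ProperSpace E]
  [NormedAddCommGroup W] [NormedSpace ℝ W]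

omit [NormedSpace ℝ E] in
theorem continuousOn_integral_of_continuousOn_prod {r : ℝ} {φ : E → ℝ → W}
    (hφ : ContinuousOn (fun p : E × ℝ => φ p.1 p.2) (ball 0 r ×ˢ Icc 0 1)) :
    ContinuousOn (fun x => ∫ t in (0 : ℝ)..1, φ x t) (ball 0 r) := by
  intro x hx
  obtain ⟨C, ρ, h1, h2, hC⟩ := exists_bound_on_ball_prod hφ hx
  have hn : ball (0 : E) ρ ∈ 𝓝 x := isOpen_ball.mem_nhds (mem_ball_zero_iff.2 h1)
  refine ContinuousAt.continuousWithinAt ?_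
  refine intervalIntegral.continuousAt_of_dominated_interval (bound := fun _ => C) ?_ ?_ (by simp) ?_
  · filter_upwards [hn] with y hy using aestronglyMeasurable_of_continuousOn_prod hφ (h2 hy)
  · filter_upwards [hn] with y hy
    refine Eventually.of_forall fun t ht => hC y hy t ?_
    rw [uIoc_of_le zero_le_one] at ht
    exact ⟨ht.1.le, ht.2⟩
  · refine Eventually.of_forall fun t ht => ?_
    rw [uIoc_of_le zero_le_one] at ht
    have : ContinuousOn (fun y => φ y t) (ball 0 r) :=
      hφ.comp (f := fun y : E => (y, t)) (by fun_prop) fun y hy => ⟨hy, ht.1.le, ht.2⟩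
    exact this.continuousAt (isOpen_ball.mem_nhds hx)

variable [CompleteSpace W]

/-- The radial homotopy operator applied to a `C¹` one-form `α`: its derivative differs from `α`
by at most the norm of the exterior derivative of `α`. -/
theorem exists_fderiv_radial_integral {r : ℝ} {α : E → E →L[ℝ] W}
    (hα : ContDiffOn ℝ 1 α (ball 0 r)) :
    ContDiffOn ℝ 1 (fun x => ∫ t in (0 : ℝ)..1, α (t • x) x) (ball 0 r) ∧
    ∀ x ∈ ball (0 : E) r, ∀ C : ℝ, 0 ≤ C →
      (∀ y ∈ ball (0 : E) r, ∀ u, ‖fderiv ℝ α y u x - fderiv ℝ α y x u‖ ≤ C * ‖u‖) →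
      ‖fderiv ℝ (fun x => ∫ t in (0 : ℝ)..1, α (t • x) x) x - α x‖ ≤ C := by
  have hsm : ContinuousOn (fun p : E × ℝ => p.2 • p.1) (ball 0 r ×ˢ Icc 0 1) := by fun_prop
  have hmt : MapsTo (fun p : E × ℝ => p.2 • p.1) (ball 0 r ×ˢ Icc 0 1) (ball 0 r) :=
    fun p hp => smul_mem_ball_zero hp.1 hp.2
  have hα0 : ContinuousOn (fun p : E × ℝ => α (p.2 • p.1)) (ball 0 r ×ˢ Icc 0 1) :=
    hα.continuousOn.comp hsm hmt
  have hα1 : ContinuousOn (fun p : E × ℝ => fderiv ℝ α (p.2 • p.1)) (ball 0 r ×ˢ Icc 0 1) :=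
    (hα.continuousOn_fderiv_of_isOpen isOpen_ball le_rfl).comp hsm hmt
  have hdα : ∀ y ∈ ball (0 : E) r, HasFDerivAt α (fderiv ℝ α y) y := fun y hy =>
    ((hα.differentiableOn one_ne_zero).differentiableAt (isOpen_ball.mem_nhds hy)).hasFDerivAt
  -- The derivative in `x` of `α (t • x) x`; the second term comes from the moving base point `t •
  -- x`.
  let F' : E → ℝ → E →L[ℝ] W := fun x t =>
    α (t • x) + t • (fderiv ℝ α (t • x)).flip x
  have hF'c : ContinuousOn (fun p : E × ℝ => F' p.1 p.2) (ball 0 r ×ˢ Icc 0 1) := by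
    refine hα0.add (continuousOn_snd.smul ?_)
    have : ContinuousOn (fun p : E × ℝ => (fderiv ℝ α (p.2 • p.1)).flip) (ball 0 r ×ˢ Icc 0 1) :=
      (ContinuousLinearMap.flipₗᵢ ℝ E E W).continuous.comp_continuousOn hα1
    exact this.clm_apply continuousOn_fst
  have hFc : ContinuousOn (fun p : E × ℝ => α (p.2 • p.1) p.1) (ball 0 r ×ˢ Icc 0 1) :=
    hα0.clm_apply continuousOn_fst
  have hder : ∀ t ∈ Icc (0 : ℝ) 1, ∀ x ∈ ball (0 : E) r,
      HasFDerivAt (fun x => α (t • x) x) (F' x t) x := by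
    intro t ht x hx
    have h1 := (hdα _ (smul_mem_ball_zero hx ht)).comp x ((hasFDerivAt_id x).const_smul t)
    refine (h1.clm_apply (hasFDerivAt_id x)).congr_fderiv ?_
    ext v
    simp [F']
  have hmain : ∀ x ∈ ball (0 : E) r,
      HasFDerivAt (fun x => ∫ t in (0 : ℝ)..1, α (t • x) x) (∫ t in (0 : ℝ)..1, F' x t) x := by
    intro x hx
    obtain ⟨C, ρ, h1, h2, hC⟩ := exists_bound_on_ball_prod hF'c hx
    have hn : ball (0 : E) ρ ∈ 𝓝 x := isOpen_ball.mem_nhds (mem_ball_zero_iff.2 h1)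
    refine intervalIntegral.hasFDerivAt_integral_of_dominated_of_fderiv_le (F' := F')
      (bound := fun _ => C) hn ?_ ?_ ?_ ?_ (by simp) ?_
    · filter_upwards [hn] with y hy using
        aestronglyMeasurable_of_continuousOn_prod (φ := fun x t => α (t • x) x) hFc (h2 hy)
    · exact intervalIntegrable_of_continuousOn_prod (φ := fun x t => α (t • x) x) hFc hx
    · exact aestronglyMeasurable_of_continuousOn_prod hF'c hx
    · refine Eventually.of_forall fun t ht y hy => hC y hy t ?_
      rw [uIoc_of_le zero_le_one] at ht
      exact ⟨ht.1.le, ht.2⟩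
    · refine Eventually.of_forall fun t ht y hy => hder t ?_ y (h2 hy)
      rw [uIoc_of_le zero_le_one] at ht
      exact ⟨ht.1.le, ht.2⟩
  refine ⟨?_, fun x hx C hC0 hC => ?_⟩
  · have h0 : ContDiffOn ℝ (0 + 1) (fun x => ∫ t in (0 : ℝ)..1, α (t • x) x) (ball 0 r) := by
      rw [contDiffOn_succ_iff_fderiv_of_isOpen isOpen_ball]
      refine ⟨fun x hx => (hmain x hx).differentiableAt.differentiableWithinAt, by simp, ?_⟩
      rw [contDiffOn_zero]
      exact (continuousOn_integral_of_continuousOn_prod hF'c).congr fun x hx => (hmain x hx).fderiv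
    simpa using h0
  · rw [(hmain x hx).fderiv]
    refine ContinuousLinearMap.opNorm_le_bound _ hC0 fun u => ?_
    have hint := intervalIntegrable_of_continuousOn_prod hF'c hx
    have hline : ContinuousOn (fun t : ℝ => fderiv ℝ α (t • x)) (Icc 0 1) :=
      hα1.comp (f := fun t : ℝ => (x, t)) (by fun_prop) fun t ht => ⟨hx, ht⟩
    have hline0 : ContinuousOn (fun t : ℝ => α (t • x)) (Icc 0 1) :=
      hα0.comp (f := fun t : ℝ => (x, t)) (by fun_prop) fun t ht => ⟨hx, ht⟩
    have hcont : ContinuousOn (fun t : ℝ => α (t • x) u + t • fderiv ℝ α (t • x) x u) (Icc 0 1) :=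
      (hline0.clm_apply continuousOn_const).add (continuousOn_id.smul
        ((hline.clm_apply continuousOn_const).clm_apply continuousOn_const))
    -- The integrand is the derivative of `t • α (t • x) u`. Writing `α x u` as this integral leaves
    -- only the antisymmetrized derivative of `α` in the difference to be estimated.
    have hftc : ∫ t in (0 : ℝ)..1, (α (t • x) u + t • fderiv ℝ α (t • x) x u) = α x u := by
      have := intervalIntegral.integral_eq_sub_of_hasDerivAt (a := (0 : ℝ)) (b := 1)
        (f := fun t : ℝ => t • α (t • x) u)
        (f' := fun t : ℝ => α (t • x) u + t • fderiv ℝ α (t • x) x u) ?_ ?_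
      · simpa using this
      · intro t ht
        rw [uIcc_of_le zero_le_one] at ht
        have h1 : HasDerivAt (fun t : ℝ => α (t • x)) (fderiv ℝ α (t • x) x) t := by
          have := (hdα _ (smul_mem_ball_zero hx ht)).comp_hasDerivAt t
            ((hasDerivAt_id t).smul_const x)
          rwa [one_smul] at this
        have h2 : HasDerivAt (fun t : ℝ => α (t • x) u) (fderiv ℝ α (t • x) x u) t := by
          simpa using h1.clm_apply (hasDerivAt_const t u)
        have := (hasDerivAt_id t).smul h2
        rwa [one_smul, add_comm] at this
      · apply ContinuousOn.intervalIntegrable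
        rwa [uIcc_of_le zero_le_one]
    have e1 : (∫ t in (0 : ℝ)..1, F' x t) u = ∫ t in (0 : ℝ)..1, F' x t u :=
      ContinuousLinearMap.intervalIntegral_apply hint u
    rw [sub_apply, e1, ← hftc, ← intervalIntegral.integral_sub]
    · have := intervalIntegral.norm_integral_le_of_norm_le_const (a := (0 : ℝ)) (b := 1)
        (f := fun t : ℝ => F' x t u - (α (t • x) u + t • fderiv ℝ α (t • x) x u)) (C := C * ‖u‖) ?_
      · simpa using this
      intro t ht
      rw [uIoc_of_le zero_le_one] at ht
      have ht' : t ∈ Icc (0 : ℝ) 1 := ⟨ht.1.le, ht.2⟩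
      have e2 : F' x t u - (α (t • x) u + t • fderiv ℝ α (t • x) x u) =
          t • (fderiv ℝ α (t • x) u x - fderiv ℝ α (t • x) x u) := by
        simp [F', smul_sub]
      rw [e2, norm_smul, Real.norm_of_nonneg ht'.1]
      have := hC _ (smul_mem_ball_zero hx ht') u
      nlinarith [norm_nonneg (fderiv ℝ α (t • x) u x - fderiv ℝ α (t • x) x u), ht'.2, ht'.1]
    · apply ContinuousOn.intervalIntegrable
      rw [uIcc_of_le zero_le_one]
      have : ContinuousOn (fun t : ℝ => F' x t) (Icc 0 1) :=
        hF'c.comp (f := fun t : ℝ => (x, t)) (by fun_prop) fun t ht => ⟨hx, ht⟩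
      fun_prop
    · apply ContinuousOn.intervalIntegrable
      rwa [uIcc_of_le zero_le_one]

/-- The image of a section under the connection form `Λ` is the one-form that a parallel section
would have as its derivative; its exterior derivative is controlled by the defect of `f`. -/
theorem norm_fderiv_radial_integral_sub_le {r K : ℝ} (hK : 0 ≤ K) (hKr : K * r ≤ 1 / 8)
    {Λ : E → W →L[ℝ] E →L[ℝ] W} (hΛ : ContDiffOn ℝ 1 Λ (ball 0 r))
    (hΛK : ∀ x ∈ ball (0 : E) r, ‖Λ x‖ ≤ K)
    (hflat : ∀ x ∈ ball (0 : E) r, ∀ u v : E, ∀ w : W,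
      fderiv ℝ Λ x u w v - fderiv ℝ Λ x v w u + (Λ x (Λ x w u) v - Λ x (Λ x w v) u) = 0)
    {f : E → W} (hf : ContDiffOn ℝ 1 f (ball 0 r)) {b : ℝ} (hb : 0 ≤ b)
    (hfb : ∀ x ∈ ball (0 : E) r, ‖fderiv ℝ f x - Λ x (f x)‖ ≤ b) {x : E}
    (hx : x ∈ ball (0 : E) r) :
    ‖fderiv ℝ (fun x => ∫ t in (0 : ℝ)..1, Λ (t • x) (f (t • x)) x) x - Λ x (f x)‖ ≤ b / 4 := by
  refine (exists_fderiv_radial_integral (hΛ.clm_apply hf)).2 x hx (b / 4) (by positivity) ?_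
  intro y hy u
  have h1 : HasFDerivAt Λ (fderiv ℝ Λ y) y :=
    ((hΛ.differentiableOn one_ne_zero).differentiableAt (isOpen_ball.mem_nhds hy)).hasFDerivAt
  have h2 : HasFDerivAt f (fderiv ℝ f y) y :=
    ((hf.differentiableOn one_ne_zero).differentiableAt (isOpen_ball.mem_nhds hy)).hasFDerivAt
  have hd : ∀ u v, fderiv ℝ (fun y => Λ y (f y)) y u v =
      fderiv ℝ Λ y u (f y) v + Λ y (fderiv ℝ f y u) v := by
    intro u v
    rw [(h1.clm_apply h2).fderiv]
    simp [add_comm]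
  -- Split `fderiv ℝ f` into `Λ f` plus the defect. Flatness cancels the contribution of `Λ f` to
  -- the exterior derivative, so what remains is linear in the defect.
  have hkey : fderiv ℝ (fun y => Λ y (f y)) y u x - fderiv ℝ (fun y => Λ y (f y)) y x u =
      Λ y ((fderiv ℝ f y - Λ y (f y)) u) x - Λ y ((fderiv ℝ f y - Λ y (f y)) x) u := by
    rw [hd, hd, sub_apply, sub_apply, map_sub, map_sub, sub_apply, sub_apply, ← sub_eq_zero,
      ← hflat y hy u x (f y)]
    abel
  have hb' : ∀ a c : E, ‖Λ y ((fderiv ℝ f y - Λ y (f y)) a) c‖ ≤ K * (b * ‖a‖) * ‖c‖ := by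
    intro a c
    refine ((Λ y).le_opNorm₂ _ _).trans ?_
    gcongr
    · exact hΛK y hy
    · refine (ContinuousLinearMap.le_opNorm _ _).trans ?_
      gcongr
      exact hfb y hy
  rw [hkey]
  refine (norm_sub_le _ _).trans ((add_le_add (hb' u x) (hb' x u)).trans ?_)
  have h2 : K * ‖x‖ ≤ 1 / 8 := le_trans (by
    gcongr
    exact (mem_ball_zero_iff.1 hx).le) hKr
  -- Two defect terms, each of size at most `b / 8 * ‖u‖`, account for the `b / 4`.
  calc _ = (K * ‖x‖) * (2 * (b * ‖u‖)) := by ring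
    _ ≤ (1 / 8) * (2 * (b * ‖u‖)) := by gcongr
    _ = _ := by ring

omit [ProperSpace E] [CompleteSpace W] in
theorem norm_radial_integral_le {r K : ℝ} (hKr : K * r ≤ 1 / 8)
    {Λ : E → W →L[ℝ] E →L[ℝ] W} (hK : 0 ≤ K) (hΛK : ∀ x ∈ ball (0 : E) r, ‖Λ x‖ ≤ K)
    {f : E → W} {b : ℝ} (hb : 0 ≤ b) (hfb : ∀ x ∈ ball (0 : E) r, ‖f x‖ ≤ b) {x : E}
    (hx : x ∈ ball (0 : E) r) :
    ‖∫ t in (0 : ℝ)..1, Λ (t • x) (f (t • x)) x‖ ≤ b / 8 := by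
  have := intervalIntegral.norm_integral_le_of_norm_le_const (a := (0 : ℝ)) (b := 1)
    (f := fun t : ℝ => Λ (t • x) (f (t • x)) x) (C := b / 8) ?_
  · simpa using this
  intro t ht
  rw [uIoc_of_le zero_le_one] at ht
  have hb := smul_mem_ball_zero hx (t := t) ⟨ht.1.le, ht.2⟩
  have h2 : K * ‖x‖ ≤ 1 / 8 := le_trans (by
    gcongr
    exact (mem_ball_zero_iff.1 hx).le) hKr
  calc _ ≤ K * b * ‖x‖ := by
        refine ((Λ (t • x)).le_opNorm₂ _ _).trans ?_
        gcongr
        · exact hΛK _ hb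
        · exact hfb _ hb
    _ = (K * ‖x‖) * b := by ring
    _ ≤ (1 / 8) * b := by gcongr
    _ = _ := by ring

omit [ProperSpace E] [CompleteSpace W] in
theorem norm_radial_integral_sub_le {r K : ℝ} (hKr : K * r ≤ 1 / 8)
    {Λ : E → W →L[ℝ] E →L[ℝ] W} (hK : 0 ≤ K) (hΛK : ∀ x ∈ ball (0 : E) r, ‖Λ x‖ ≤ K)
    (hΛ : ContDiffOn ℝ 1 Λ (ball 0 r)) {f g : E → W} (hf : ContDiffOn ℝ 1 f (ball 0 r))
    (hg : ContDiffOn ℝ 1 g (ball 0 r)) {b : ℝ} (hb : 0 ≤ b)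
    (hfb : ∀ x ∈ ball (0 : E) r, ‖f x - g x‖ ≤ b) {x : E} (hx : x ∈ ball (0 : E) r) :
    ‖(∫ t in (0 : ℝ)..1, Λ (t • x) (f (t • x)) x) - ∫ t in (0 : ℝ)..1, Λ (t • x) (g (t • x)) x‖
      ≤ b / 8 := by
  have hline : ∀ {f : E → W}, ContDiffOn ℝ 1 f (ball 0 r) →
      IntervalIntegrable (fun t : ℝ => Λ (t • x) (f (t • x)) x) volume 0 1 := by
    intro f hf
    apply ContinuousOn.intervalIntegrable
    rw [uIcc_of_le zero_le_one]
    exact ((hΛ.clm_apply hf).continuousOn.comp (f := fun t : ℝ => t • x) (by fun_prop)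
      fun t ht => smul_mem_ball_zero hx ht).clm_apply continuousOn_const
  rw [← intervalIntegral.integral_sub (hline hf) (hline hg)]
  simpa using norm_radial_integral_le hKr hK hΛK (f := fun x => f x - g x) hb hfb hx

/-- Picard iteration of `T s x = w₀ + ∫ Λ (t x) (s (t x)) x dt`, which solves the system along each
ray. The values converge with ratio `1/8`. The defect `ds - Λ s` in all directions decays with ratio
`1/2` because of flatness, so the derivatives converge uniformly as well and the limit solves the
full system. -/
theorem exists_parallel_on_ball_zero {r K : ℝ} (hr : 0 < r) (hK : 0 ≤ K) (hKr : K * r ≤ 1 / 8)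
    {Λ : E → W →L[ℝ] E →L[ℝ] W} (hΛ : ContDiffOn ℝ 1 Λ (ball 0 r))
    (hΛK : ∀ x ∈ ball (0 : E) r, ‖Λ x‖ ≤ K)
    (hflat : ∀ x ∈ ball (0 : E) r, ∀ u v : E, ∀ w : W,
      fderiv ℝ Λ x u w v - fderiv ℝ Λ x v w u + (Λ x (Λ x w u) v - Λ x (Λ x w v) u) = 0)
    (w₀ : W) :
    ∃ s : E → W, s 0 = w₀ ∧ ∀ x ∈ ball (0 : E) r, HasFDerivAt s (Λ x (s x)) x := by
  let T : (E → W) → E → W := fun s x => w₀ + ∫ t in (0 : ℝ)..1, Λ (t • x) (s (t • x)) x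
  let s : ℕ → E → W := fun k => T^[k] fun _ => w₀
  have hs0 : s 0 = fun _ => w₀ := rfl
  have hsucc : ∀ k, s (k + 1) = T (s k) := fun k => Function.iterate_succ_apply' T k _
  have hsub : ∀ (f g : E → W), ∀ y ∈ ball (0 : E) r, ‖Λ y (f y) - Λ y (g y)‖ ≤ K * ‖f y - g y‖ := by
    intro f g y hy
    rw [← map_sub]
    refine (ContinuousLinearMap.le_opNorm _ _).trans ?_
    gcongr
    exact hΛK y hy
  have hsm : ∀ k, ContDiffOn ℝ 1 (s k) (ball 0 r) := by
    intro k
    induction k with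
    | zero => exact contDiffOn_const
    | succ k ih =>
      rw [hsucc]
      exact contDiffOn_const.add (exists_fderiv_radial_integral (hΛ.clm_apply ih)).1
  have hstep : ∀ k, ∀ x ∈ ball (0 : E) r, ‖s (k + 1) x - s k x‖ ≤ ‖w₀‖ * (1 / 8) ^ k := by
    intro k
    induction k with
    | zero =>
      intro x hx
      have e : s (0 + 1) x - s 0 x = ∫ t in (0 : ℝ)..1, Λ (t • x) (s 0 (t • x)) x := by
        rw [hsucc, hs0]; simp [T]
      rw [e]
      refine (norm_radial_integral_le hKr hK hΛK (norm_nonneg w₀) (fun _ _ => le_rfl) hx).trans ?_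
      linarith [norm_nonneg w₀]
    | succ k ih =>
      intro x hx
      have e : s (k + 1 + 1) x - s (k + 1) x = (∫ t in (0 : ℝ)..1, Λ (t • x) (s (k + 1) (t • x)) x) -
          ∫ t in (0 : ℝ)..1, Λ (t • x) (s k (t • x)) x := by
        rw [hsucc (k + 1), hsucc k]
        simp [T]
      rw [e]
      refine (norm_radial_integral_sub_le hKr hK hΛK hΛ (hsm _) (hsm _) (by positivity) ih hx).trans
        (le_of_eq ?_)
      ring
  -- The constant `4` closes the induction: a quarter of the old defect plus `K` times the increment
  -- of the iterates is at most `2 * K * ‖w₀‖ * (1/2)^k`, half of the previous bound.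
  have hβ : ∀ k, ∀ x ∈ ball (0 : E) r,
      ‖fderiv ℝ (s k) x - Λ x (s k x)‖ ≤ 4 * K * ‖w₀‖ * (1 / 2) ^ k := by
    intro k
    induction k with
    | zero =>
      intro x hx
      have : fderiv ℝ (s 0) x - Λ x (s 0 x) = -(Λ x w₀) := by simp [hs0]
      rw [this, norm_neg]
      refine (ContinuousLinearMap.le_opNorm _ _).trans ?_
      have := mul_le_mul_of_nonneg_right (hΛK x hx) (norm_nonneg w₀)
      have h0 := mul_nonneg hK (norm_nonneg w₀)
      linarith
    | succ k ih =>
      intro x hx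
      have h1 := norm_fderiv_radial_integral_sub_le hK hKr hΛ hΛK hflat (hsm k) (by positivity) ih hx
      have h2 : fderiv ℝ (s (k + 1)) x =
          fderiv ℝ (fun x => ∫ t in (0 : ℝ)..1, Λ (t • x) (s k (t • x)) x) x := by
        rw [hsucc]; exact fderiv_const_add _
      have h3 := hsub (s (k + 1)) (s k) x hx
      have h4 := hstep k x hx
      have h5 : ((1 : ℝ) / 8) ^ k ≤ (1 / 2) ^ k := by gcongr; norm_num
      have h6 : K * ‖s (k + 1) x - s k x‖ ≤ K * (‖w₀‖ * (1 / 2) ^ k) := by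
        gcongr; exact h4.trans (by gcongr)
      rw [h2, ← sub_sub_sub_cancel_right _ _ (Λ x (s k x))]
      refine (norm_sub_le _ _).trans ((add_le_add h1 (h3.trans h6)).trans (le_of_eq ?_))
      ring
  have hdist : ∀ x ∈ ball (0 : E) r, ∀ k, dist (s k x) (s (k + 1) x) ≤ ‖w₀‖ * (1 / 8) ^ k := by
    intro x hx k
    rw [dist_comm, dist_eq_norm]
    exact hstep k x hx
  -- Quantified over all `x` so that `choose` yields a function on the whole space; its value off
  -- the ball is immaterial.
  have hlim : ∀ x, ∃ y, x ∈ ball (0 : E) r → Tendsto (fun k => s k x) atTop (𝓝 y) := by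
    intro x
    by_cases hx : x ∈ ball (0 : E) r
    · obtain ⟨y, hy⟩ := cauchySeq_tendsto_of_complete
        (cauchySeq_of_le_geometric (1 / 8) ‖w₀‖ (by norm_num) (hdist x hx))
      exact ⟨y, fun _ => hy⟩
    · exact ⟨0, fun h => absurd h hx⟩
  choose S hS using hlim
  refine ⟨S, ?_, fun x hx => ?_⟩
  · have h0 : ∀ k, s k 0 = w₀ := by
      intro k
      cases k with
      | zero => rfl
      | succ k => rw [hsucc]; simp [T]
    have := hS 0 (mem_ball_self hr)
    simp only [h0] at this
    exact (tendsto_nhds_unique this tendsto_const_nhds)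
  · refine hasFDerivAt_of_tendstoUniformlyOn (f := s) (f' := fun k => fderiv ℝ (s k))
      (g' := fun x => Λ x (S x)) (l := atTop) isOpen_ball ?_
      (fun k x hx => (((hsm k).differentiableOn one_ne_zero).differentiableAt
        (isOpen_ball.mem_nhds hx)).hasFDerivAt) hS hx
    -- `6 = 4 + 2`: the defect of the iterate, and `K` times its distance to the limit.
    have hbound : ∀ k, ∀ x ∈ ball (0 : E) r,
        dist (Λ x (S x)) (fderiv ℝ (s k) x) ≤ 6 * K * ‖w₀‖ * (1 / 2) ^ k := by
      intro k x hx
      have h1 := dist_le_of_le_geometric_of_tendsto (1 / 8) ‖w₀‖ (by norm_num) (hdist x hx)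
        (hS x hx) k
      have h2 : ‖w₀‖ * (1 / 8) ^ k / (1 - 1 / 8) ≤ 2 * ‖w₀‖ * (1 / 2) ^ k := by
        have h5 : ((1 : ℝ) / 8) ^ k ≤ (1 / 2) ^ k := by gcongr; norm_num
        have := mul_le_mul_of_nonneg_left h5 (norm_nonneg w₀)
        have h6 : 0 ≤ ‖w₀‖ * (1 / 8) ^ k := by positivity
        rw [div_le_iff₀ (by norm_num)]
        nlinarith
      have h4 := hsub (s k) S x hx
      have h7 : K * ‖s k x - S x‖ ≤ K * (2 * ‖w₀‖ * (1 / 2) ^ k) := by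
        rw [← dist_eq_norm]
        gcongr
        exact h1.trans h2
      rw [dist_comm, dist_eq_norm, ← sub_add_sub_cancel _ (Λ x (s k x))]
      refine (norm_add_le _ _).trans ((add_le_add (hβ k x hx) (h4.trans h7)).trans (le_of_eq ?_))
      ring
    rw [Metric.tendstoUniformlyOn_iff]
    intro ε hε
    have ht : Tendsto (fun k : ℕ => 6 * K * ‖w₀‖ * (1 / 2 : ℝ) ^ k) atTop (𝓝 0) := by
      simpa using (tendsto_pow_atTop_nhds_zero_of_lt_one (by norm_num : (0 : ℝ) ≤ 1 / 2)
        (by norm_num)).const_mul (6 * K * ‖w₀‖)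
    filter_upwards [ht.eventually (gt_mem_nhds hε)] with k hk x hx
    exact (hbound k x hx).trans_lt hk

set_option synthInstance.maxHeartbeats 200000 in
/-- Frobenius theorem for linear total differential systems: a flat `C¹` connection form has a
local parallel section with prescribed value at a point. -/
theorem exists_parallel_of_flat {Ω : Set E} (hΩ : IsOpen Ω) {Λ : E → W →L[ℝ] E →L[ℝ] W}
    (hΛ : ContDiffOn ℝ 1 Λ Ω)
    (hflat : ∀ x ∈ Ω, ∀ u v : E, ∀ w : W,
      fderiv ℝ Λ x u w v - fderiv ℝ Λ x v w u + (Λ x (Λ x w u) v - Λ x (Λ x w v) u) = 0)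
    {x₀ : E} (hx₀ : x₀ ∈ Ω) (w₀ : W) :
    ∃ r > 0, ball x₀ r ⊆ Ω ∧
      ∃ s : E → W, s x₀ = w₀ ∧ ∀ x ∈ ball x₀ r, HasFDerivAt s (Λ x (s x)) x := by
  have hev1 : ∀ᶠ x in 𝓝 x₀, x ∈ Ω := hΩ.mem_nhds hx₀
  have hev2 : ∀ᶠ x in 𝓝 x₀, ‖Λ x‖ < ‖Λ x₀‖ + 1 :=
    
    eventually_norm_lt_add_one (Z := W →L[ℝ] E →L[ℝ] W) hΩ hΛ.continuousOn hx₀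
  obtain ⟨ε, hε, hball⟩ := Metric.eventually_nhds_iff_ball.1 (hev1.and hev2)
  set K := ‖Λ x₀‖ + 1 with hK
  have hK0 : 0 < K := by positivity
  -- Since `K` bounds `‖Λ‖` near `x₀`, shrinking the radius achieves the smallness `K * r ≤ 1 / 8`
  -- on which the contraction rests.
  let r := min ε (1 / (8 * K))
  have hr : 0 < r := by positivity
  have hKr : K * r ≤ 1 / 8 := by
    calc K * r ≤ K * (1 / (8 * K)) := by gcongr; exact min_le_right _ _
      _ = 1 / 8 := by field_simp
  have hmem : ∀ x ∈ ball (0 : E) r, x + x₀ ∈ ball x₀ ε := by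
    intro x hx
    rw [mem_ball_zero_iff] at hx
    simpa [dist_eq_norm] using hx.trans_le (min_le_left _ _)
  have hmap : MapsTo (fun x : E => x + x₀) (ball 0 r) Ω := fun x hx => (hball _ (hmem x hx)).1
  have hfd : ∀ x, fderiv ℝ (fun y => Λ (y + x₀)) x = fderiv ℝ Λ (x + x₀) := fun x =>
    fderiv_comp_add_right (𝕜 := ℝ) (F := W →L[ℝ] E →L[ℝ] W) (f := Λ) x₀
  obtain ⟨s, hs0, hs⟩ := exists_parallel_on_ball_zero hr hK0.le hKr
    (Λ := fun x => Λ (x + x₀)) (hΛ.comp (contDiff_id.add contDiff_const).contDiffOn hmap)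
    (fun x hx => (hball _ (hmem x hx)).2.le)
    (fun x hx u v w => by rw [hfd]; exact hflat _ (hmap hx) u v w) w₀
  refine ⟨r, hr, fun x hx => (hball x (ball_subset_ball (min_le_left _ _) hx)).1,
    fun x => s (x - x₀), by simpa using hs0, fun x hx => ?_⟩
  have hx' : x - x₀ ∈ ball (0 : E) r := by
    rw [mem_ball_zero_iff, ← dist_eq_norm]; exact hx
  have := (hs _ hx').comp x ((hasFDerivAt_id x).sub_const x₀)
  rwa [sub_add_cancel] at this

end Frobenius

/-! ### Entrywise calculus of matrix valued functions -/

section MatrixCalculus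

open Set Filter Topology

variable {n : ℕ} {Ω : Set (EuclideanSpace ℝ (Fin n))} {f g : EuclideanSpace ℝ (Fin n) → ℝ}
  {u : EuclideanSpace ℝ (Fin n)} {ι κ τ : Type*}

theorem partialDeriv_congr (hΩ : IsOpen Ω) (hu : u ∈ Ω) (h : EqOn f g Ω) (i : Fin n) :
    partialDeriv i f u = partialDeriv i g u := by
  have : f =ᶠ[𝓝 u] g := h.eventuallyEq_of_mem (hΩ.mem_nhds hu)
  rw [partialDeriv, partialDeriv, this.fderiv_eq]

theorem differentiableAt_of_smooth (hΩ : IsOpen Ω) (hf : ContDiffOn ℝ ∞ f Ω) (hu : u ∈ Ω) :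
    DifferentiableAt ℝ f u :=
  (hf.differentiableOn (by simp)).differentiableAt (hΩ.mem_nhds hu)

theorem contDiffOn_partialDeriv (hΩ : IsOpen Ω) (hf : ContDiffOn ℝ ∞ f Ω) (i : Fin n) :
    ContDiffOn ℝ ∞ (partialDeriv i f) Ω :=
  (hf.fderiv_of_isOpen (m := ∞) hΩ (by simp)).clm_apply contDiffOn_const

theorem partialDeriv_add (hf : DifferentiableAt ℝ f u) (hg : DifferentiableAt ℝ g u) (i : Fin n) :
    partialDeriv i (fun x => f x + g x) u = partialDeriv i f u + partialDeriv i g u := by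
  simp [partialDeriv, fderiv_fun_add hf hg]

theorem partialDeriv_sub (hf : DifferentiableAt ℝ f u) (hg : DifferentiableAt ℝ g u) (i : Fin n) :
    partialDeriv i (fun x => f x - g x) u = partialDeriv i f u - partialDeriv i g u := by
  simp [partialDeriv, fderiv_fun_sub hf hg]

theorem partialDeriv_neg (i : Fin n) :
    partialDeriv i (fun x => -f x) u = -partialDeriv i f u := by
  simp [partialDeriv]

theorem partialDeriv_mul (hf : DifferentiableAt ℝ f u) (hg : DifferentiableAt ℝ g u) (i : Fin n) :
    partialDeriv i (fun x => f x * g x) u = partialDeriv i f u * g u + f u * partialDeriv i g u := by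
  rw [partialDeriv, fderiv_fun_mul hf hg]
  change f u * partialDeriv i g u + g u * partialDeriv i f u = _
  ring

theorem partialDeriv_const (c : ℝ) (i : Fin n) : partialDeriv i (fun _ => c) u = 0 := by
  simp [partialDeriv]

theorem partialDeriv_sum {s : Finset ι} {F : ι → EuclideanSpace ℝ (Fin n) → ℝ}
    (hF : ∀ a ∈ s, DifferentiableAt ℝ (F a) u) (i : Fin n) :
    partialDeriv i (fun x => ∑ a ∈ s, F a x) u = ∑ a ∈ s, partialDeriv i (F a) u := by
  simp [partialDeriv, fderiv_fun_sum hF]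

theorem partialDeriv_comm (hΩ : IsOpen Ω) (hf : ContDiffOn ℝ ∞ f Ω) (hu : u ∈ Ω) (i j : Fin n) :
    partialDeriv i (partialDeriv j f) u = partialDeriv j (partialDeriv i f) u := by
  have hd : DifferentiableAt ℝ (fderiv ℝ f) u :=
    ((hf.fderiv_of_isOpen (m := ∞) hΩ (by simp)).differentiableOn (by simp)).differentiableAt
      (hΩ.mem_nhds hu)
  have hs : IsSymmSndFDerivAt ℝ f u :=
    (hf.contDiffAt (hΩ.mem_nhds hu)).isSymmSndFDerivAt (by
      rw [minSmoothness_of_isRCLikeNormedField]; exact WithTop.coe_le_coe.2 (le_top (a := (2 : ℕ∞))))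
  have h : ∀ i j : Fin n, partialDeriv i (partialDeriv j f) u =
      fderiv ℝ (fderiv ℝ f) u (EuclideanSpace.single i 1) (EuclideanSpace.single j 1) := by
    intro i j
    have : HasFDerivAt (partialDeriv j f) _ u :=
      hd.hasFDerivAt.clm_apply (hasFDerivAt_const (EuclideanSpace.single j (1 : ℝ)) u)
    rw [partialDeriv, this.fderiv]
    simp
  rw [h, h, hs.eq]

/-- The entrywise partial derivative of a matrix valued function. -/
def matDeriv (i : Fin n) (A : EuclideanSpace ℝ (Fin n) → Matrix ι κ ℝ)
    (u : EuclideanSpace ℝ (Fin n)) : Matrix ι κ ℝ :=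
  Matrix.of fun a b => partialDeriv i (fun x => A x a b) u

/-- Smoothness of a matrix valued function, entry by entry. -/
def MatSmoothOn (A : EuclideanSpace ℝ (Fin n) → Matrix ι κ ℝ) (Ω : Set (EuclideanSpace ℝ (Fin n))) :
    Prop :=
  ∀ a b, ContDiffOn ℝ ∞ (fun x => A x a b) Ω

variable {A B : EuclideanSpace ℝ (Fin n) → Matrix ι κ ℝ}
  {C : EuclideanSpace ℝ (Fin n) → Matrix κ τ ℝ}

theorem MatSmoothOn.mono {Ω' : Set (EuclideanSpace ℝ (Fin n))} (hA : MatSmoothOn A Ω)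
    (h : Ω' ⊆ Ω) : MatSmoothOn A Ω' :=
  fun a b => (hA a b).mono h

theorem MatSmoothOn.congr (hA : MatSmoothOn A Ω) (h : EqOn B A Ω) : MatSmoothOn B Ω :=
  fun a b => (hA a b).congr fun x hx => by rw [h hx]

theorem MatSmoothOn.add (hA : MatSmoothOn A Ω) (hB : MatSmoothOn B Ω) :
    MatSmoothOn (fun x => A x + B x) Ω :=
  fun a b => (hA a b).add (hB a b)

theorem MatSmoothOn.sub (hA : MatSmoothOn A Ω) (hB : MatSmoothOn B Ω) :
    MatSmoothOn (fun x => A x - B x) Ω :=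
  fun a b => (hA a b).sub (hB a b)

theorem MatSmoothOn.smul (hf : ContDiffOn ℝ ∞ f Ω) (hA : MatSmoothOn A Ω) :
    MatSmoothOn (fun x => f x • A x) Ω :=
  fun a b => hf.mul (hA a b)

theorem MatSmoothOn.mul [Fintype κ] (hA : MatSmoothOn A Ω) (hC : MatSmoothOn C Ω) :
    MatSmoothOn (fun x => A x * C x) Ω := by
  intro a b
  simp only [Matrix.mul_apply]
  exact ContDiffOn.sum fun c _ => (hA a c).mul (hC c b)

theorem MatSmoothOn.transpose (hA : MatSmoothOn A Ω) : MatSmoothOn (fun x => (A x).transpose) Ω :=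
  fun a b => hA b a

theorem MatSmoothOn.const (M : Matrix ι κ ℝ) : MatSmoothOn (fun _ => M) Ω :=
  fun _ _ => contDiffOn_const

theorem MatSmoothOn.det [Fintype ι] [DecidableEq ι]
    {A : EuclideanSpace ℝ (Fin n) → Matrix ι ι ℝ} (hA : MatSmoothOn A Ω) :
    ContDiffOn ℝ ∞ (fun x => (A x).det) Ω := by
  simp only [Matrix.det_apply]
  exact ContDiffOn.sum fun σ _ => by
    simp only [Units.smul_def, zsmul_eq_mul]
    exact contDiffOn_const.mul (contDiffOn_prod fun i _ => hA _ _)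

/-- Cramer's rule: the entries of the adjugate are determinants of the matrix with one row replaced
by a constant one. -/
theorem MatSmoothOn.inv [Fintype ι] [DecidableEq ι]
    {A : EuclideanSpace ℝ (Fin n) → Matrix ι ι ℝ} (hA : MatSmoothOn A Ω)
    (hdet : ∀ x ∈ Ω, (A x).det ≠ 0) : MatSmoothOn (fun x => (A x)⁻¹) Ω := by
  intro a b
  simp only [Matrix.inv_def, Ring.inverse_eq_inv', Matrix.smul_apply, smul_eq_mul]
  refine (hA.det.inv hdet).mul ?_
  simp only [Matrix.adjugate_apply]
  refine MatSmoothOn.det fun i j => ?_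
  by_cases h : i = b
  · subst h
    simpa using contDiffOn_const
  · simpa [Matrix.updateRow_ne h] using hA i j

theorem MatSmoothOn.matDeriv (hΩ : IsOpen Ω) (hA : MatSmoothOn A Ω) (i : Fin n) :
    MatSmoothOn (matDeriv i A) Ω :=
  fun a b => contDiffOn_partialDeriv hΩ (hA a b) i

theorem matDeriv_congr (hΩ : IsOpen Ω) (hu : u ∈ Ω) (h : EqOn A B Ω) (i : Fin n) :
    matDeriv i A u = matDeriv i B u := by
  ext a b
  exact partialDeriv_congr hΩ hu (fun x hx => by rw [h hx]) i

theorem matDeriv_add (hΩ : IsOpen Ω) (hA : MatSmoothOn A Ω) (hB : MatSmoothOn B Ω) (hu : u ∈ Ω)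
    (i : Fin n) : matDeriv i (fun x => A x + B x) u = matDeriv i A u + matDeriv i B u := by
  ext a b
  exact partialDeriv_add (differentiableAt_of_smooth hΩ (hA a b) hu)
    (differentiableAt_of_smooth hΩ (hB a b) hu) i

theorem matDeriv_smul (hΩ : IsOpen Ω) (hf : ContDiffOn ℝ ∞ f Ω) (hA : MatSmoothOn A Ω)
    (hu : u ∈ Ω) (i : Fin n) :
    matDeriv i (fun x => f x • A x) u = partialDeriv i f u • A u + f u • matDeriv i A u := by
  ext a b
  exact partialDeriv_mul (differentiableAt_of_smooth hΩ hf hu)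
    (differentiableAt_of_smooth hΩ (hA a b) hu) i

theorem matDeriv_mul [Fintype κ] (hΩ : IsOpen Ω) (hA : MatSmoothOn A Ω) (hC : MatSmoothOn C Ω)
    (hu : u ∈ Ω) (i : Fin n) :
    matDeriv i (fun x => A x * C x) u = matDeriv i A u * C u + A u * matDeriv i C u := by
  ext a b
  simp only [matDeriv, Matrix.of_apply, Matrix.mul_apply, Matrix.add_apply]
  rw [partialDeriv_sum (F := fun c x => A x a c * C x c b) fun c _ =>
    (differentiableAt_of_smooth hΩ (hA a c) hu).fun_mul (differentiableAt_of_smooth hΩ (hC c b) hu),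
    ← Finset.sum_add_distrib]
  exact Finset.sum_congr rfl fun c _ => partialDeriv_mul (differentiableAt_of_smooth hΩ (hA a c) hu)
    (differentiableAt_of_smooth hΩ (hC c b) hu) i

theorem matDeriv_transpose (i : Fin n) :
    matDeriv i (fun x => (A x).transpose) u = (matDeriv i A u).transpose := rfl

theorem matDeriv_const (M : Matrix ι κ ℝ) (i : Fin n) : matDeriv i (fun _ => M) u = 0 := by
  ext a b
  exact partialDeriv_const _ i

theorem matDeriv_comm (hΩ : IsOpen Ω) (hA : MatSmoothOn A Ω) (hu : u ∈ Ω) (i j : Fin n) :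
    matDeriv i (matDeriv j A) u = matDeriv j (matDeriv i A) u := by
  ext a b
  exact partialDeriv_comm hΩ (hA a b) hu i j

/-- Differentiate `A * A⁻¹ = 1`. -/
theorem matDeriv_inv [Fintype ι] [DecidableEq ι] {A : EuclideanSpace ℝ (Fin n) → Matrix ι ι ℝ}
    (hΩ : IsOpen Ω) (hA : MatSmoothOn A Ω) (hdet : ∀ x ∈ Ω, (A x).det ≠ 0) (hu : u ∈ Ω)
    (i : Fin n) :
    matDeriv i (fun x => (A x)⁻¹) u = -((A u)⁻¹ * matDeriv i A u * (A u)⁻¹) := by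
  have h1 : EqOn (fun x => A x * (A x)⁻¹) (fun _ => 1) Ω := fun x hx =>
    Matrix.mul_nonsing_inv _ (hdet x hx).isUnit
  have h2 := matDeriv_congr hΩ hu h1 i
  rw [matDeriv_mul hΩ hA (hA.inv hdet) hu, matDeriv_const] at h2
  have h3 : (A u)⁻¹ * A u = 1 := Matrix.nonsing_inv_mul _ (hdet u hu).isUnit
  have h4 := congrArg (fun M => (A u)⁻¹ * M) h2
  simp only [mul_add, mul_zero, ← mul_assoc, h3, one_mul] at h4
  exact (neg_eq_of_add_eq_zero_right h4).symm

end MatrixCalculus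

/-! ### Connection forms and their curvature -/

section Connection

open Set Filter Topology Matrix

variable {n : ℕ} {Ω : Set (EuclideanSpace ℝ (Fin n))} {u : EuclideanSpace ℝ (Fin n)}

/-- The curvature `∂_i Γ_j - ∂_j Γ_i + [Γ_i, Γ_j]` of a matrix valued connection form. -/
def connCurv (Γ : Fin n → EuclideanSpace ℝ (Fin n) → Matrix (Fin n) (Fin n) ℝ) (i j : Fin n)
    (u : EuclideanSpace ℝ (Fin n)) : Matrix (Fin n) (Fin n) ℝ :=
  matDeriv i (Γ j) u - matDeriv j (Γ i) u + (Γ i u * Γ j u - Γ j u * Γ i u)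

/-- The connection form of the Levi-Civita connection. -/
def leviCivita (G : EuclideanSpace ℝ (Fin n) → Matrix (Fin n) (Fin n) ℝ) (i : Fin n)
    (u : EuclideanSpace ℝ (Fin n)) : Matrix (Fin n) (Fin n) ℝ :=
  Matrix.of fun k j => christoffel G k i j u

theorem riemannCoord_eq (G : EuclideanSpace ℝ (Fin n) → Matrix (Fin n) (Fin n) ℝ)
    (i j k l : Fin n) : riemannCoord G i j k l u = connCurv (leviCivita G) i j u l k := by
  simp only [riemannCoord, connCurv, leviCivita, matDeriv, Matrix.add_apply, Matrix.sub_apply,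
    Matrix.of_apply, Matrix.mul_apply, Finset.sum_sub_distrib]
  congr 2 <;> exact Finset.sum_congr rfl fun m _ => mul_comm _ _

/-- A smooth symmetric non-degenerate matrix field on an open set. -/
structure IsMetricOn (G : EuclideanSpace ℝ (Fin n) → Matrix (Fin n) (Fin n) ℝ)
    (Ω : Set (EuclideanSpace ℝ (Fin n))) : Prop where
  isOpen : IsOpen Ω
  smooth : MatSmoothOn G Ω
  symm : ∀ x ∈ Ω, (G x)ᵀ = G x
  det_ne : ∀ x ∈ Ω, (G x).det ≠ 0

variable {G : EuclideanSpace ℝ (Fin n) → Matrix (Fin n) (Fin n) ℝ}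

theorem IsMetricOn.matDeriv_symm (hG : IsMetricOn G Ω) (hu : u ∈ Ω) (i a b : Fin n) :
    matDeriv i G u a b = matDeriv i G u b a := by
  have := matDeriv_congr hG.isOpen hu (A := fun x => (G x)ᵀ) hG.symm i
  rw [matDeriv_transpose] at this
  exact congrFun₂ this b a

theorem IsMetricOn.mono {Ω' : Set (EuclideanSpace ℝ (Fin n))} (hG : IsMetricOn G Ω)
    (ho : IsOpen Ω') (h : Ω' ⊆ Ω) : IsMetricOn G Ω' :=
  ⟨ho, hG.smooth.mono h, fun x hx => hG.symm x (h hx), fun x hx => hG.det_ne x (h hx)⟩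

theorem IsMetricOn.mul_inv (hG : IsMetricOn G Ω) (hu : u ∈ Ω) : G u * (G u)⁻¹ = 1 :=
  Matrix.mul_nonsing_inv _ (hG.det_ne u hu).isUnit

theorem IsMetricOn.inv_mul (hG : IsMetricOn G Ω) (hu : u ∈ Ω) : (G u)⁻¹ * G u = 1 :=
  Matrix.nonsing_inv_mul _ (hG.det_ne u hu).isUnit

/-- Factoring out the inverse metric makes `G * Γ_i` an explicit expression in first derivatives of
`G`, which is how the Christoffel symbols are handled from here on. -/
theorem christoffel_eq_mul (k i j : Fin n) : christoffel G k i j u =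
    ((G u)⁻¹ * Matrix.of fun l m => (1 / 2) *
      (matDeriv i G u m l + matDeriv m G u i l - matDeriv l G u i m)) k j := by
  simp only [christoffel, Matrix.mul_apply, Finset.mul_sum, matDeriv, Matrix.of_apply]
  exact Finset.sum_congr rfl fun l _ => by ring

theorem IsMetricOn.mul_leviCivita (hG : IsMetricOn G Ω) (hu : u ∈ Ω) (i l j : Fin n) :
    (G u * leviCivita G i u) l j = (1 / 2) *
      (matDeriv i G u j l + matDeriv j G u i l - matDeriv l G u i j) := by
  have : leviCivita G i u = (G u)⁻¹ * Matrix.of fun l m => (1 / 2) *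
      (matDeriv i G u m l + matDeriv m G u i l - matDeriv l G u i m) := by
    ext k j
    exact christoffel_eq_mul k i j
  rw [this, ← mul_assoc, hG.mul_inv hu, one_mul]
  rfl

/-- The Levi-Civita connection is torsion free. -/
theorem IsMetricOn.leviCivita_symm (hG : IsMetricOn G Ω) (hu : u ∈ Ω) (i j k : Fin n) :
    leviCivita G i u k j = leviCivita G j u k i := by
  simp only [leviCivita, Matrix.of_apply, christoffel_eq_mul]
  simp only [Matrix.mul_apply, Matrix.of_apply]
  refine Finset.sum_congr rfl fun l _ => ?_
  rw [hG.matDeriv_symm hu l i j]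
  ring

/-- The Levi-Civita connection is metric. -/
theorem IsMetricOn.matDeriv_eq (hG : IsMetricOn G Ω) (hu : u ∈ Ω) (i : Fin n) :
    matDeriv i G u = (leviCivita G i u)ᵀ * G u + G u * leviCivita G i u := by
  have h : (leviCivita G i u)ᵀ * G u = (G u * leviCivita G i u)ᵀ := by
    rw [Matrix.transpose_mul, hG.symm u hu]
  ext a b
  rw [h, Matrix.add_apply, Matrix.transpose_apply, hG.mul_leviCivita hu, hG.mul_leviCivita hu,
    hG.matDeriv_symm hu i b a, hG.matDeriv_symm hu a i b, hG.matDeriv_symm hu b i a]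
  ring_nf

/-- A torsion free metric connection is the Levi-Civita connection. -/
theorem IsMetricOn.leviCivita_unique (hG : IsMetricOn G Ω) (hu : u ∈ Ω)
    {Γ : Fin n → Matrix (Fin n) (Fin n) ℝ} (hs : ∀ i j k, Γ i k j = Γ j k i)
    (hm : ∀ i, matDeriv i G u = (Γ i)ᵀ * G u + G u * Γ i) (i : Fin n) :
    leviCivita G i u = Γ i := by
  have hB : ∀ i a b, matDeriv i G u a b = (G u * Γ i) b a + (G u * Γ i) a b := by
    intro i a b
    have h : (Γ i)ᵀ * G u = (G u * Γ i)ᵀ := by rw [Matrix.transpose_mul, hG.symm u hu]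
    rw [hm, h]
    rfl
  have hBs : ∀ i j l, (G u * Γ i) l j = (G u * Γ j) l i := by
    intro i j l
    simp only [Matrix.mul_apply]
    exact Finset.sum_congr rfl fun m _ => by rw [hs]
  have h : G u * leviCivita G i u = G u * Γ i := by
    ext l j
    rw [hG.mul_leviCivita hu, hB, hB, hB]
    -- Koszul's argument: of the six terms, torsion-freeness cancels four and identifies the other
    -- two.
    linarith [hBs i j l, hBs i l j, hBs j l i]
  have h2 := congrArg (fun M => (G u)⁻¹ * M) h
  simpa only [← mul_assoc, hG.inv_mul hu, one_mul] using h2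

theorem IsMetricOn.smooth_leviCivita (hG : IsMetricOn G Ω) (i : Fin n) :
    MatSmoothOn (leviCivita G i) Ω := by
  have : leviCivita G i = fun u => (G u)⁻¹ * Matrix.of fun l m => (1 / 2) *
      (matDeriv i G u m l + matDeriv m G u i l - matDeriv l G u i m) := by
    ext u k j
    exact christoffel_eq_mul k i j
  rw [this]
  refine (hG.smooth.inv hG.det_ne).mul fun a b => contDiffOn_const.mul ?_
  exact ((hG.smooth.matDeriv hG.isOpen i b a).add (hG.smooth.matDeriv hG.isOpen b i a)).sub
    (hG.smooth.matDeriv hG.isOpen a i b)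

/-- Behaviour of the curvature under a change of frame. -/
theorem mul_connCurv_of_gauge (hΩ : IsOpen Ω)
    {Γ θ : Fin n → EuclideanSpace ℝ (Fin n) → Matrix (Fin n) (Fin n) ℝ}
    {P : EuclideanSpace ℝ (Fin n) → Matrix (Fin n) (Fin n) ℝ}
    (hΓ : ∀ i, MatSmoothOn (Γ i) Ω) (hθ : ∀ i, MatSmoothOn (θ i) Ω) (hP : MatSmoothOn P Ω)
    (h : ∀ i, ∀ x ∈ Ω, P x * Γ i x = θ i x * P x + matDeriv i P x) (hu : u ∈ Ω) (i j : Fin n) :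
    P u * connCurv Γ i j u = connCurv θ i j u * P u := by
  have hd : ∀ i j, matDeriv i P u * Γ j u + P u * matDeriv i (Γ j) u =
      matDeriv i (θ j) u * P u + θ j u * matDeriv i P u + matDeriv i (matDeriv j P) u := by
    intro i j
    rw [← matDeriv_mul hΩ hP (hΓ j) hu, ← matDeriv_mul hΩ (hθ j) hP hu,
      ← matDeriv_add hΩ ((hθ j).mul hP) (hP.matDeriv hΩ j) hu]
    exact matDeriv_congr hΩ hu (h j) i
  have h1 := hd i j
  have h2 := hd j i
  -- The second derivatives of `P` are symmetric, so they drop out of the antisymmetrization in `i,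
  -- j`.
  rw [matDeriv_comm hΩ hP hu j i] at h2
  have h3 := h i u hu
  have h4 := h j u hu
  have e1 : P u * matDeriv i (Γ j) u = matDeriv i (θ j) u * P u + θ j u * matDeriv i P u +
      matDeriv i (matDeriv j P) u - matDeriv i P u * Γ j u := eq_sub_of_add_eq' h1
  have e2 : P u * matDeriv j (Γ i) u = matDeriv j (θ i) u * P u + θ i u * matDeriv j P u +
      matDeriv i (matDeriv j P) u - matDeriv j P u * Γ i u := eq_sub_of_add_eq' h2
  have e3 : P u * (Γ i u * Γ j u) = θ i u * (θ j u * P u + matDeriv j P u)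
      + matDeriv i P u * Γ j u := by
    rw [← mul_assoc, h3, add_mul, mul_assoc, h4]
  have e4 : P u * (Γ j u * Γ i u) = θ j u * (θ i u * P u + matDeriv i P u)
      + matDeriv j P u * Γ i u := by
    rw [← mul_assoc, h4, add_mul, mul_assoc, h3]
  rw [connCurv, connCurv, mul_add, mul_sub, mul_sub, e1, e2, e3, e4]
  noncomm_ring

end Connection

/-! ### Naturality of curvature, Ricci and Schouten tensors under local diffeomorphisms -/

section Naturality

open Set Filter Topology Matrix

variable {n : ℕ} {Ω Ω' : Set (EuclideanSpace ℝ (Fin n))} {u : EuclideanSpace ℝ (Fin n)}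
  {ψ : EuclideanSpace ℝ (Fin n) → EuclideanSpace ℝ (Fin n)} {ι κ τ : Type*}

/-- The Jacobian matrix of a map of `ℝⁿ`. -/
def jacobian (ψ : EuclideanSpace ℝ (Fin n) → EuclideanSpace ℝ (Fin n))
    (u : EuclideanSpace ℝ (Fin n)) : Matrix (Fin n) (Fin n) ℝ :=
  Matrix.of fun a k => partialDeriv k (fun x => ψ x a) u

theorem contDiffOn_component (hψ : ContDiffOn ℝ ∞ ψ Ω) (a : Fin n) :
    ContDiffOn ℝ ∞ (fun x => ψ x a) Ω :=
  (EuclideanSpace.proj (𝕜 := ℝ) a : EuclideanSpace ℝ (Fin n) →L[ℝ] ℝ).contDiff.comp_contDiffOn hψ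

theorem jacobian_apply (hψ : DifferentiableAt ℝ ψ u) (a k : Fin n) :
    jacobian ψ u a k = fderiv ℝ ψ u (EuclideanSpace.single k 1) a := by
  have h : HasFDerivAt (fun x => ψ x a) ((EuclideanSpace.proj (𝕜 := ℝ) a :
      EuclideanSpace ℝ (Fin n) →L[ℝ] ℝ).comp (fderiv ℝ ψ u)) u :=
    (EuclideanSpace.proj (𝕜 := ℝ) a :
      EuclideanSpace ℝ (Fin n) →L[ℝ] ℝ).hasFDerivAt.comp u hψ.hasFDerivAt
  rw [jacobian, Matrix.of_apply, partialDeriv, h.fderiv]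
  rfl

theorem smooth_jacobian (hΩ : IsOpen Ω) (hψ : ContDiffOn ℝ ∞ ψ Ω) : MatSmoothOn (jacobian ψ) Ω :=
  fun a k => contDiffOn_partialDeriv hΩ (contDiffOn_component hψ a) k

theorem matDeriv_jacobian_symm (hΩ : IsOpen Ω) (hψ : ContDiffOn ℝ ∞ ψ Ω) (hu : u ∈ Ω)
    (i a j : Fin n) : matDeriv i (jacobian ψ) u a j = matDeriv j (jacobian ψ) u a i :=
  partialDeriv_comm hΩ (contDiffOn_component hψ a) hu i j

theorem sum_single_eq (v : EuclideanSpace ℝ (Fin n)) :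
    v = ∑ a, v a • EuclideanSpace.single a (1 : ℝ) := by
  ext b
  simp [Pi.single_apply]

theorem partialDeriv_comp {f : EuclideanSpace ℝ (Fin n) → ℝ} (hf : DifferentiableAt ℝ f (ψ u))
    (hψ : DifferentiableAt ℝ ψ u) (i : Fin n) :
    partialDeriv i (fun x => f (ψ x)) u = ∑ a, jacobian ψ u a i * partialDeriv a f (ψ u) := by
  have h : HasFDerivAt (fun x => f (ψ x)) ((fderiv ℝ f (ψ u)).comp (fderiv ℝ ψ u)) u :=
    hf.hasFDerivAt.comp u hψ.hasFDerivAt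
  rw [partialDeriv, h.fderiv, ContinuousLinearMap.comp_apply,
    sum_single_eq (fderiv ℝ ψ u (EuclideanSpace.single i 1)), map_sum]
  refine Finset.sum_congr rfl fun a _ => ?_
  rw [map_smul, jacobian_apply hψ]
  rfl

theorem matDeriv_comp {A : EuclideanSpace ℝ (Fin n) → Matrix ι κ ℝ} (hΩ : IsOpen Ω)
    (hΩ' : IsOpen Ω') (hψ : ContDiffOn ℝ ∞ ψ Ω) (hm : MapsTo ψ Ω Ω') (hA : MatSmoothOn A Ω')
    (hu : u ∈ Ω) (i : Fin n) :
    matDeriv i (fun x => A (ψ x)) u = ∑ a, jacobian ψ u a i • matDeriv a A (ψ u) := by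
  ext b c
  rw [Matrix.sum_apply]
  exact partialDeriv_comp (differentiableAt_of_smooth hΩ' (hA b c) (hm hu))
    ((hψ.differentiableOn (by simp)).differentiableAt (hΩ.mem_nhds hu)) i

theorem MatSmoothOn.comp {A : EuclideanSpace ℝ (Fin n) → Matrix ι κ ℝ}
    (hA : MatSmoothOn A Ω') (hψ : ContDiffOn ℝ ∞ ψ Ω) (hm : MapsTo ψ Ω Ω') :
    MatSmoothOn (fun x => A (ψ x)) Ω :=
  fun a b => (hA a b).comp hψ hm

theorem MatSmoothOn.sum {α : Type*} {s : Finset α} {A : α → EuclideanSpace ℝ (Fin n) → Matrix ι κ ℝ}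
    (hA : ∀ a ∈ s, MatSmoothOn (A a) Ω) : MatSmoothOn (fun x => ∑ a ∈ s, A a x) Ω := by
  intro b c
  simp only [Matrix.sum_apply]
  exact ContDiffOn.sum fun a ha => hA a ha b c

theorem matDeriv_sum {α : Type*} {s : Finset α} {A : α → EuclideanSpace ℝ (Fin n) → Matrix ι κ ℝ}
    (hΩ : IsOpen Ω) (hA : ∀ a ∈ s, MatSmoothOn (A a) Ω) (hu : u ∈ Ω) (i : Fin n) :
    matDeriv i (fun x => ∑ a ∈ s, A a x) u = ∑ a ∈ s, matDeriv i (A a) u := by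
  ext b c
  simp only [matDeriv, Matrix.of_apply, Matrix.sum_apply]
  exact partialDeriv_sum (fun a ha => differentiableAt_of_smooth hΩ (hA a ha b c) hu) i

/-- The pull-back of a connection form. -/
def pullbackConn (ψ : EuclideanSpace ℝ (Fin n) → EuclideanSpace ℝ (Fin n))
    (Γ : Fin n → EuclideanSpace ℝ (Fin n) → Matrix (Fin n) (Fin n) ℝ) (i : Fin n)
    (u : EuclideanSpace ℝ (Fin n)) : Matrix (Fin n) (Fin n) ℝ :=
  ∑ a, jacobian ψ u a i • Γ a (ψ u)

variable {Γ : Fin n → EuclideanSpace ℝ (Fin n) → Matrix (Fin n) (Fin n) ℝ}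

theorem smooth_pullbackConn (hΩ : IsOpen Ω) (hψ : ContDiffOn ℝ ∞ ψ Ω) (hm : MapsTo ψ Ω Ω')
    (hΓ : ∀ i, MatSmoothOn (Γ i) Ω') (i : Fin n) : MatSmoothOn (pullbackConn ψ Γ i) Ω :=
  MatSmoothOn.sum fun a _ => MatSmoothOn.smul (smooth_jacobian hΩ hψ a i) ((hΓ a).comp hψ hm)

/-- The second derivatives of `ψ` produced by differentiating the Jacobian factor are symmetric in
`i, j` and cancel; everything else is bilinear in the columns of the Jacobian. -/
theorem connCurv_pullbackConn (hΩ : IsOpen Ω) (hΩ' : IsOpen Ω') (hψ : ContDiffOn ℝ ∞ ψ Ω)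
    (hm : MapsTo ψ Ω Ω') (hΓ : ∀ i, MatSmoothOn (Γ i) Ω') (hu : u ∈ Ω) (i j : Fin n) :
    connCurv (pullbackConn ψ Γ) i j u =
      ∑ a, ∑ b, (jacobian ψ u a i * jacobian ψ u b j) • connCurv Γ a b (ψ u) := by
  have hd : ∀ i j, matDeriv i (pullbackConn ψ Γ j) u =
      ∑ b, matDeriv i (jacobian ψ) u b j • Γ b (ψ u) +
        ∑ a, ∑ b, (jacobian ψ u a i * jacobian ψ u b j) • matDeriv a (Γ b) (ψ u) := by
    intro i j
    have : matDeriv i (pullbackConn ψ Γ j) u =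
        ∑ b, matDeriv i (fun x => jacobian ψ x b j • Γ b (ψ x)) u :=
      matDeriv_sum hΩ (fun b _ => MatSmoothOn.smul (smooth_jacobian hΩ hψ b j) ((hΓ b).comp hψ hm))
        hu i
    rw [this, Finset.sum_comm, ← Finset.sum_add_distrib]
    refine Finset.sum_congr rfl fun b _ => ?_
    rw [matDeriv_smul hΩ (smooth_jacobian hΩ hψ b j) ((hΓ b).comp hψ hm) hu,
      matDeriv_comp hΩ hΩ' hψ hm (hΓ b) hu, Finset.smul_sum]
    congr 1
    exact Finset.sum_congr rfl fun a _ => by rw [smul_smul, mul_comm]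
  have hprod : ∀ i j, pullbackConn ψ Γ i u * pullbackConn ψ Γ j u =
      ∑ a, ∑ b, (jacobian ψ u a i * jacobian ψ u b j) • (Γ a (ψ u) * Γ b (ψ u)) := by
    intro i j
    rw [pullbackConn, pullbackConn, Finset.sum_mul_sum]
    exact Finset.sum_congr rfl fun a _ => Finset.sum_congr rfl fun b _ => by
      rw [smul_mul_smul_comm]
  have hswap : ∀ F : Fin n → Fin n → Matrix (Fin n) (Fin n) ℝ,
      ∑ a, ∑ b, (jacobian ψ u a j * jacobian ψ u b i) • F a b =
        ∑ a, ∑ b, (jacobian ψ u a i * jacobian ψ u b j) • F b a := by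
    intro F
    rw [Finset.sum_comm]
    exact Finset.sum_congr rfl fun a _ => Finset.sum_congr rfl fun b _ => by rw [mul_comm]
  have hsym : ∑ b, matDeriv j (jacobian ψ) u b i • Γ b (ψ u) =
      ∑ b, matDeriv i (jacobian ψ) u b j • Γ b (ψ u) :=
    Finset.sum_congr rfl fun b _ => by rw [matDeriv_jacobian_symm hΩ hψ hu]
  rw [connCurv, hd, hd, hprod, hprod, hswap (fun a b => matDeriv a (Γ b) (ψ u)),
    hswap (fun a b => Γ a (ψ u) * Γ b (ψ u)), hsym, add_sub_add_left_eq_sub,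
    ← Finset.sum_sub_distrib, ← Finset.sum_sub_distrib, ← Finset.sum_add_distrib]
  refine Finset.sum_congr rfl fun a _ => ?_
  rw [← Finset.sum_sub_distrib, ← Finset.sum_sub_distrib, ← Finset.sum_add_distrib]
  refine Finset.sum_congr rfl fun b _ => ?_
  rw [connCurv, ← smul_sub, ← smul_sub, ← smul_add]

variable {G G' : EuclideanSpace ℝ (Fin n) → Matrix (Fin n) (Fin n) ℝ}

/-- `G` is the pull-back of the metric `G'` under `ψ`. -/
structure IsPullback (ψ : EuclideanSpace ℝ (Fin n) → EuclideanSpace ℝ (Fin n))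
    (G G' : EuclideanSpace ℝ (Fin n) → Matrix (Fin n) (Fin n) ℝ)
    (Ω Ω' : Set (EuclideanSpace ℝ (Fin n))) : Prop where
  isOpen : IsOpen Ω
  smooth : ContDiffOn ℝ ∞ ψ Ω
  mapsTo : MapsTo ψ Ω Ω'
  det_ne : ∀ x ∈ Ω, (jacobian ψ x).det ≠ 0
  eq : ∀ x ∈ Ω, G x = (jacobian ψ x)ᵀ * G' (ψ x) * jacobian ψ x

theorem IsPullback.isMetricOn (h : IsPullback ψ G G' Ω Ω') (hG' : IsMetricOn G' Ω') :
    IsMetricOn G Ω := by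
  have hJ := smooth_jacobian h.isOpen h.smooth
  refine ⟨h.isOpen, ((hJ.transpose.mul (hG'.smooth.comp h.smooth h.mapsTo)).mul hJ).congr h.eq,
    fun x hx => ?_, fun x hx => ?_⟩
  · rw [h.eq x hx]
    simp only [Matrix.transpose_mul, Matrix.transpose_transpose, hG'.symm _ (h.mapsTo hx),
      mul_assoc]
  · rw [h.eq x hx]
    simp [h.det_ne x hx, hG'.det_ne _ (h.mapsTo hx)]

theorem IsPullback.jacobian_mul_inv (h : IsPullback ψ G G' Ω Ω') (hu : u ∈ Ω) :
    jacobian ψ u * (jacobian ψ u)⁻¹ = 1 := Matrix.mul_nonsing_inv _ (h.det_ne u hu).isUnit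

theorem IsPullback.inv_mul_jacobian (h : IsPullback ψ G G' Ω Ω') (hu : u ∈ Ω) :
    (jacobian ψ u)⁻¹ * jacobian ψ u = 1 := Matrix.nonsing_inv_mul _ (h.det_ne u hu).isUnit

/-- The transformation law of the Christoffel symbols. The connection `J⁻¹ (ψ*Γ' J + ∂J)` is torsion
free and metric for `G`, so `leviCivita_unique` applies and no Christoffel symbol has to be
expanded. The result is a gauge relation, ready for `mul_connCurv_of_gauge`. -/
theorem IsPullback.leviCivita_eq (h : IsPullback ψ G G' Ω Ω') (hG' : IsMetricOn G' Ω') (hu : u ∈ Ω)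
    (i : Fin n) : jacobian ψ u * leviCivita G i u =
      pullbackConn ψ (leviCivita G') i u * jacobian ψ u + matDeriv i (jacobian ψ) u := by
  set J := jacobian ψ u with hJdef
  have hG := h.isMetricOn hG'
  have hJs := smooth_jacobian h.isOpen h.smooth
  have key : ∀ i, leviCivita G i u =
      J⁻¹ * (pullbackConn ψ (leviCivita G') i u * J + matDeriv i (jacobian ψ) u) := by
    refine fun i => hG.leviCivita_unique hu (Γ := fun i => J⁻¹ *
      (pullbackConn ψ (leviCivita G') i u * J + matDeriv i (jacobian ψ) u)) ?_ ?_ i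
    · intro i j k
      have hsym : ∀ i j c, (pullbackConn ψ (leviCivita G') i u * J +
          matDeriv i (jacobian ψ) u) c j = ∑ a, ∑ b, J a i * leviCivita G' a (ψ u) c b * J b j +
            matDeriv i (jacobian ψ) u c j := by
        intro i j c
        rw [Matrix.add_apply, pullbackConn, Finset.sum_mul, Matrix.sum_apply]
        congr 1
      rw [Matrix.mul_apply, Matrix.mul_apply]
      refine Finset.sum_congr rfl fun c _ => ?_
      rw [hsym, hsym, matDeriv_jacobian_symm h.isOpen h.smooth hu i c j, Finset.sum_comm]
      congr 2
      refine Finset.sum_congr rfl fun a _ => Finset.sum_congr rfl fun b _ => ?_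
      rw [hG'.leviCivita_symm (h.mapsTo hu) b a c]
      ring
    · intro i
      have e1 : matDeriv i G u = (matDeriv i (jacobian ψ) u)ᵀ * G' (ψ u) * J +
          Jᵀ * (∑ a, J a i • matDeriv a G' (ψ u)) * J +
          Jᵀ * G' (ψ u) * matDeriv i (jacobian ψ) u := by
        rw [matDeriv_congr h.isOpen hu h.eq i,
          matDeriv_mul h.isOpen (hJs.transpose.mul (hG'.smooth.comp h.smooth h.mapsTo)) hJs hu,
          matDeriv_mul h.isOpen hJs.transpose (hG'.smooth.comp h.smooth h.mapsTo) hu,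
          matDeriv_comp h.isOpen hG'.isOpen h.smooth h.mapsTo hG'.smooth hu, matDeriv_transpose,
          add_mul]
      have e2 : ∑ a, J a i • matDeriv a G' (ψ u) =
          (pullbackConn ψ (leviCivita G') i u)ᵀ * G' (ψ u) +
            G' (ψ u) * pullbackConn ψ (leviCivita G') i u := by
        rw [pullbackConn, Matrix.transpose_sum, Finset.sum_mul, Finset.mul_sum,
          ← Finset.sum_add_distrib]
        refine Finset.sum_congr rfl fun a _ => ?_
        rw [hG'.matDeriv_eq (h.mapsTo hu), Matrix.transpose_smul, smul_mul_assoc, mul_smul_comm,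
          smul_add]
      have e3 : G u * J⁻¹ = Jᵀ * G' (ψ u) := by
        rw [h.eq u hu, mul_assoc, h.jacobian_mul_inv hu, mul_one]
      have e4 : (J⁻¹)ᵀ * G u = G' (ψ u) * J := by
        rw [h.eq u hu, mul_assoc, ← mul_assoc, ← Matrix.transpose_mul, h.jacobian_mul_inv hu,
          Matrix.transpose_one, one_mul]
      rw [e1, e2, ← mul_assoc, e3, Matrix.transpose_mul, mul_assoc _ (J⁻¹)ᵀ, e4,
        Matrix.transpose_add, Matrix.transpose_mul]
      noncomm_ring
  rw [key i, ← mul_assoc, h.jacobian_mul_inv hu, one_mul]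

/-- The curvature tensor is natural. -/
theorem IsPullback.connCurv_eq (h : IsPullback ψ G G' Ω Ω') (hG' : IsMetricOn G' Ω') (hu : u ∈ Ω)
    (i j : Fin n) : jacobian ψ u * connCurv (leviCivita G) i j u =
      (∑ a, ∑ b, (jacobian ψ u a i * jacobian ψ u b j) •
        connCurv (leviCivita G') a b (ψ u)) * jacobian ψ u := by
  rw [← connCurv_pullbackConn h.isOpen hG'.isOpen h.smooth h.mapsTo hG'.smooth_leviCivita hu]
  exact mul_connCurv_of_gauge h.isOpen (h.isMetricOn hG').smooth_leviCivita
    (smooth_pullbackConn h.isOpen h.smooth h.mapsTo hG'.smooth_leviCivita)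
    (smooth_jacobian h.isOpen h.smooth) (fun i x hx => h.leviCivita_eq hG' hx i) hu i j

/-- The matrix of the Ricci tensor. -/
def ricciMat (G : EuclideanSpace ℝ (Fin n) → Matrix (Fin n) (Fin n) ℝ)
    (u : EuclideanSpace ℝ (Fin n)) : Matrix (Fin n) (Fin n) ℝ :=
  Matrix.of fun j k => ricciCoord G j k u

theorem ricciMat_apply (j k : Fin n) :
    ricciMat G u j k = ∑ i, connCurv (leviCivita G) i j u i k := by
  simp only [ricciMat, Matrix.of_apply, ricciCoord, riemannCoord_eq]

theorem scalarCoord_eq (hG : (G u)ᵀ = G u) :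
    scalarCoord G u = ((G u)⁻¹ * ricciMat G u).trace := by
  have h : ((G u)⁻¹)ᵀ = (G u)⁻¹ := by rw [Matrix.transpose_nonsing_inv, hG]
  simp only [scalarCoord, Matrix.trace, Matrix.diag, Matrix.mul_apply]
  rw [Finset.sum_comm]
  refine Finset.sum_congr rfl fun k _ => Finset.sum_congr rfl fun j _ => ?_
  rw [← h, Matrix.transpose_apply, h]
  rfl

theorem schoutenCoord_eq : schoutenCoord G u = (1 / ((n : ℝ) - 2)) •
    (ricciMat G u - (scalarCoord G u / (2 * ((n : ℝ) - 1))) • G u) := by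
  ext i j
  simp [schoutenCoord, ricciMat]

theorem IsPullback.ricciMat_eq (h : IsPullback ψ G G' Ω Ω') (hG' : IsMetricOn G' Ω')
    (hu : u ∈ Ω) : ricciMat G u = (jacobian ψ u)ᵀ * ricciMat G' (ψ u) * jacobian ψ u := by
  set J := jacobian ψ u with hJ
  have h1 : ∀ i j, connCurv (leviCivita G) i j u = ∑ a, ∑ b, (J a i * J b j) •
      (J⁻¹ * (connCurv (leviCivita G') a b (ψ u) * J)) := by
    intro i j
    have h0 : connCurv (leviCivita G) i j u = J⁻¹ * (J * connCurv (leviCivita G) i j u) := by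
      rw [← mul_assoc, h.inv_mul_jacobian hu, one_mul]
    rw [h0, h.connCurv_eq hG' hu]
    simp only [Finset.mul_sum, Finset.sum_mul, mul_smul_comm, smul_mul_assoc]
    rfl
  -- In the Ricci trace, the conjugating `J⁻¹` meets the factor `J a i` of the first form index and
  -- cancels it.
  have h2 : ∀ (M : Matrix (Fin n) (Fin n) ℝ) a k, ∑ i, J a i * (J⁻¹ * M) i k = M a k := by
    intro M a k
    rw [← Matrix.mul_apply, ← mul_assoc, h.jacobian_mul_inv hu, one_mul]
  ext j k
  rw [ricciMat_apply]
  simp only [h1, Matrix.sum_apply, Matrix.smul_apply, smul_eq_mul]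
  calc _ = ∑ a, ∑ b, J b j * ∑ i, J a i * (J⁻¹ * (connCurv (leviCivita G') a b (ψ u) * J)) i k := by
        rw [Finset.sum_comm]
        refine Finset.sum_congr rfl fun a _ => ?_
        rw [Finset.sum_comm]
        refine Finset.sum_congr rfl fun b _ => ?_
        rw [Finset.mul_sum]
        exact Finset.sum_congr rfl fun i _ => by ring
    _ = ∑ a, ∑ b, ∑ d, J b j * connCurv (leviCivita G') a b (ψ u) a d * J d k := by
        simp only [h2]
        simp only [Matrix.mul_apply, Finset.mul_sum, mul_assoc]
    _ = _ := by
        rw [mul_assoc, Matrix.mul_apply, Finset.sum_comm]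
        refine Finset.sum_congr rfl fun b _ => ?_
        rw [Matrix.mul_apply, Finset.sum_comm, Finset.mul_sum]
        refine Finset.sum_congr rfl fun d _ => ?_
        rw [ricciMat_apply, Finset.sum_mul, Finset.mul_sum]
        exact Finset.sum_congr rfl fun a _ => by rw [Matrix.transpose_apply]; ring

theorem IsPullback.inv_eq (h : IsPullback ψ G G' Ω Ω') (hu : u ∈ Ω) :
    (G u)⁻¹ = (jacobian ψ u)⁻¹ * (G' (ψ u))⁻¹ * ((jacobian ψ u)ᵀ)⁻¹ := by
  rw [h.eq u hu, Matrix.mul_inv_rev, Matrix.mul_inv_rev, mul_assoc]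

theorem IsPullback.scalarCoord_eq (h : IsPullback ψ G G' Ω Ω') (hG' : IsMetricOn G' Ω')
    (hu : u ∈ Ω) : scalarCoord G u = scalarCoord G' (ψ u) := by
  have hT : ((jacobian ψ u)ᵀ)⁻¹ * (jacobian ψ u)ᵀ = 1 :=
    Matrix.nonsing_inv_mul _ (by rw [Matrix.det_transpose]; exact (h.det_ne u hu).isUnit)
  rw [_root_.scalarCoord_eq ((h.isMetricOn hG').symm u hu),
    _root_.scalarCoord_eq (hG'.symm _ (h.mapsTo hu)), h.ricciMat_eq hG' hu, h.inv_eq hu]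
  have : (jacobian ψ u)⁻¹ * (G' (ψ u))⁻¹ * ((jacobian ψ u)ᵀ)⁻¹ *
      ((jacobian ψ u)ᵀ * ricciMat G' (ψ u) * jacobian ψ u) =
      (jacobian ψ u)⁻¹ * ((G' (ψ u))⁻¹ * (((jacobian ψ u)ᵀ)⁻¹ * (jacobian ψ u)ᵀ) *
        ricciMat G' (ψ u)) * jacobian ψ u := by noncomm_ring
  rw [this, hT, mul_one, mul_assoc, Matrix.trace_mul_comm, mul_assoc, h.jacobian_mul_inv hu,
    mul_one]

/-- The Schouten tensor is natural. -/
theorem IsPullback.schoutenCoord_eq (h : IsPullback ψ G G' Ω Ω') (hG' : IsMetricOn G' Ω')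
    (hu : u ∈ Ω) :
    schoutenCoord G u = (jacobian ψ u)ᵀ * schoutenCoord G' (ψ u) * jacobian ψ u := by
  rw [_root_.schoutenCoord_eq, _root_.schoutenCoord_eq, h.ricciMat_eq hG' hu,
    h.scalarCoord_eq hG' hu]
  conv_lhs => rw [h.eq u hu]
  simp only [mul_smul_comm, smul_mul_assoc, mul_sub, sub_mul]

theorem IsMetricOn.smooth_connCurv (hG : IsMetricOn G Ω) (i j : Fin n) :
    MatSmoothOn (connCurv (leviCivita G) i j) Ω := by
  have h := hG.smooth_leviCivita
  exact (((h j).matDeriv hG.isOpen i).sub ((h i).matDeriv hG.isOpen j)).add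
    (((h i).mul (h j)).sub ((h j).mul (h i)))

theorem IsMetricOn.smooth_schoutenCoord (hG : IsMetricOn G Ω) : MatSmoothOn (schoutenCoord G) Ω := by
  have hr : MatSmoothOn (ricciMat G) Ω := by
    intro j k
    simp only [ricciMat_apply]
    exact ContDiffOn.sum fun i _ => hG.smooth_connCurv i j i k
  have hs : ContDiffOn ℝ ∞ (scalarCoord G) Ω :=
    ContDiffOn.sum fun j _ => ContDiffOn.sum fun k _ => ((hG.smooth.inv hG.det_ne) j k).mul (hr j k)
  have : schoutenCoord G = fun u => (1 / ((n : ℝ) - 2)) •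
    (ricciMat G u - (scalarCoord G u / (2 * ((n : ℝ) - 1))) • G u) := funext fun _ => _root_.schoutenCoord_eq
  rw [this]
  exact MatSmoothOn.smul contDiffOn_const (hr.sub (MatSmoothOn.smul (hs.div_const _) hG.smooth))

/-- This and the next two lemmas record that curvature depends only on the metric on an open set.
They are needed because `tensorCoord` of the dual tensor is known to equal `dualCoord` only over the
regular set. -/
theorem leviCivita_congr {H : EuclideanSpace ℝ (Fin n) → Matrix (Fin n) (Fin n) ℝ}
    (hΩ : IsOpen Ω) (h : EqOn H G Ω) (i : Fin n) : EqOn (leviCivita H i) (leviCivita G i) Ω := by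
  intro x hx
  ext k j
  simp only [leviCivita, Matrix.of_apply, christoffel_eq_mul, matDeriv_congr hΩ hx h, h hx]

theorem connCurv_congr {H : EuclideanSpace ℝ (Fin n) → Matrix (Fin n) (Fin n) ℝ}
    (hΩ : IsOpen Ω) (h : EqOn H G Ω) (hu : u ∈ Ω) (i j : Fin n) :
    connCurv (leviCivita H) i j u = connCurv (leviCivita G) i j u := by
  rw [connCurv, connCurv, matDeriv_congr hΩ hu (leviCivita_congr hΩ h j),
    matDeriv_congr hΩ hu (leviCivita_congr hΩ h i), leviCivita_congr hΩ h i hu,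
    leviCivita_congr hΩ h j hu]

theorem schoutenCoord_congr {H : EuclideanSpace ℝ (Fin n) → Matrix (Fin n) (Fin n) ℝ}
    (hΩ : IsOpen Ω) (h : EqOn H G Ω) (hu : u ∈ Ω) : schoutenCoord H u = schoutenCoord G u := by
  have hr : ricciMat H u = ricciMat G u := by
    ext j k
    rw [ricciMat_apply, ricciMat_apply]
    exact Finset.sum_congr rfl fun i _ => by rw [connCurv_congr hΩ h hu]
  have hr' : ∀ j k, ricciCoord H j k u = ricciCoord G j k u := fun j k => congrFun₂ hr j k
  rw [_root_.schoutenCoord_eq, _root_.schoutenCoord_eq, hr, scalarCoord, scalarCoord, h hu]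
  simp only [hr']

end Naturality

/-! ### Connection and curvature of a conformally flat metric in a flat frame -/

section ConformallyFlat

open Set Filter Topology Matrix

variable {n : ℕ} {Ω Ω' : Set (EuclideanSpace ℝ (Fin n))} {u : EuclideanSpace ℝ (Fin n)}

/-- The metric `G` on `Ω` is `e^{2s}` times the pull-back of the Euclidean metric under `ψ`, and `w`
is the gradient of `s` in the coordinates `ψ`. -/
structure IsConformalChart (G : EuclideanSpace ℝ (Fin n) → Matrix (Fin n) (Fin n) ℝ)
    (ψ : EuclideanSpace ℝ (Fin n) → EuclideanSpace ℝ (Fin n)) (s : EuclideanSpace ℝ (Fin n) → ℝ)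
    (w : EuclideanSpace ℝ (Fin n) → Fin n → ℝ) (Ω : Set (EuclideanSpace ℝ (Fin n))) : Prop where
  isOpen : IsOpen Ω
  smooth : ContDiffOn ℝ ∞ ψ Ω
  smooth_factor : ContDiffOn ℝ ∞ s Ω
  smooth_grad : ∀ a, ContDiffOn ℝ ∞ (fun x => w x a) Ω
  det_ne : ∀ x ∈ Ω, (jacobian ψ x).det ≠ 0
  eq : ∀ x ∈ Ω, G x = Real.exp (2 * s x) • ((jacobian ψ x)ᵀ * jacobian ψ x)
  partialDeriv_factor : ∀ x ∈ Ω, ∀ i, partialDeriv i s x = ∑ a, jacobian ψ x a i * w x a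

/-- The matrix `∂_i w_a`. -/
def gradMat (w : EuclideanSpace ℝ (Fin n) → Fin n → ℝ) (u : EuclideanSpace ℝ (Fin n)) :
    Matrix (Fin n) (Fin n) ℝ :=
  Matrix.of fun a i => partialDeriv i (fun x => w x a) u

/-- The Levi-Civita connection of a conformally flat metric in a flat frame. -/
def conformalConn (ψ : EuclideanSpace ℝ (Fin n) → EuclideanSpace ℝ (Fin n))
    (s : EuclideanSpace ℝ (Fin n) → ℝ) (w : EuclideanSpace ℝ (Fin n) → Fin n → ℝ) (i : Fin n)
    (x : EuclideanSpace ℝ (Fin n)) : Matrix (Fin n) (Fin n) ℝ :=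
  partialDeriv i s x • (1 : Matrix (Fin n) (Fin n) ℝ) +
    Matrix.of fun a b => jacobian ψ x a i * w x b - w x a * jacobian ψ x b i

variable {G : EuclideanSpace ℝ (Fin n) → Matrix (Fin n) (Fin n) ℝ}
  {ψ : EuclideanSpace ℝ (Fin n) → EuclideanSpace ℝ (Fin n)} {s : EuclideanSpace ℝ (Fin n) → ℝ}
  {w : EuclideanSpace ℝ (Fin n) → Fin n → ℝ}

namespace IsConformalChart

theorem smooth_jac (h : IsConformalChart G ψ s w Ω) : MatSmoothOn (jacobian ψ) Ω :=
  smooth_jacobian h.isOpen h.smooth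

theorem isMetricOn (h : IsConformalChart G ψ s w Ω) : IsMetricOn G Ω := by
  refine ⟨h.isOpen, (MatSmoothOn.smul ((contDiffOn_const.mul h.smooth_factor).exp)
    (h.smooth_jac.transpose.mul h.smooth_jac)).congr h.eq, fun x hx => ?_, fun x hx => ?_⟩
  · rw [h.eq x hx]
    simp
  · rw [h.eq x hx]
    simp [h.det_ne x hx]

theorem jac_mul_inv (h : IsConformalChart G ψ s w Ω) (hu : u ∈ Ω) :
    jacobian ψ u * (jacobian ψ u)⁻¹ = 1 := Matrix.mul_nonsing_inv _ (h.det_ne u hu).isUnit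

theorem inv_mul_jac (h : IsConformalChart G ψ s w Ω) (hu : u ∈ Ω) :
    (jacobian ψ u)⁻¹ * jacobian ψ u = 1 := Matrix.nonsing_inv_mul _ (h.det_ne u hu).isUnit

theorem smooth_skew (h : IsConformalChart G ψ s w Ω) (i : Fin n) :
    MatSmoothOn (fun x => Matrix.of fun a b => jacobian ψ x a i * w x b - w x a * jacobian ψ x b i)
      Ω :=
  fun a b => ((h.smooth_jac a i).mul (h.smooth_grad b)).sub
    ((h.smooth_grad a).mul (h.smooth_jac b i))

theorem smooth_conformalConn (h : IsConformalChart G ψ s w Ω) (i : Fin n) :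
    MatSmoothOn (conformalConn ψ s w i) Ω :=
  (MatSmoothOn.smul (contDiffOn_partialDeriv h.isOpen h.smooth_factor i) (MatSmoothOn.const 1)).add
    (h.smooth_skew i)

/-- Again by uniqueness. The symmetric part `∂_i s • 1` of `conformalConn` accounts for the
derivative of the conformal factor. With `ds = Jᵀ w`, the skew part makes `conformalConn` times `J`
symmetric in the two lower indices, so there is no torsion. -/
theorem leviCivita_eq (h : IsConformalChart G ψ s w Ω) (hu : u ∈ Ω) (i : Fin n) :
    jacobian ψ u * leviCivita G i u =
      conformalConn ψ s w i u * jacobian ψ u + matDeriv i (jacobian ψ) u := by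
  set J := jacobian ψ u with hJ
  have hG := h.isMetricOn
  have key : ∀ i, leviCivita G i u =
      J⁻¹ * (conformalConn ψ s w i u * J + matDeriv i (jacobian ψ) u) := by
    refine fun i => hG.leviCivita_unique hu (Γ := fun i => J⁻¹ *
      (conformalConn ψ s w i u * J + matDeriv i (jacobian ψ) u)) ?_ ?_ i
    · intro i j k
      have hent : ∀ i j c, (conformalConn ψ s w i u * J + matDeriv i (jacobian ψ) u) c j =
          partialDeriv i s u * J c j + J c i * partialDeriv j s u - w u c * ∑ b, J b i * J b j +
            matDeriv i (jacobian ψ) u c j := by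
        intro i j c
        rw [Matrix.add_apply, conformalConn, add_mul, Matrix.add_apply, smul_mul_assoc, one_mul,
          Matrix.smul_apply, Matrix.mul_apply, h.partialDeriv_factor u hu j]
        simp only [Matrix.of_apply, sub_mul, Finset.sum_sub_distrib, smul_eq_mul, Finset.mul_sum]
        rw [add_sub_assoc]
        congr 3
        · exact Finset.sum_congr rfl fun b _ => by ring
        · exact Finset.sum_congr rfl fun b _ => by ring
      rw [Matrix.mul_apply, Matrix.mul_apply]
      refine Finset.sum_congr rfl fun c _ => ?_
      rw [hent, hent, matDeriv_jacobian_symm h.isOpen h.smooth hu i c j]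
      have : ∑ b, J b i * J b j = ∑ b, J b j * J b i :=
        Finset.sum_congr rfl fun b _ => mul_comm _ _
      rw [this]
      ring
    · intro i
      set D := matDeriv i (jacobian ψ) u with hD
      set e := Real.exp (2 * s u) with he
      have hexp : partialDeriv i (fun x => Real.exp (2 * s x)) u = 2 * partialDeriv i s u * e := by
        have hs := differentiableAt_of_smooth h.isOpen h.smooth_factor hu
        have : HasFDerivAt (fun x => Real.exp (2 * s x))
          (Real.exp (2 * s u) • (2 : ℝ) • fderiv ℝ s u) u := (hs.hasFDerivAt.const_mul 2).exp
        rw [partialDeriv, this.fderiv, partialDeriv]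
        simp [he]
        ring
      have e1 : matDeriv i G u = (2 * partialDeriv i s u * e) • (Jᵀ * J) +
          e • (Dᵀ * J + Jᵀ * D) := by
        rw [matDeriv_congr h.isOpen hu h.eq i,
          matDeriv_smul h.isOpen ((contDiffOn_const.mul h.smooth_factor).exp)
            (h.smooth_jac.transpose.mul h.smooth_jac) hu,
          matDeriv_mul h.isOpen h.smooth_jac.transpose h.smooth_jac hu, matDeriv_transpose, hexp]
      have e2 : (conformalConn ψ s w i u)ᵀ + conformalConn ψ s w i u =
          (2 * partialDeriv i s u) • (1 : Matrix (Fin n) (Fin n) ℝ) := by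
        ext a b
        simp only [conformalConn, Matrix.add_apply, Matrix.transpose_apply, Matrix.smul_apply,
          Matrix.of_apply, smul_eq_mul, Matrix.one_apply, @eq_comm _ b a]
        split_ifs <;> ring
      have e3 : G u * J⁻¹ = e • Jᵀ := by
        rw [h.eq u hu, smul_mul_assoc, mul_assoc, h.jac_mul_inv hu, mul_one]
      have e4 : (J⁻¹)ᵀ * G u = e • J := by
        rw [h.eq u hu, mul_smul_comm, ← mul_assoc, ← Matrix.transpose_mul, h.jac_mul_inv hu,
          Matrix.transpose_one, one_mul]
      have e5 : (conformalConn ψ s w i u)ᵀ =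
          (2 * partialDeriv i s u) • (1 : Matrix (Fin n) (Fin n) ℝ) - conformalConn ψ s w i u :=
        eq_sub_of_add_eq e2
      rw [e1, ← mul_assoc, e3, Matrix.transpose_mul, mul_assoc _ (J⁻¹)ᵀ, e4,
        Matrix.transpose_add, Matrix.transpose_mul, e5]
      simp only [mul_add, add_mul, mul_sub, sub_mul, smul_mul_assoc, mul_smul_comm, mul_one,
        smul_add, smul_sub, smul_smul, mul_assoc]
      module
  rw [key i, ← mul_assoc, h.jac_mul_inv hu, one_mul]

/-- The scalar part `∂_i s • 1` is closed and central, and the second derivatives of `ψ` are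
symmetric in `i, j`. The curvature therefore involves only `J`, `w`, `ds` and the first derivatives
of `w`. -/
theorem connCurv_conformalConn (h : IsConformalChart G ψ s w Ω) (hu : u ∈ Ω) (i j a b : Fin n) :
    connCurv (conformalConn ψ s w) i j u a b =
      jacobian ψ u a j * gradMat w u b i - gradMat w u a i * jacobian ψ u b j
      - jacobian ψ u a i * gradMat w u b j + gradMat w u a j * jacobian ψ u b i
      + partialDeriv j s u * (jacobian ψ u a i * w u b - w u a * jacobian ψ u b i)
      - partialDeriv i s u * (jacobian ψ u a j * w u b - w u a * jacobian ψ u b j)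
      - (∑ c, w u c * w u c) * (jacobian ψ u a i * jacobian ψ u b j
        - jacobian ψ u a j * jacobian ψ u b i) := by
  set J := jacobian ψ u with hJ
  have hd : ∀ i j a b, matDeriv i (conformalConn ψ s w j) u a b =
      partialDeriv i (partialDeriv j s) u * (1 : Matrix (Fin n) (Fin n) ℝ) a b +
      (matDeriv i (jacobian ψ) u a j * w u b + J a j * gradMat w u b i
        - gradMat w u a i * J b j - w u a * matDeriv i (jacobian ψ) u b j) := by
    intro i j a b
    have h1 := contDiffOn_partialDeriv h.isOpen h.smooth_factor j
    have e : matDeriv i (conformalConn ψ s w j) u = matDeriv i (fun x =>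
        partialDeriv j s x • (1 : Matrix (Fin n) (Fin n) ℝ)) u + matDeriv i (fun x =>
        Matrix.of fun a b => jacobian ψ x a j * w x b - w x a * jacobian ψ x b j) u :=
      matDeriv_add h.isOpen (MatSmoothOn.smul h1 (MatSmoothOn.const 1)) (h.smooth_skew j) hu i
    rw [e, matDeriv_smul h.isOpen h1 (MatSmoothOn.const 1) hu, matDeriv_const, smul_zero, add_zero,
      Matrix.add_apply, Matrix.smul_apply, smul_eq_mul]
    congr 1
    have hJd : ∀ a, DifferentiableAt ℝ (fun x => jacobian ψ x a j) u := fun a =>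
      differentiableAt_of_smooth h.isOpen (h.smooth_jac a j) hu
    have hwd : ∀ a, DifferentiableAt ℝ (fun x => w x a) u := fun a =>
      differentiableAt_of_smooth h.isOpen (h.smooth_grad a) hu
    change partialDeriv i (fun x => jacobian ψ x a j * w x b - w x a * jacobian ψ x b j) u = _
    rw [partialDeriv_sub ((hJd a).fun_mul (hwd b)) ((hwd a).fun_mul (hJd b)),
      partialDeriv_mul (hJd a) (hwd b), partialDeriv_mul (hwd a) (hJd b)]
    simp only [matDeriv, gradMat, Matrix.of_apply]
    ring
  have hprod : ∀ i j, (conformalConn ψ s w i u * conformalConn ψ s w j u) a b =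
      partialDeriv i s u * partialDeriv j s u * (1 : Matrix (Fin n) (Fin n) ℝ) a b
      + partialDeriv i s u * (J a j * w u b - w u a * J b j)
      + partialDeriv j s u * (J a i * w u b - w u a * J b i)
      + (partialDeriv j s u * J a i * w u b - (∑ c, w u c * w u c) * (J a i * J b j)
        - (∑ c, J c i * J c j) * (w u a * w u b) + partialDeriv i s u * w u a * J b j) := by
    intro i j
    rw [conformalConn, conformalConn, add_mul, mul_add, mul_add, smul_mul_assoc, one_mul,
      smul_mul_assoc, one_mul, mul_smul_comm, mul_one]
    simp only [Matrix.add_apply, Matrix.smul_apply, smul_eq_mul, Matrix.of_apply, Matrix.mul_apply]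
    have : ∑ c, (J a i * w u c - w u a * J c i) * (J c j * w u b - w u c * J b j) =
        partialDeriv j s u * J a i * w u b - (∑ c, w u c * w u c) * (J a i * J b j)
        - (∑ c, J c i * J c j) * (w u a * w u b) + partialDeriv i s u * w u a * J b j := by
      rw [h.partialDeriv_factor u hu i, h.partialDeriv_factor u hu j]
      simp only [Finset.sum_mul, ← Finset.sum_sub_distrib, ← Finset.sum_add_distrib]
      exact Finset.sum_congr rfl fun c _ => by ring
    rw [this]
    ring
  have hsum : ∑ c, J c i * J c j = ∑ c, J c j * J c i :=
    Finset.sum_congr rfl fun c _ => mul_comm _ _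
  simp only [connCurv, Matrix.add_apply, Matrix.sub_apply, hd, hprod]
  rw [partialDeriv_comm h.isOpen h.smooth_factor hu j i,
    matDeriv_jacobian_symm h.isOpen h.smooth hu i a j,
    matDeriv_jacobian_symm h.isOpen h.smooth hu i b j, hsum]
  ring

theorem connCurv_eq (h : IsConformalChart G ψ s w Ω) (hu : u ∈ Ω) (i j : Fin n) :
    connCurv (leviCivita G) i j u =
      (jacobian ψ u)⁻¹ * (connCurv (conformalConn ψ s w) i j u * jacobian ψ u) := by
  rw [← mul_connCurv_of_gauge h.isOpen h.isMetricOn.smooth_leviCivita h.smooth_conformalConn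
    h.smooth_jac (fun i x hx => h.leviCivita_eq hx i) hu i j, ← mul_assoc, h.inv_mul_jac hu, one_mul]

/-- The pull-back of the Euclidean metric is flat. -/
theorem connCurv_eq_zero (h : IsConformalChart G ψ (fun _ => 0) (fun _ _ => 0) Ω) (hu : u ∈ Ω)
    (i j : Fin n) : connCurv (leviCivita G) i j u = 0 := by
  have : connCurv (conformalConn ψ (fun _ => 0) (fun _ _ => 0)) i j u = 0 := by
    ext a b
    rw [h.connCurv_conformalConn hu]
    simp [gradMat, partialDeriv_const]
  rw [h.connCurv_eq hu, this, zero_mul, mul_zero]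

/-- `Jᵀ K` is the Hessian of `s` in the flat coordinates: differentiating `ds = Jᵀ w` gives it as
`∂_i ∂_j s` minus a term containing `∂_i J`, and both of these are symmetric. -/
theorem transpose_mul_gradMat_symm (h : IsConformalChart G ψ s w Ω) (hu : u ∈ Ω) :
    ((jacobian ψ u)ᵀ * gradMat w u)ᵀ = (jacobian ψ u)ᵀ * gradMat w u := by
  have hdd : ∀ i j, partialDeriv i (partialDeriv j s) u =
      ∑ a, matDeriv i (jacobian ψ) u a j * w u a + ((jacobian ψ u)ᵀ * gradMat w u) j i := by
    intro i j
    have h1 : EqOn (partialDeriv j s) (fun x => ∑ a, jacobian ψ x a j * w x a) Ω :=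
      fun x hx => h.partialDeriv_factor x hx j
    have hJd : ∀ a, DifferentiableAt ℝ (fun x => jacobian ψ x a j) u := fun a =>
      differentiableAt_of_smooth h.isOpen (h.smooth_jac a j) hu
    have hwd : ∀ a, DifferentiableAt ℝ (fun x => w x a) u := fun a =>
      differentiableAt_of_smooth h.isOpen (h.smooth_grad a) hu
    rw [partialDeriv_congr h.isOpen hu h1 i,
      partialDeriv_sum (fun a _ => (hJd a).fun_mul (hwd a)), Matrix.mul_apply,
      ← Finset.sum_add_distrib]
    exact Finset.sum_congr rfl fun a _ => partialDeriv_mul (hJd a) (hwd a) i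
  ext i j
  have h1 := hdd i j
  rw [partialDeriv_comm h.isOpen h.smooth_factor hu, hdd j i] at h1
  have h2 : ∑ a, matDeriv i (jacobian ψ) u a j * w u a =
      ∑ a, matDeriv j (jacobian ψ) u a i * w u a :=
    Finset.sum_congr rfl fun a _ => by rw [matDeriv_jacobian_symm h.isOpen h.smooth hu]
  rw [Matrix.transpose_apply]
  linarith

end IsConformalChart

end ConformallyFlat

/-! ### Ricci and Schouten tensors in a conformal chart -/

namespace IsConformalChart

open Set Filter Topology Matrix

variable {n : ℕ} {Ω Ω' : Set (EuclideanSpace ℝ (Fin n))} {u : EuclideanSpace ℝ (Fin n)}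
  {G : EuclideanSpace ℝ (Fin n) → Matrix (Fin n) (Fin n) ℝ}
  {ψ : EuclideanSpace ℝ (Fin n) → EuclideanSpace ℝ (Fin n)} {s : EuclideanSpace ℝ (Fin n) → ℝ}
  {w : EuclideanSpace ℝ (Fin n) → Fin n → ℝ}

/-- The Ricci tensor of a conformally flat metric. -/
theorem ricciMat_eq (h : IsConformalChart G ψ s w Ω) (hu : u ∈ Ω) :
    ricciMat G u = (2 - (n : ℝ)) • ((jacobian ψ u)ᵀ * gradMat w u) +
      ((n : ℝ) - 2) • vecMulVec ((jacobian ψ u)ᵀ *ᵥ w u) ((jacobian ψ u)ᵀ *ᵥ w u) -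
      (((jacobian ψ u)⁻¹ * gradMat w u).trace + ((n : ℝ) - 2) * (w u ⬝ᵥ w u)) •
        ((jacobian ψ u)ᵀ * jacobian ψ u) := by
  set J := jacobian ψ u with hJ
  set K := gradMat w u with hK
  set R := J⁻¹ with hR
  set T := Jᵀ * K with hT
  set g := Jᵀ * J with hg
  set W := w u ⬝ᵥ w u with hW
  set d : Fin n → ℝ := Jᵀ *ᵥ w u with hd
  have hRJ : R * J = 1 := h.inv_mul_jac hu
  have hJR : J * R = 1 := h.jac_mul_inv hu
  have hTs : ∀ a b, T a b = T b a := fun a b => congrFun₂ (h.transpose_mul_gradMat_symm hu) b a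
  have hdi : ∀ i, partialDeriv i s u = d i := fun i => h.partialDeriv_factor u hu i
  have hda : ∀ i, d i = ∑ a, J a i * w u a := fun i => rfl
  have hTa : ∀ i k, T k i = ∑ b, K b i * J b k := fun i k => by
    rw [hT, Matrix.mul_apply]; exact Finset.sum_congr rfl fun b _ => mul_comm _ _
  have hga : ∀ i k, g i k = ∑ b, J b i * J b k := fun i k => rfl
  have hFJ : ∀ i j a k, (connCurv (conformalConn ψ s w) i j u * J) a k =
      J a j * T k i - K a i * g j k - J a i * T k j + K a j * g i k
        + d j * (J a i * d k - w u a * g i k) - d i * (J a j * d k - w u a * g j k)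
        - W * (J a i * g j k - J a j * g i k) := by
    intro i j a k
    rw [Matrix.mul_apply, hTa, hTa, hga, hga, hda k]
    simp only [h.connCurv_conformalConn hu, hdi, Finset.mul_sum, mul_sub,
      ← Finset.sum_sub_distrib, ← Finset.sum_add_distrib]
    exact Finset.sum_congr rfl fun b _ => by rw [hW, dotProduct]; ring
  -- The identities `c1` to `c6` are the contractions of `R = J⁻¹` with the terms of `hFJ` that
  -- occur in the Ricci trace over `i`.
  have c1 : ∀ (f : Fin n → ℝ) j, ∑ i, ∑ a, R i a * (J a j * f i) = f j := by
    intro f j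
    have : ∀ i, ∑ a, R i a * (J a j * f i) = (R * J) i j * f i := fun i => by
      rw [Matrix.mul_apply, Finset.sum_mul]
      exact Finset.sum_congr rfl fun a _ => by ring
    simp [this, hRJ, Matrix.one_apply]
  have c2 : ∑ i, ∑ a, R i a * J a i = n := by
    have : ∀ i, ∑ a, R i a * J a i = 1 := fun i => by
      rw [← Matrix.mul_apply, hRJ, Matrix.one_apply_eq]
    simp [this]
  have c3 : ∑ i, ∑ a, R i a * K a i = (R * K).trace := by
    simp [Matrix.trace, Matrix.mul_apply]
  have c4' : ∀ a k, ∑ i, R i a * g i k = J a k := by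
    intro a k
    have e : g * 1 = Jᵀ * J := mul_one _
    calc ∑ i, R i a * g i k = (Rᵀ * (Jᵀ * J)) a k := by rw [Matrix.mul_apply]; rfl
      _ = J a k := by rw [← mul_assoc, ← Matrix.transpose_mul, hJR, Matrix.transpose_one, one_mul]
  have c4 : ∀ (v : Fin n → ℝ) k, ∑ i, ∑ a, R i a * (v a * g i k) = ∑ a, v a * J a k := by
    intro v k
    rw [Finset.sum_comm]
    refine Finset.sum_congr rfl fun a _ => ?_
    rw [← c4', Finset.mul_sum]
    exact Finset.sum_congr rfl fun i _ => by ring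
  have c5 : ∑ i, ∑ a, R i a * (d i * w u a) = W := by
    rw [Finset.sum_comm, hW, dotProduct]
    refine Finset.sum_congr rfl fun a _ => ?_
    have : ∑ i, R i a * d i = w u a := by
      calc ∑ i, R i a * d i = (Rᵀ *ᵥ (Jᵀ *ᵥ w u)) a := rfl
        _ = w u a := by
          rw [Matrix.mulVec_mulVec, ← Matrix.transpose_mul, hJR, Matrix.transpose_one,
            Matrix.one_mulVec]
    calc _ = (∑ i, R i a * d i) * w u a := by
          rw [Finset.sum_mul]; exact Finset.sum_congr rfl fun i _ => by ring
      _ = _ := by rw [this]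
  ext j k
  have hexp : ricciMat G u j k =
      (∑ i, ∑ a, R i a * (J a j * T k i)) - (∑ i, ∑ a, R i a * K a i) * g j k
      - (∑ i, ∑ a, R i a * J a i) * T k j + (∑ i, ∑ a, R i a * (K a j * g i k))
      + d j * d k * (∑ i, ∑ a, R i a * J a i) - d j * (∑ i, ∑ a, R i a * (w u a * g i k))
      - d k * (∑ i, ∑ a, R i a * (J a j * d i)) + g j k * (∑ i, ∑ a, R i a * (d i * w u a))
      - W * g j k * (∑ i, ∑ a, R i a * J a i) + W * (∑ i, ∑ a, R i a * (J a j * g i k)) := by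
    rw [ricciMat_apply]
    simp only [h.connCurv_eq hu, Matrix.mul_apply (M := R), hFJ, ← hJ, ← hR]
    simp only [Finset.mul_sum, Finset.sum_mul, ← Finset.sum_sub_distrib, ← Finset.sum_add_distrib]
    exact Finset.sum_congr rfl fun i _ => Finset.sum_congr rfl fun a _ => by ring
  have hwd : ∑ a, w u a * J a k = d k := by
    rw [hda]; exact Finset.sum_congr rfl fun a _ => mul_comm _ _
  have hKJ : ∑ a, K a j * J a k = T k j := (hTa j k).symm
  have c6 : ∑ i, ∑ a, R i a * (J a j * g i k) = g j k := c1 (fun i => g i k) j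
  rw [hexp, c1 (fun i => T k i), c1 d, c6, c2, c3, c4 (fun a => K a j), c4 (w u), c5, hwd, hKJ,
    hTs k j]
  simp only [Matrix.sub_apply, Matrix.add_apply, Matrix.smul_apply, smul_eq_mul, vecMulVec_apply]
  ring

/-- The Schouten tensor of a conformally flat metric. -/
theorem schoutenCoord_eq (hn : 3 ≤ n) (h : IsConformalChart G ψ s w Ω) (hu : u ∈ Ω) :
    schoutenCoord G u = vecMulVec ((jacobian ψ u)ᵀ *ᵥ w u) ((jacobian ψ u)ᵀ *ᵥ w u)
      - (jacobian ψ u)ᵀ * gradMat w u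
      - ((w u ⬝ᵥ w u) / 2) • ((jacobian ψ u)ᵀ * jacobian ψ u) := by
  set J := jacobian ψ u with hJ
  set K := gradMat w u with hK
  set W := w u ⬝ᵥ w u with hW
  set d : Fin n → ℝ := Jᵀ *ᵥ w u with hd
  set t := (J⁻¹ * K).trace with ht
  have hJR : J * J⁻¹ = 1 := h.jac_mul_inv hu
  have hRJ : J⁻¹ * J = 1 := h.inv_mul_jac hu
  have hTR : (Jᵀ)⁻¹ * Jᵀ = 1 := by
    rw [← Matrix.transpose_nonsing_inv, ← Matrix.transpose_mul, hJR, Matrix.transpose_one]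
  have hric := h.ricciMat_eq hu
  simp only [← hJ, ← hK, ← hW, ← hd, ← ht] at hric
  have hinv : (G u)⁻¹ = Real.exp (-(2 * s u)) • (J⁻¹ * (Jᵀ)⁻¹) := by
    rw [h.eq u hu]
    refine Matrix.inv_eq_right_inv ?_
    rw [smul_mul_smul_comm, ← Real.exp_add, add_neg_cancel, Real.exp_zero, one_smul, ← hJ]
    calc Jᵀ * J * (J⁻¹ * (Jᵀ)⁻¹) = Jᵀ * (J * J⁻¹) * (Jᵀ)⁻¹ := by noncomm_ring
      _ = 1 := by
        rw [hJR, mul_one]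
        exact Matrix.mul_nonsing_inv _ (by rw [Matrix.det_transpose]; exact (h.det_ne u hu).isUnit)
  have t1 : (J⁻¹ * (Jᵀ)⁻¹ * (Jᵀ * K)).trace = t := by
    rw [mul_assoc, ← mul_assoc (Jᵀ)⁻¹, hTR, one_mul]
  have t2 : (J⁻¹ * (Jᵀ)⁻¹ * (Jᵀ * J)).trace = n := by
    rw [mul_assoc, ← mul_assoc (Jᵀ)⁻¹, hTR, one_mul, hRJ]
    simp
  have t3 : (J⁻¹ * (Jᵀ)⁻¹ * vecMulVec d d).trace = W := by
    rw [mul_vecMulVec, trace_vecMulVec, hd, mulVec_mulVec, mul_assoc, hTR, mul_one,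
      dotProduct_mulVec, vecMul_transpose, mulVec_mulVec, hJR, one_mulVec]
  have hS : scalarCoord G u = Real.exp (-(2 * s u)) *
      (-((n : ℝ) - 1) * (2 * t + ((n : ℝ) - 2) * W)) := by
    rw [_root_.scalarCoord_eq (h.isMetricOn.symm u hu), hric, hinv]
    simp only [mul_sub, mul_add, mul_smul_comm, smul_mul_assoc, Matrix.trace_add, Matrix.trace_sub,
      Matrix.trace_smul, t1, t2, t3, smul_eq_mul]
    ring
  have hn2 : (n : ℝ) - 2 ≠ 0 := by
    have : (3 : ℝ) ≤ n := by exact_mod_cast hn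
    linarith
  have hn1 : (n : ℝ) - 1 ≠ 0 := by
    have : (3 : ℝ) ≤ n := by exact_mod_cast hn
    linarith
  -- The `e^{-2s}` of the scalar curvature cancels the `e^{2s}` of `G`. The trace `t` here matches
  -- the one in the Ricci tensor, so the Schouten tensor contains neither.
  have hSG : (scalarCoord G u / (2 * ((n : ℝ) - 1))) • G u =
      (-(2 * t + ((n : ℝ) - 2) * W) / 2) • (Jᵀ * J) := by
    rw [hS, h.eq u hu, smul_smul, ← hJ]
    congr 1
    have : Real.exp (-(2 * s u)) * Real.exp (2 * s u) = 1 := by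
      rw [← Real.exp_add, neg_add_cancel, Real.exp_zero]
    field_simp
    linear_combination (-(2 * t + ((n : ℝ) - 2) * W)) * this
  rw [_root_.schoutenCoord_eq, hSG, hric]
  ext i j
  simp only [Matrix.sub_apply, Matrix.add_apply, Matrix.smul_apply, smul_eq_mul]
  field_simp
  ring

end IsConformalChart

/-- The matrix `A g⁻¹ Aᵀ` of the dual tensor, where `A` is the Schouten tensor of `g`. -/
def dualCoord {n : ℕ} (G : EuclideanSpace ℝ (Fin n) → Matrix (Fin n) (Fin n) ℝ)
    (u : EuclideanSpace ℝ (Fin n)) : Matrix (Fin n) (Fin n) ℝ :=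
  schoutenCoord G u * (G u)⁻¹ * (schoutenCoord G u).transpose

theorem dualCoord_apply {n : ℕ} (G : EuclideanSpace ℝ (Fin n) → Matrix (Fin n) (Fin n) ℝ)
    (u : EuclideanSpace ℝ (Fin n)) (i j : Fin n) :
    dualCoord G u i j =
      ∑ a, ∑ b, schoutenCoord G u i a * schoutenCoord G u j b * (G u)⁻¹ a b := by
  simp only [dualCoord, Matrix.mul_apply, Matrix.transpose_apply, Finset.sum_mul]
  rw [Finset.sum_comm]
  exact Finset.sum_congr rfl fun a _ => Finset.sum_congr rfl fun b _ => by ring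

/-! ### The dual conformal chart and invariance of the Schouten tensor -/

namespace IsConformalChart

open Set Filter Topology Matrix

variable {n : ℕ} {Ω Ω' : Set (EuclideanSpace ℝ (Fin n))} {u : EuclideanSpace ℝ (Fin n)}
  {G : EuclideanSpace ℝ (Fin n) → Matrix (Fin n) (Fin n) ℝ}
  {ψ : EuclideanSpace ℝ (Fin n) → EuclideanSpace ℝ (Fin n)} {s : EuclideanSpace ℝ (Fin n) → ℝ}
  {w : EuclideanSpace ℝ (Fin n) → Fin n → ℝ}

/-- The flat coordinates of the dual metric. -/
def dualMap (ψ : EuclideanSpace ℝ (Fin n) → EuclideanSpace ℝ (Fin n))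
    (w : EuclideanSpace ℝ (Fin n) → Fin n → ℝ) (x : EuclideanSpace ℝ (Fin n)) :
    EuclideanSpace ℝ (Fin n) :=
  WithLp.toLp 2 fun a => ψ x a + 2 * (w x ⬝ᵥ w x)⁻¹ * w x a

/-- The conformal factor of the dual metric. -/
def dualFactor (s : EuclideanSpace ℝ (Fin n) → ℝ) (w : EuclideanSpace ℝ (Fin n) → Fin n → ℝ)
    (x : EuclideanSpace ℝ (Fin n)) : ℝ :=
  Real.log (w x ⬝ᵥ w x) - s x - Real.log 2

/-- The reflection in the hyperplane orthogonal to `v`. -/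
def reflMat (v : Fin n → ℝ) : Matrix (Fin n) (Fin n) ℝ := 1 - (2 * (v ⬝ᵥ v)⁻¹) • vecMulVec v v

theorem reflMat_mul_self {v : Fin n → ℝ} (hv : v ⬝ᵥ v ≠ 0) : reflMat v * reflMat v = 1 := by
  have h : vecMulVec v v * vecMulVec v v = (v ⬝ᵥ v) • vecMulVec v v := by
    rw [vecMulVec_mul_vecMulVec]
    ext i j
    simp [vecMulVec_apply]
    ring
  simp only [reflMat, sub_mul, mul_sub, one_mul, mul_one, smul_mul_smul_comm, h, smul_smul]
  have : 2 * (v ⬝ᵥ v)⁻¹ * (2 * (v ⬝ᵥ v)⁻¹) * (v ⬝ᵥ v) = 2 * (2 * (v ⬝ᵥ v)⁻¹) := by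
    field_simp
  rw [this]
  module

theorem reflMat_transpose (v : Fin n → ℝ) : (reflMat v)ᵀ = reflMat v := by
  simp [reflMat, transpose_vecMulVec]

theorem reflMat_mulVec {v : Fin n → ℝ} (hv : v ⬝ᵥ v ≠ 0) : reflMat v *ᵥ v = -v := by
  have : vecMulVec v v *ᵥ v = (v ⬝ᵥ v) • v := by
    ext i
    simp [vecMulVec_apply, mulVec, dotProduct, Finset.sum_mul]
    exact Finset.sum_congr rfl fun j _ => by ring
  rw [reflMat, sub_mulVec, one_mulVec, smul_mulVec, this, smul_smul, mul_assoc,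
    inv_mul_cancel₀ hv]
  module

theorem contDiffOn_dotProduct (h : IsConformalChart G ψ s w Ω) :
    ContDiffOn ℝ ∞ (fun x => w x ⬝ᵥ w x) Ω :=
  ContDiffOn.sum fun a _ => (h.smooth_grad a).mul (h.smooth_grad a)

theorem partialDeriv_dotProduct (h : IsConformalChart G ψ s w Ω) (hu : u ∈ Ω) (i : Fin n) :
    partialDeriv i (fun x => w x ⬝ᵥ w x) u = 2 * ((gradMat w u)ᵀ *ᵥ w u) i := by
  have hwd : ∀ a, DifferentiableAt ℝ (fun x => w x a) u := fun a =>
    differentiableAt_of_smooth h.isOpen (h.smooth_grad a) hu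
  simp only [dotProduct, mulVec]
  rw [partialDeriv_sum (fun a _ => (hwd a).fun_mul (hwd a)), Finset.mul_sum]
  refine Finset.sum_congr rfl fun a _ => ?_
  rw [partialDeriv_mul (hwd a) (hwd a)]
  simp only [gradMat, Matrix.transpose_apply, Matrix.of_apply]
  ring

theorem smooth_dualMap (h : IsConformalChart G ψ s w Ω) (hw : ∀ x ∈ Ω, w x ⬝ᵥ w x ≠ 0) :
    ContDiffOn ℝ ∞ (dualMap ψ w) Ω := by
  rw [contDiffOn_piLp]
  intro a
  exact (contDiffOn_component h.smooth a).add
    ((contDiffOn_const.mul (h.contDiffOn_dotProduct.inv hw)).mul (h.smooth_grad a))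

theorem partialDeriv_inv' {f : EuclideanSpace ℝ (Fin n) → ℝ} (hf : DifferentiableAt ℝ f u)
    (h0 : f u ≠ 0) (i : Fin n) :
    partialDeriv i (fun x => (f x)⁻¹) u = -partialDeriv i f u * (f u)⁻¹ ^ 2 := by
  have : HasFDerivAt (fun x => (f x)⁻¹) (-((f u) ^ 2)⁻¹ • fderiv ℝ f u) u :=
    (hasDerivAt_inv h0).comp_hasFDerivAt u hf.hasFDerivAt
  rw [partialDeriv, this.fderiv, partialDeriv]
  simp
  ring

/-- The inversion `w ↦ w / |w|²` has derivative `|w|⁻²` times the reflection along `w`; compose with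
the differential `K` of `w`. -/
theorem jacobian_dualMap (h : IsConformalChart G ψ s w Ω) (hw : ∀ x ∈ Ω, w x ⬝ᵥ w x ≠ 0)
    (hu : u ∈ Ω) : jacobian (dualMap ψ w) u =
      jacobian ψ u + (2 * (w u ⬝ᵥ w u)⁻¹) • (reflMat (w u) * gradMat w u) := by
  have hwd : ∀ a, DifferentiableAt ℝ (fun x => w x a) u := fun a =>
    differentiableAt_of_smooth h.isOpen (h.smooth_grad a) hu
  have hW := differentiableAt_of_smooth h.isOpen h.contDiffOn_dotProduct hu
  have hψ : ∀ a, DifferentiableAt ℝ (fun x => ψ x a) u := fun a =>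
    differentiableAt_of_smooth h.isOpen (contDiffOn_component h.smooth a) hu
  have hWi : DifferentiableAt ℝ (fun x => (w x ⬝ᵥ w x)⁻¹) u := hW.fun_inv (hw u hu)
  have h2 : DifferentiableAt ℝ (fun x => 2 * (w x ⬝ᵥ w x)⁻¹) u := hWi.const_mul 2
  ext a k
  change partialDeriv k (fun x => ψ x a + 2 * (w x ⬝ᵥ w x)⁻¹ * w x a) u = _
  rw [partialDeriv_add (hψ a) (h2.fun_mul (hwd a)), partialDeriv_mul h2 (hwd a),
    partialDeriv_mul (differentiableAt_const 2) hWi, partialDeriv_const,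
    partialDeriv_inv' hW (hw u hu), h.partialDeriv_dotProduct hu]
  have : (vecMulVec (w u) (w u) * gradMat w u) a k = w u a * ((gradMat w u)ᵀ *ᵥ w u) k := by
    simp only [Matrix.mul_apply, vecMulVec_apply, mulVec, dotProduct, Finset.mul_sum,
      Matrix.transpose_apply]
    exact Finset.sum_congr rfl fun b _ => by ring
  simp only [reflMat, sub_mul, one_mul, smul_mul_assoc, Matrix.add_apply, Matrix.smul_apply,
    Matrix.sub_apply, smul_eq_mul, this]
  simp only [jacobian, gradMat, Matrix.of_apply]
  ring

/-- The key factorization. In `Jᵀ R L` the reflection squares to `1` in front of `K`, giving the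
Hessian term, while `Jᵀ R J` supplies `Jᵀ J` and the rank-one term. It shows that `L` is invertible
where `A` is, and computes `A G⁻¹ A`. -/
theorem schoutenCoord_eq_mul_dual (hn : 3 ≤ n) (h : IsConformalChart G ψ s w Ω)
    (hw : ∀ x ∈ Ω, w x ⬝ᵥ w x ≠ 0) (hu : u ∈ Ω) : schoutenCoord G u =
      -((w u ⬝ᵥ w u) / 2) •
        ((jacobian ψ u)ᵀ * reflMat (w u) * jacobian (dualMap ψ w) u) := by
  have hW := hw u hu
  rw [h.schoutenCoord_eq hn hu, h.jacobian_dualMap hw hu, mul_add, mul_smul_comm,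
    mul_assoc _ (reflMat (w u)) (reflMat (w u) * _), ← mul_assoc (reflMat (w u)) (reflMat (w u)),
    reflMat_mul_self hW, one_mul, smul_add, smul_smul]
  have e1 : -((w u ⬝ᵥ w u) / 2) * (2 * (w u ⬝ᵥ w u)⁻¹) = -1 := by field_simp
  have e2 : vecMulVec ((jacobian ψ u)ᵀ *ᵥ w u) ((jacobian ψ u)ᵀ *ᵥ w u) =
      (jacobian ψ u)ᵀ * vecMulVec (w u) (w u) * jacobian ψ u := by
    rw [mul_vecMulVec, vecMulVec_mul, mulVec_transpose]
  have e3 : -((w u ⬝ᵥ w u) / 2) * (2 * (w u ⬝ᵥ w u)⁻¹) = -1 := e1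
  rw [e1, e2, reflMat, mul_sub, mul_one, sub_mul, mul_smul_comm, smul_mul_assoc, smul_sub, smul_smul,
    e3]
  module

theorem schoutenCoord_symm (hn : 3 ≤ n) (h : IsConformalChart G ψ s w Ω) (hu : u ∈ Ω) :
    (schoutenCoord G u)ᵀ = schoutenCoord G u := by
  rw [h.schoutenCoord_eq hn hu]
  simp only [transpose_sub, transpose_smul, transpose_vecMulVec, h.transpose_mul_gradMat_symm hu,
    transpose_mul, transpose_transpose]

theorem metric_inv (h : IsConformalChart G ψ s w Ω) (hu : u ∈ Ω) :
    (G u)⁻¹ = Real.exp (-(2 * s u)) • ((jacobian ψ u)⁻¹ * ((jacobian ψ u)⁻¹)ᵀ) := by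
  rw [h.eq u hu]
  refine Matrix.inv_eq_right_inv ?_
  rw [smul_mul_smul_comm, ← Real.exp_add, add_neg_cancel, Real.exp_zero, one_smul, mul_assoc,
    ← mul_assoc (jacobian ψ u), h.jac_mul_inv hu, one_mul, ← transpose_mul, h.inv_mul_jac hu,
    transpose_one]

/-- The dual of a conformally flat metric is conformally flat. -/
theorem dual (hn : 3 ≤ n) (h : IsConformalChart G ψ s w Ω) (hw : ∀ x ∈ Ω, w x ⬝ᵥ w x ≠ 0)
    (hA : ∀ x ∈ Ω, (schoutenCoord G x).det ≠ 0) :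
    IsConformalChart (dualCoord G) (dualMap ψ w) (dualFactor s w) (fun x => -w x) Ω where
  isOpen := h.isOpen
  smooth := h.smooth_dualMap hw
  smooth_factor := ((h.contDiffOn_dotProduct.log hw).sub h.smooth_factor).sub contDiffOn_const
  smooth_grad a := (h.smooth_grad a).neg
  -- By the factorization, a singular Jacobian of the dual map would make the Schouten tensor
  -- degenerate.
  det_ne x hx h0 := by
    refine hA x hx ?_
    rw [h.schoutenCoord_eq_mul_dual hn hw hx, det_smul, det_mul, h0, mul_zero, mul_zero]
  eq x hx := by
    have hT := h.schoutenCoord_symm hn hx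
    have hW := hw x hx
    have hWpos : 0 < w x ⬝ᵥ w x :=
      lt_of_le_of_ne (Finset.sum_nonneg fun a _ => mul_self_nonneg _) (Ne.symm hW)
    -- The `log 2` in `dualFactor` is the `1/2` in the factorization of the Schouten tensor, which
    -- enters here squared.
    have hexp : Real.exp (2 * dualFactor s w x) =
        Real.exp (-(2 * s x)) * (-((w x ⬝ᵥ w x) / 2) * -((w x ⬝ᵥ w x) / 2)) := by
      rw [dualFactor, mul_sub, mul_sub, Real.exp_sub, Real.exp_sub, Real.exp_neg]
      have e : ∀ y : ℝ, 0 < y → Real.exp (2 * Real.log y) = y * y := fun y hy => by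
        rw [two_mul, Real.exp_add, Real.exp_log hy]
      rw [e _ hWpos, e 2 two_pos]
      field_simp
    have hd : dualCoord G x = (schoutenCoord G x)ᵀ * (G x)⁻¹ * schoutenCoord G x := by
      rw [dualCoord, hT]
    have hJ1 : jacobian ψ x * (jacobian ψ x)⁻¹ = 1 := h.jac_mul_inv hx
    have hJ2 : ((jacobian ψ x)⁻¹)ᵀ * (jacobian ψ x)ᵀ = 1 := by
      rw [← transpose_mul, hJ1, transpose_one]
    rw [hd, h.metric_inv hx, h.schoutenCoord_eq_mul_dual hn hw hx, hexp]
    simp only [transpose_smul, transpose_mul, transpose_transpose, reflMat_transpose]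
    simp only [smul_mul_assoc, mul_smul_comm, smul_smul]
    congr 1
    · ring
    -- `J` cancels against the inverse metric, and then the two reflections cancel each other.
    · calc _ = (jacobian (dualMap ψ w) x)ᵀ * (reflMat (w x) * (jacobian ψ x * (jacobian ψ x)⁻¹) *
            (((jacobian ψ x)⁻¹)ᵀ * (jacobian ψ x)ᵀ) * reflMat (w x)) * jacobian (dualMap ψ w) x := by
            noncomm_ring
        _ = _ := by rw [hJ1, hJ2, mul_one, mul_one, reflMat_mul_self hW, mul_one]
  partialDeriv_factor x hx i := by
    have hW := hw x hx
    have hWd := differentiableAt_of_smooth h.isOpen h.contDiffOn_dotProduct hx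
    have hs := differentiableAt_of_smooth h.isOpen h.smooth_factor hx
    have hlog : partialDeriv i (fun x => Real.log (w x ⬝ᵥ w x)) x =
        (w x ⬝ᵥ w x)⁻¹ * (2 * ((gradMat w x)ᵀ *ᵥ w x) i) := by
      rw [← h.partialDeriv_dotProduct hx, partialDeriv, (hWd.hasFDerivAt.log hW).fderiv]
      rfl
    have e1 : partialDeriv i (dualFactor s w) x =
        (w x ⬝ᵥ w x)⁻¹ * (2 * ((gradMat w x)ᵀ *ᵥ w x) i) - ((jacobian ψ x)ᵀ *ᵥ w x) i := by
      change partialDeriv i (fun x => Real.log (w x ⬝ᵥ w x) - s x - Real.log 2) x = _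
      rw [partialDeriv_sub ((hWd.log hW).fun_sub hs) (differentiableAt_const _),
        partialDeriv_sub (hWd.log hW) hs, hlog, partialDeriv_const, sub_zero,
        h.partialDeriv_factor x hx]
      rfl
    -- `R w = -w` flips the sign of the `K` term. This is why the dual gradient is exactly `-w`.
    have e2 : (jacobian (dualMap ψ w) x)ᵀ *ᵥ w x =
        (jacobian ψ x)ᵀ *ᵥ w x - (2 * (w x ⬝ᵥ w x)⁻¹) • ((gradMat w x)ᵀ *ᵥ w x) := by
      rw [h.jacobian_dualMap hw hx, transpose_add, transpose_smul, transpose_mul,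
        reflMat_transpose, add_mulVec, smul_mulVec, ← mulVec_mulVec, reflMat_mulVec hW, mulVec_neg,
        smul_neg, sub_eq_add_neg]
    calc _ = -((jacobian (dualMap ψ w) x)ᵀ *ᵥ w x) i := by
          rw [e1, e2, Pi.sub_apply, Pi.smul_apply, smul_eq_mul]
          ring
      _ = _ := by
          simp [mulVec, dotProduct]

/-- The dual of a conformally flat metric has the same Schouten tensor. -/
theorem schoutenCoord_dual (hn : 3 ≤ n) (h : IsConformalChart G ψ s w Ω)
    (hw : ∀ x ∈ Ω, w x ⬝ᵥ w x ≠ 0) (hA : ∀ x ∈ Ω, (schoutenCoord G x).det ≠ 0) (hu : u ∈ Ω) :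
    schoutenCoord (dualCoord G) u = schoutenCoord G u := by
  have hW := hw u hu
  have hK : gradMat (fun x => -w x) u = -gradMat w u := by
    ext a i
    exact partialDeriv_neg (f := fun x => w x a) i
  -- The formula for the dual chart with gradient `-w` reduces to `-(|w|²/2) Lᵀ R J`, the transpose
  -- of the factorization of the original tensor; hence the passage to `(schoutenCoord G u)ᵀ` first.
  rw [(h.dual hn hw hA).schoutenCoord_eq hn hu, ← h.schoutenCoord_symm hn hu,
    h.schoutenCoord_eq_mul_dual hn hw hu, hK]
  set L := jacobian (dualMap ψ w) u with hL
  have e2 : vecMulVec (Lᵀ *ᵥ (-w u)) (Lᵀ *ᵥ (-w u)) = Lᵀ * vecMulVec (w u) (w u) * L := by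
    rw [mul_vecMulVec, vecMulVec_mul, mulVec_transpose, mulVec_transpose, neg_vecMul, neg_vecMulVec,
      vecMulVec_neg, neg_neg]
  have e3 : reflMat (w u) * L =
      reflMat (w u) * jacobian ψ u + (2 * (w u ⬝ᵥ w u)⁻¹) • gradMat w u := by
    rw [hL, h.jacobian_dualMap hw hu, mul_add, mul_smul_comm, ← mul_assoc, reflMat_mul_self hW,
      one_mul]
  have e4 : reflMat (w u) * L = L - (2 * (w u ⬝ᵥ w u)⁻¹) • (vecMulVec (w u) (w u) * L) := by
    rw [reflMat, sub_mul, one_mul, smul_mul_assoc]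
  have e5 : -((w u ⬝ᵥ w u) / 2) * (2 * (w u ⬝ᵥ w u)⁻¹) = -1 := by field_simp
  have e6 : reflMat (w u) * jacobian ψ u = L - (2 * (w u ⬝ᵥ w u)⁻¹) • (vecMulVec (w u) (w u) * L)
      - (2 * (w u ⬝ᵥ w u)⁻¹) • gradMat w u := by
    rw [← e4, e3, add_sub_cancel_right]
  simp only [transpose_smul, transpose_mul, transpose_transpose, reflMat_transpose]
  rw [e2, e6, neg_dotProduct_neg]
  simp only [mul_sub, mul_smul_comm, mul_neg, smul_sub, smul_smul, e5, mul_assoc, sub_neg_eq_add]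
  module

/-- Undoing the conformal factor leaves a chart with zero factor and zero gradient, to which
`connCurv_eq_zero` applies. -/
theorem exp_neg_smul (h : IsConformalChart G ψ s w Ω) :
    IsConformalChart (fun x => Real.exp (2 * -s x) • G x) ψ (fun _ => 0) (fun _ _ => 0) Ω where
  isOpen := h.isOpen
  smooth := h.smooth
  smooth_factor := contDiffOn_const
  smooth_grad _ := contDiffOn_const
  det_ne := h.det_ne
  eq x hx := by
    rw [h.eq x hx, smul_smul, ← Real.exp_add]
    simp
  partialDeriv_factor x hx i := by simp [partialDeriv_const]

end IsConformalChart

/-! ### Flat metrics are locally Euclidean -/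

section FlatCoordinates

open Set Filter Topology Matrix Metric

variable {n : ℕ} {Ω : Set (EuclideanSpace ℝ (Fin n))} {u p : EuclideanSpace ℝ (Fin n)}
  {Γ : Fin n → EuclideanSpace ℝ (Fin n) → Matrix (Fin n) (Fin n) ℝ}

theorem contDiffOn_smul_const {E Z : Type*} [NormedAddCommGroup E] [NormedSpace ℝ E]
    [NormedAddCommGroup Z] [NormedSpace ℝ Z] {f : E → ℝ} {S : Set E} (hf : ContDiffOn ℝ ∞ f S)
    (c : Z) : ContDiffOn ℝ ∞ (fun x => f x • c) S :=
  hf.smul contDiffOn_const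

theorem hasFDerivAt_apply_apply {E F G Z : Type*} [NormedAddCommGroup E] [NormedSpace ℝ E]
    [NormedAddCommGroup F] [NormedSpace ℝ F] [NormedAddCommGroup G] [NormedSpace ℝ G]
    [NormedAddCommGroup Z] [NormedSpace ℝ Z] {c : E → F →L[ℝ] G →L[ℝ] Z} {x : E}
    (hc : DifferentiableAt ℝ c x) (θ : F) (z : G) :
    HasFDerivAt (fun x => c x θ z) (((fderiv ℝ c x).flip θ).flip z) x := by
  refine ((hc.hasFDerivAt.clm_apply (hasFDerivAt_const θ x)).clm_apply
    (hasFDerivAt_const z x)).congr_fderiv ?_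
  ext v
  simp

/-- The elementary bilinear map `(θ, v) ↦ θ_k v_i e_j`. -/
def elementaryBilin (i j k : Fin n) : EuclideanSpace ℝ (Fin n) →L[ℝ]
    EuclideanSpace ℝ (Fin n) →L[ℝ] EuclideanSpace ℝ (Fin n) :=
  (EuclideanSpace.proj (𝕜 := ℝ) k : EuclideanSpace ℝ (Fin n) →L[ℝ] ℝ).smulRight
    ((EuclideanSpace.proj (𝕜 := ℝ) i : EuclideanSpace ℝ (Fin n) →L[ℝ] ℝ).smulRight
      (EuclideanSpace.single j (1 : ℝ)))

theorem elementaryBilin_apply (i j k : Fin n) (θ v : EuclideanSpace ℝ (Fin n)) (l : Fin n) :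
    elementaryBilin i j k θ v l = if l = j then θ k * v i else 0 := by
  simp [elementaryBilin]

/-- The connection form on covectors, as a bilinear map. -/
def connForm (Γ : Fin n → EuclideanSpace ℝ (Fin n) → Matrix (Fin n) (Fin n) ℝ)
    (x : EuclideanSpace ℝ (Fin n)) : EuclideanSpace ℝ (Fin n) →L[ℝ]
    EuclideanSpace ℝ (Fin n) →L[ℝ] EuclideanSpace ℝ (Fin n) :=
  ∑ i, ∑ j, ∑ k, Γ i x k j • elementaryBilin i j k

theorem connForm_apply (x θ v : EuclideanSpace ℝ (Fin n)) (j : Fin n) :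
    connForm Γ x θ v j = ∑ i, v i * ∑ k, θ k * Γ i x k j := by
  simp only [connForm, _root_.sum_apply, _root_.smul_apply, WithLp.ofLp_sum, Finset.sum_apply,
    PiLp.smul_apply, elementaryBilin_apply, smul_eq_mul, Finset.mul_sum]
  refine Finset.sum_congr rfl fun i _ => ?_
  rw [Finset.sum_comm]
  refine Finset.sum_congr rfl fun k _ => ?_
  simp
  ring

theorem contDiffOn_connForm (hΓ : ∀ i, MatSmoothOn (Γ i) Ω) : ContDiffOn ℝ ∞ (connForm Γ) Ω :=
  ContDiffOn.sum fun i _ => ContDiffOn.sum fun j _ => ContDiffOn.sum fun k _ =>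
    contDiffOn_smul_const (hΓ i k j) _

theorem fderiv_eq_sum (f : EuclideanSpace ℝ (Fin n) → ℝ) (v : EuclideanSpace ℝ (Fin n)) :
    fderiv ℝ f u v = ∑ i, v i * partialDeriv i f u := by
  conv_lhs => rw [sum_single_eq v, map_sum]
  exact Finset.sum_congr rfl fun i _ => by rw [map_smul, partialDeriv, smul_eq_mul]

theorem fderiv_connForm (hΩ : IsOpen Ω) (hΓ : ∀ i, MatSmoothOn (Γ i) Ω) (hu : u ∈ Ω)
    (v θ z : EuclideanSpace ℝ (Fin n)) (j : Fin n) :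
    fderiv ℝ (connForm Γ) u v θ z j =
      ∑ i, z i * ∑ k, θ k * ∑ l, v l * matDeriv l (Γ i) u k j := by
  have hc : DifferentiableAt ℝ (connForm Γ) u :=
    ((contDiffOn_connForm hΓ).differentiableOn (by simp)).differentiableAt (hΩ.mem_nhds hu)
  have h1 : HasFDerivAt (fun x => connForm Γ x θ z j) ((EuclideanSpace.proj (𝕜 := ℝ) j :
      EuclideanSpace ℝ (Fin n) →L[ℝ] ℝ).comp (((fderiv ℝ (connForm Γ) u).flip θ).flip z)) u :=
    (EuclideanSpace.proj (𝕜 := ℝ) j :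
      EuclideanSpace ℝ (Fin n) →L[ℝ] ℝ).hasFDerivAt.comp u (hasFDerivAt_apply_apply hc θ z)
  have hd : ∀ i k, DifferentiableAt ℝ (fun x => Γ i x k j) u := fun i k =>
    differentiableAt_of_smooth hΩ (hΓ i k j) hu
  have h2 : HasFDerivAt (fun x => connForm Γ x θ z j)
      (∑ i, z i • ∑ k, θ k • fderiv ℝ (fun x => Γ i x k j) u) u := by
    simp only [connForm_apply]
    exact HasFDerivAt.fun_sum fun i _ => (HasFDerivAt.fun_sum fun k _ =>
      (hd i k).hasFDerivAt.const_mul (θ k)).const_mul (z i)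
  have h3 : fderiv ℝ (connForm Γ) u v θ z j =
      (∑ i, z i • ∑ k, θ k • fderiv ℝ (fun x => Γ i x k j) u) v :=
    DFunLike.congr_fun (h1.unique h2) v
  rw [h3]
  simp only [_root_.sum_apply, _root_.smul_apply, smul_eq_mul, fderiv_eq_sum]
  rfl

/-- For the system `∂_i θ_j = ∑ k, Γ^k_{ij} θ_k` of parallel covectors, the integrability condition
of `exists_parallel_of_flat` is the vanishing of the curvature contracted with `θ`. -/
theorem connForm_flat (hΩ : IsOpen Ω) (hΓ : ∀ i, MatSmoothOn (Γ i) Ω) (hu : u ∈ Ω)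
    (h0 : ∀ i j, connCurv Γ i j u = 0) (v z θ : EuclideanSpace ℝ (Fin n)) :
    fderiv ℝ (connForm Γ) u v θ z - fderiv ℝ (connForm Γ) u z θ v +
      (connForm Γ u (connForm Γ u θ v) z - connForm Γ u (connForm Γ u θ z) v) = 0 := by
  ext j
  have hcurv : ∑ i, ∑ k, ∑ l, z i * v l * θ k * connCurv Γ l i u k j = 0 := by simp [h0]
  have e1 : ∀ v z, fderiv ℝ (connForm Γ) u v θ z j =
      ∑ i, ∑ k, ∑ l, z i * v l * θ k * matDeriv l (Γ i) u k j := by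
    intro v z
    rw [fderiv_connForm hΩ hΓ hu]
    simp only [Finset.mul_sum]
    exact Finset.sum_congr rfl fun i _ => Finset.sum_congr rfl fun k _ =>
      Finset.sum_congr rfl fun l _ => by ring
  have e2 : ∀ v z, connForm Γ u (connForm Γ u θ v) z j =
      ∑ i, ∑ k, ∑ l, z i * v l * θ k * (Γ l u * Γ i u) k j := by
    intro v z
    rw [connForm_apply]
    simp only [connForm_apply, Matrix.mul_apply, Finset.mul_sum, Finset.sum_mul]
    refine Finset.sum_congr rfl fun i _ => ?_
    rw [Finset.sum_comm' (t' := Finset.univ) (s' := fun _ => Finset.univ) (by simp),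
      Finset.sum_comm]
    rw [Finset.sum_comm]
    calc _ = ∑ l, ∑ k, ∑ m, z i * v l * θ k * (Γ l u k m * Γ i u m j) := by
          refine Finset.sum_congr rfl fun l _ => ?_
          rw [Finset.sum_comm]
          exact Finset.sum_congr rfl fun k _ => Finset.sum_congr rfl fun m _ => by ring
      _ = _ := by rw [Finset.sum_comm]
  have swap : ∀ F : Fin n → Fin n → Fin n → ℝ, ∑ i, ∑ k, ∑ l, v i * z l * θ k * F l i k =
      ∑ i, ∑ k, ∑ l, z i * v l * θ k * F i l k := by
    intro F
    rw [Finset.sum_comm]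
    conv_rhs => rw [Finset.sum_comm]
    refine Finset.sum_congr rfl fun k _ => ?_
    rw [Finset.sum_comm]
    exact Finset.sum_congr rfl fun i _ => Finset.sum_congr rfl fun l _ => by ring
  have hz : ((0 : EuclideanSpace ℝ (Fin n)) j) = 0 := rfl
  rw [PiLp.add_apply, PiLp.sub_apply, PiLp.sub_apply, e1, e1, e2, e2,
    swap (fun l i k => matDeriv l (Γ i) u k j), swap (fun l i k => (Γ l u * Γ i u) k j), hz, ← hcurv]
  simp only [← Finset.sum_sub_distrib, ← Finset.sum_add_distrib]
  exact Finset.sum_congr rfl fun i _ => Finset.sum_congr rfl fun k _ =>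
    Finset.sum_congr rfl fun l _ => by
      simp only [connCurv, Matrix.add_apply, Matrix.sub_apply]; ring

/-- Regularity of solutions of a first order system. -/
theorem contDiffOn_of_hasFDerivAt {E W : Type*} [NormedAddCommGroup E] [NormedSpace ℝ E]
    [NormedAddCommGroup W] [NormedSpace ℝ W] {Ω : Set E} (hΩ : IsOpen Ω)
    {Λ : E → W →L[ℝ] E →L[ℝ] W} (hΛ : ContDiffOn ℝ ∞ Λ Ω) {s : E → W}
    (hs : ∀ x ∈ Ω, HasFDerivAt s (Λ x (s x)) x) : ContDiffOn ℝ ∞ s Ω := by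
  rw [contDiffOn_infty]
  intro k
  induction k with
  | zero =>
    rw [Nat.cast_zero, contDiffOn_zero]
    exact fun x hx => (hs x hx).continuousAt.continuousWithinAt
  | succ k ih =>
    rw [Nat.cast_succ, contDiffOn_succ_iff_fderiv_of_isOpen hΩ]
    refine ⟨fun x hx => (hs x hx).differentiableAt.differentiableWithinAt, by simp, ?_⟩
    exact ((hΛ.of_le (by exact_mod_cast le_top)).clm_apply ih).congr fun x hx => (hs x hx).fderiv

theorem eqOn_const_of_partialDeriv_eq_zero {f : EuclideanSpace ℝ (Fin n) → ℝ} {r : ℝ}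
    (hf : ContDiffOn ℝ ∞ f (ball p r)) (h0 : ∀ x ∈ ball p r, ∀ i, partialDeriv i f x = 0)
    {x : EuclideanSpace ℝ (Fin n)} (hx : x ∈ ball p r) : f x = f p := by
  refine isOpen_ball.is_const_of_fderiv_eq_zero (convex_ball p r).isPreconnected
    (hf.differentiableOn (by simp)) ?_ hx (mem_ball_self (pos_of_mem_ball hx))
  intro y hy
  ext v
  rw [fderiv_eq_sum]
  simp [h0 y hy]

open scoped MatrixOrder Matrix.Norms.L2Operator in
theorem exists_eq_transpose_mul_self {A : Matrix (Fin n) (Fin n) ℝ} (hA : A.PosSemidef) :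
    ∃ B : Matrix (Fin n) (Fin n) ℝ, A = Bᵀ * B := by
  obtain ⟨B, hB⟩ := CStarAlgebra.nonneg_iff_eq_star_mul_self.1 hA.nonneg
  exact ⟨B, by simpa [star_eq_conjTranspose] using hB⟩

/-- A flat metric is locally the pull-back of the Euclidean metric. -/
theorem exists_flat_coordinates {H : EuclideanSpace ℝ (Fin n) → Matrix (Fin n) (Fin n) ℝ}
    (hH : IsMetricOn H Ω) (h0 : ∀ x ∈ Ω, ∀ i j, connCurv (leviCivita H) i j x = 0) (hp : p ∈ Ω)
    (hpos : (H p).PosDef) :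
    ∃ r > 0, ball p r ⊆ Ω ∧ ∃ ψ : EuclideanSpace ℝ (Fin n) → EuclideanSpace ℝ (Fin n),
      ContDiffOn ℝ ∞ ψ (ball p r) ∧ ∀ x ∈ ball p r, (jacobian ψ x).det ≠ 0 ∧
        H x = (jacobian ψ x)ᵀ * jacobian ψ x := by
  set Λ := connForm (leviCivita H) with hΛ
  have hΛs : ContDiffOn ℝ ∞ Λ Ω := contDiffOn_connForm hH.smooth_leviCivita
  -- The rows of `Θ₀` form an orthonormal coframe at `p`; they are the initial values of the
  -- parallel one-forms.
  obtain ⟨Θ₀, hΘ₀⟩ : ∃ Θ₀ : Matrix (Fin n) (Fin n) ℝ, H p = Θ₀ᵀ * Θ₀ :=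
    exists_eq_transpose_mul_self hpos.posSemidef
  have hfrob : ∀ a : Fin n, ∃ s : EuclideanSpace ℝ (Fin n) → EuclideanSpace ℝ (Fin n),
      s p = WithLp.toLp 2 (Θ₀ a) ∧ ∀ᶠ x in 𝓝 p, x ∈ Ω ∧ HasFDerivAt s (Λ x (s x)) x := by
    intro a
    obtain ⟨r, hr, hrΩ, s, hs0, hs⟩ := exists_parallel_of_flat hH.isOpen
      (hΛs.of_le (by simp)) (fun x hx v z θ =>
        connForm_flat hH.isOpen hH.smooth_leviCivita hx (h0 x hx) v z θ) hp
      (WithLp.toLp 2 (Θ₀ a))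
    exact ⟨s, hs0, Filter.eventually_of_mem (ball_mem_nhds p hr) fun x hx => ⟨hrΩ hx, hs x hx⟩⟩
  choose s hs0 hs using hfrob
  obtain ⟨r, hr, hball⟩ := Metric.eventually_nhds_iff_ball.1
    ((Filter.eventually_all.2 hs).and (hH.isOpen.mem_nhds hp))
  have hrΩ : ball p r ⊆ Ω := fun x hx => (hball x hx).2
  have hsd : ∀ a, ∀ x ∈ ball p r, HasFDerivAt (s a) (Λ x (s a x)) x :=
    fun a x hx => ((hball x hx).1 a).2
  have hss : ∀ a, ContDiffOn ℝ ∞ (s a) (ball p r) := fun a =>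
    contDiffOn_of_hasFDerivAt isOpen_ball (hΛs.mono hrΩ) (hsd a)
  -- Torsion-freeness makes a parallel one-form closed, hence exact on the convex ball. The
  -- primitives are the flat coordinates.
  have hprim : ∀ a, ∃ f : EuclideanSpace ℝ (Fin n) → ℝ, ∀ x ∈ ball p r,
      HasFDerivAt f (innerSL ℝ (s a x)) x := by
    intro a
    have hω : ∀ x ∈ ball p r, HasFDerivAt (fun x => (innerSL ℝ (s a x) :
        EuclideanSpace ℝ (Fin n) →L[ℝ] ℝ)) ((innerSL ℝ).comp (Λ x (s a x))) x := fun x hx =>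
      (innerSL ℝ : EuclideanSpace ℝ (Fin n) →L[ℝ]
        EuclideanSpace ℝ (Fin n) →L[ℝ] ℝ).hasFDerivAt.comp x (hsd a x hx)
    refine (convex_ball p r).exists_forall_hasFDerivAt_of_fderiv_symmetric isOpen_ball
      (fun x hx => (hω x hx).differentiableAt.differentiableWithinAt) ?_
    intro x hx v z
    rw [(hω x hx).fderiv]
    change inner ℝ (Λ x (s a x) v) z = inner ℝ (Λ x (s a x) z) v
    have hin : ∀ v z, inner ℝ (Λ x (s a x) v) z =
        ∑ j, ∑ i, z j * v i * ∑ k, s a x k * leviCivita H i x k j := by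
      intro v z
      rw [PiLp.inner_apply]
      refine Finset.sum_congr rfl fun j _ => ?_
      rw [hΛ, connForm_apply]
      simp only [RCLike.inner_apply, conj_trivial, Finset.mul_sum]
      exact Finset.sum_congr rfl fun i _ => Finset.sum_congr rfl fun k _ => by ring
    rw [hin, hin, Finset.sum_comm]
    refine Finset.sum_congr rfl fun i _ => Finset.sum_congr rfl fun j _ => ?_
    rw [mul_comm (z j)]
    congr 1
    exact Finset.sum_congr rfl fun k _ => by rw [hH.leviCivita_symm (hrΩ hx)]
  choose f hf using hprim
  have hfs : ∀ a, ContDiffOn ℝ ∞ (f a) (ball p r) := by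
    intro a
    rw [contDiffOn_infty_iff_fderiv_of_isOpen isOpen_ball]
    exact ⟨fun x hx => (hf a x hx).differentiableAt.differentiableWithinAt,
      ((innerSL ℝ : EuclideanSpace ℝ (Fin n) →L[ℝ] EuclideanSpace ℝ (Fin n) →L[ℝ]
        ℝ).contDiff.comp_contDiffOn (hss a)).congr fun x hx => (hf a x hx).fderiv⟩
  let ψ : EuclideanSpace ℝ (Fin n) → EuclideanSpace ℝ (Fin n) := fun x => WithLp.toLp 2 fun a => f a x
  have hψ : ContDiffOn ℝ ∞ ψ (ball p r) := by
    rw [contDiffOn_piLp]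
    exact hfs
  have hJ : ∀ x ∈ ball p r, ∀ a j, jacobian ψ x a j = s a x j := by
    intro x hx a j
    change partialDeriv j (f a) x = _
    rw [partialDeriv, (hf a x hx).fderiv]
    simp [EuclideanSpace.inner_single_right]
  have hJs : MatSmoothOn (jacobian ψ) (ball p r) := smooth_jacobian isOpen_ball hψ
  have hJd : ∀ x ∈ ball p r, ∀ i, matDeriv i (jacobian ψ) x = jacobian ψ x * leviCivita H i x := by
    intro x hx i
    ext a j
    have h1 : HasFDerivAt (fun y => s a y j) ((EuclideanSpace.proj (𝕜 := ℝ) j :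
        EuclideanSpace ℝ (Fin n) →L[ℝ] ℝ).comp (Λ x (s a x))) x :=
      (EuclideanSpace.proj (𝕜 := ℝ) j :
        EuclideanSpace ℝ (Fin n) →L[ℝ] ℝ).hasFDerivAt.comp x (hsd a x hx)
    have h2 : matDeriv i (jacobian ψ) x a j = partialDeriv i (fun y => s a y j) x :=
      partialDeriv_congr isOpen_ball hx (fun y hy => hJ y hy a j) i
    rw [h2, partialDeriv, h1.fderiv, Matrix.mul_apply]
    change Λ x (s a x) (EuclideanSpace.single i 1) j = _
    rw [hΛ, connForm_apply]
    simp [hJ x hx]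
  have hHb : IsMetricOn H (ball p r) := hH.mono isOpen_ball hrΩ
  have hHi := hHb.smooth.inv hHb.det_ne
  -- The Gram matrix of a parallel coframe in the inverse metric is constant, since `∂J = J Γ` and
  -- `Γ` is metric. At `p` it is `1` by the choice of `Θ₀`, which gives `H = Jᵀ J`.
  have hconst : ∀ x ∈ ball p r, jacobian ψ x * (H x)⁻¹ * (jacobian ψ x)ᵀ =
      jacobian ψ p * (H p)⁻¹ * (jacobian ψ p)ᵀ := by
    intro x hx
    ext a b
    refine eqOn_const_of_partialDeriv_eq_zero
      (f := fun x => (jacobian ψ x * (H x)⁻¹ * (jacobian ψ x)ᵀ) a b)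
      (((hJs.mul hHi).mul hJs.transpose) a b) ?_ hx
    intro y hy i
    have : matDeriv i (fun x => jacobian ψ x * (H x)⁻¹ * (jacobian ψ x)ᵀ) y = 0 := by
      rw [matDeriv_mul isOpen_ball (hJs.mul hHi) hJs.transpose hy,
        matDeriv_mul isOpen_ball hJs hHi hy, matDeriv_transpose, hJd y hy,
        matDeriv_inv isOpen_ball hHb.smooth hHb.det_ne hy, hHb.matDeriv_eq hy, transpose_mul]
      have e1 := hHb.mul_inv hy
      have e2 := hHb.inv_mul hy
      have e3 : (H y)⁻¹ * ((leviCivita H i y)ᵀ * H y + H y * leviCivita H i y) * (H y)⁻¹ =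
          (H y)⁻¹ * (leviCivita H i y)ᵀ * (H y * (H y)⁻¹) +
            ((H y)⁻¹ * H y) * leviCivita H i y * (H y)⁻¹ := by noncomm_ring
      rw [e3, e1, e2]
      noncomm_ring
    exact congrFun₂ this a b
  have hp0 : jacobian ψ p = Θ₀ := by
    ext a j
    rw [hJ p (mem_ball_self hr), hs0]
  have hdet0 : Θ₀.det ≠ 0 := by
    intro h
    have := hH.det_ne p hp
    rw [hΘ₀, det_mul, h, mul_zero] at this
    exact this rfl
  have hone : jacobian ψ p * (H p)⁻¹ * (jacobian ψ p)ᵀ = 1 := by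
    rw [hp0, hΘ₀, Matrix.mul_inv_rev, ← mul_assoc, Matrix.mul_nonsing_inv _ hdet0.isUnit, one_mul]
    exact Matrix.nonsing_inv_mul _ (by rw [Matrix.det_transpose]; exact hdet0.isUnit)
  refine ⟨r, hr, hrΩ, ψ, hψ, fun x hx => ?_⟩
  have h1 : jacobian ψ x * ((H x)⁻¹ * (jacobian ψ x)ᵀ) = 1 := by
    rw [← mul_assoc, hconst x hx, hone]
  have h2 := mul_eq_one_comm.1 h1
  refine ⟨?_, ?_⟩
  · intro h
    have := congrArg Matrix.det h1
    rw [det_mul, h, zero_mul, det_one] at this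
    exact zero_ne_one this
  · calc H x = H x * ((H x)⁻¹ * (jacobian ψ x)ᵀ * jacobian ψ x) := by rw [h2, mul_one]
      _ = (H x * (H x)⁻¹) * ((jacobian ψ x)ᵀ * jacobian ψ x) := by noncomm_ring
      _ = _ := by rw [hHb.mul_inv hx, one_mul]

end FlatCoordinates

/-! ### Making the gradient nonzero by an inversion -/

namespace IsConformalChart

open Set Filter Topology Matrix

variable {n : ℕ} {Ω Ω' : Set (EuclideanSpace ℝ (Fin n))} {u p : EuclideanSpace ℝ (Fin n)}
  {G : EuclideanSpace ℝ (Fin n) → Matrix (Fin n) (Fin n) ℝ}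
  {ψ : EuclideanSpace ℝ (Fin n) → EuclideanSpace ℝ (Fin n)} {s : EuclideanSpace ℝ (Fin n) → ℝ}
  {w : EuclideanSpace ℝ (Fin n) → Fin n → ℝ}

theorem mono (h : IsConformalChart G ψ s w Ω) (ho : IsOpen Ω') (hs : Ω' ⊆ Ω) :
    IsConformalChart G ψ s w Ω' where
  isOpen := ho
  smooth := h.smooth.mono hs
  smooth_factor := h.smooth_factor.mono hs
  smooth_grad a := (h.smooth_grad a).mono hs
  det_ne x hx := h.det_ne x (hs hx)
  eq x hx := h.eq x (hs hx)
  partialDeriv_factor x hx := h.partialDeriv_factor x (hs hx)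

/-- The gradient is forced: `Jᵀ` is invertible, so `ds = Jᵀ w` can be solved for `w`. -/
theorem of_eq (hΩ : IsOpen Ω) (hψ : ContDiffOn ℝ ∞ ψ Ω) (hs : ContDiffOn ℝ ∞ s Ω)
    (hdet : ∀ x ∈ Ω, (jacobian ψ x).det ≠ 0)
    (h : ∀ x ∈ Ω, G x = Real.exp (2 * s x) • ((jacobian ψ x)ᵀ * jacobian ψ x)) :
    IsConformalChart G ψ s (fun x => ((jacobian ψ x)ᵀ)⁻¹ *ᵥ fun i => partialDeriv i s x) Ω where
  isOpen := hΩ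
  smooth := hψ
  smooth_factor := hs
  smooth_grad a := by
    have := (smooth_jacobian hΩ hψ).transpose.inv fun x hx => by
      rw [det_transpose]; exact hdet x hx
    exact ContDiffOn.sum (s := Finset.univ) fun i _ => (this a i).mul (contDiffOn_partialDeriv hΩ hs i)
  det_ne := hdet
  eq := h
  partialDeriv_factor x hx i := by
    have h1 : (jacobian ψ x)ᵀ * ((jacobian ψ x)ᵀ)⁻¹ = 1 :=
      Matrix.mul_nonsing_inv _ (by rw [det_transpose]; exact (hdet x hx).isUnit)
    change _ = ((jacobian ψ x)ᵀ *ᵥ (((jacobian ψ x)ᵀ)⁻¹ *ᵥ fun i => partialDeriv i s x)) i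
    rw [mulVec_mulVec, h1, one_mulVec]

/-- The vector from `c` to `ψ x`. -/
def displacement (ψ : EuclideanSpace ℝ (Fin n) → EuclideanSpace ℝ (Fin n)) (c : Fin n → ℝ)
    (x : EuclideanSpace ℝ (Fin n)) : Fin n → ℝ := fun a => ψ x a - c a

/-- The chart `ψ` followed by the inversion in the unit sphere centred at `c`. -/
def invertMap (ψ : EuclideanSpace ℝ (Fin n) → EuclideanSpace ℝ (Fin n)) (c : Fin n → ℝ)
    (x : EuclideanSpace ℝ (Fin n)) : EuclideanSpace ℝ (Fin n) :=
  WithLp.toLp 2 fun a => (displacement ψ c x ⬝ᵥ displacement ψ c x)⁻¹ * (displacement ψ c x) a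

theorem smooth_sub_const (h : IsConformalChart G ψ s w Ω) (c : Fin n → ℝ) (a : Fin n) :
    ContDiffOn ℝ ∞ (fun x => (displacement ψ c x) a) Ω :=
  (contDiffOn_component h.smooth a).sub contDiffOn_const

theorem smooth_dist (h : IsConformalChart G ψ s w Ω) (c : Fin n → ℝ) :
    ContDiffOn ℝ ∞ (fun x => displacement ψ c x ⬝ᵥ displacement ψ c x) Ω :=
  ContDiffOn.sum fun a _ => (h.smooth_sub_const c a).mul (h.smooth_sub_const c a)

theorem partialDeriv_sub_const (h : IsConformalChart G ψ s w Ω) (c : Fin n → ℝ) (hu : u ∈ Ω)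
    (i a : Fin n) : partialDeriv i (fun x => (displacement ψ c x) a) u = jacobian ψ u a i := by
  have := partialDeriv_sub
    (differentiableAt_of_smooth h.isOpen (contDiffOn_component h.smooth a) hu)
    (differentiableAt_const (c a)) i
  rw [partialDeriv_const, sub_zero] at this
  exact this

theorem partialDeriv_dist (h : IsConformalChart G ψ s w Ω) (c : Fin n → ℝ) (hu : u ∈ Ω)
    (i : Fin n) : partialDeriv i (fun x => displacement ψ c x ⬝ᵥ displacement ψ c x) u =
      2 * ((jacobian ψ u)ᵀ *ᵥ (displacement ψ c u)) i := by
  have hd : ∀ a, DifferentiableAt ℝ (fun x => (displacement ψ c x) a) u := fun a =>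
    differentiableAt_of_smooth h.isOpen (h.smooth_sub_const c a) hu
  simp only [dotProduct, mulVec]
  rw [partialDeriv_sum (fun a _ => (hd a).fun_mul (hd a)), Finset.mul_sum]
  refine Finset.sum_congr rfl fun a _ => ?_
  rw [partialDeriv_mul (hd a) (hd a), h.partialDeriv_sub_const c hu, transpose_apply]
  ring

/-- Like `jacobian_dualMap`, this is the derivative of an inversion: a reflection divided by the
squared distance to the centre. -/
theorem jacobian_invertMap (h : IsConformalChart G ψ s w Ω) {c : Fin n → ℝ}
    (hc : ∀ x ∈ Ω, displacement ψ c x ⬝ᵥ displacement ψ c x ≠ 0) (hu : u ∈ Ω) :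
    jacobian (invertMap ψ c) u =
      (displacement ψ c u ⬝ᵥ displacement ψ c u)⁻¹ • (reflMat (displacement ψ c u) * jacobian ψ u) := by
  have hd : ∀ a, DifferentiableAt ℝ (fun x => (displacement ψ c x) a) u := fun a =>
    differentiableAt_of_smooth h.isOpen (h.smooth_sub_const c a) hu
  have hW := differentiableAt_of_smooth h.isOpen (h.smooth_dist c) hu
  have hWi : DifferentiableAt ℝ (fun x => (displacement ψ c x ⬝ᵥ displacement ψ c x)⁻¹) u :=
    hW.fun_inv (hc u hu)
  ext a k
  change partialDeriv k (fun x => (displacement ψ c x ⬝ᵥ displacement ψ c x)⁻¹ *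
    displacement ψ c x a) u = _
  rw [partialDeriv_mul hWi (hd a), partialDeriv_inv' hW (hc u hu), h.partialDeriv_dist c hu,
    h.partialDeriv_sub_const c hu]
  have : (vecMulVec (displacement ψ c u) (displacement ψ c u) * jacobian ψ u) a k =
      (displacement ψ c u) a * ((jacobian ψ u)ᵀ *ᵥ (displacement ψ c u)) k := by
    simp only [Matrix.mul_apply, vecMulVec_apply, mulVec, dotProduct, Finset.mul_sum,
      Matrix.transpose_apply]
    exact Finset.sum_congr rfl fun b _ => by ring
  simp only [reflMat, sub_mul, one_mul, smul_mul_assoc, Matrix.smul_apply,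
    Matrix.sub_apply, smul_eq_mul, this]
  ring

/-- Composing a conformal chart with an inversion. -/
theorem invert (h : IsConformalChart G ψ s w Ω) {c : Fin n → ℝ}
    (hc : ∀ x ∈ Ω, displacement ψ c x ⬝ᵥ displacement ψ c x ≠ 0) :
    IsConformalChart G (invertMap ψ c)
      (fun x => s x + Real.log (displacement ψ c x ⬝ᵥ displacement ψ c x))
      (fun x => (displacement ψ c x ⬝ᵥ displacement ψ c x) • (reflMat (displacement ψ c x) *ᵥ w x) -
        (2 : ℝ) • displacement ψ c x) Ω where
  isOpen := h.isOpen
  smooth := by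
    rw [contDiffOn_piLp]
    exact fun a => ((h.smooth_dist c).inv hc).mul (h.smooth_sub_const c a)
  smooth_factor := h.smooth_factor.add ((h.smooth_dist c).log hc)
  smooth_grad a := by
    have hr : MatSmoothOn (fun x => reflMat (displacement ψ c x)) Ω :=
      (MatSmoothOn.const 1).sub (MatSmoothOn.smul
        (contDiffOn_const.mul ((h.smooth_dist c).inv hc))
        fun a b => (h.smooth_sub_const c a).mul (h.smooth_sub_const c b))
    exact ((h.smooth_dist c).mul
      (ContDiffOn.sum (s := Finset.univ) fun b _ => (hr a b).mul (h.smooth_grad b))).sub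
      (contDiffOn_const.mul (h.smooth_sub_const c a))
  det_ne x hx := by
    have h1 : (reflMat (displacement ψ c x)).det ≠ 0 := by
      intro h0
      have := congrArg Matrix.det (reflMat_mul_self (hc x hx))
      rw [det_mul, h0, zero_mul, det_one] at this
      exact zero_ne_one this
    rw [h.jacobian_invertMap hc hx, det_smul, det_mul]
    exact mul_ne_zero (pow_ne_zero _ (inv_ne_zero (hc x hx))) (mul_ne_zero h1 (h.det_ne x hx))
  eq x hx := by
    have hD := hc x hx
    have hD0 : 0 < displacement ψ c x ⬝ᵥ displacement ψ c x :=
      lt_of_le_of_ne (Finset.sum_nonneg fun i _ => mul_self_nonneg _) hD.symm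
    rw [h.jacobian_invertMap hc hx, transpose_smul, transpose_mul, reflMat_transpose,
      smul_mul_smul_comm, mul_assoc, ← mul_assoc (reflMat _) (reflMat _), reflMat_mul_self hD,
      one_mul, smul_smul, mul_add, Real.exp_add, h.eq x hx]
    congr 1
    rw [two_mul (Real.log _), Real.exp_add, Real.exp_log hD0]
    field_simp
  partialDeriv_factor x hx i := by
    have hD := hc x hx
    have hlog : partialDeriv i (fun x => Real.log (displacement ψ c x ⬝ᵥ displacement ψ c x)) x =
        (displacement ψ c x ⬝ᵥ displacement ψ c x)⁻¹ *
          partialDeriv i (fun x => displacement ψ c x ⬝ᵥ displacement ψ c x) x := by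
      have hW := differentiableAt_of_smooth h.isOpen (h.smooth_dist c) hx
      rw [partialDeriv, (hW.hasFDerivAt.log hD).fderiv]
      rfl
    rw [partialDeriv_add (differentiableAt_of_smooth h.isOpen h.smooth_factor hx)
      (differentiableAt_of_smooth h.isOpen ((h.smooth_dist c).log hc) hx), hlog,
      h.partialDeriv_dist c hx, h.partialDeriv_factor x hx]
    -- With `D` the displacement, the transposed new Jacobian `|D|⁻² Jᵀ R` sends `|D|² R w` to `Jᵀ
    -- w` and, as `R D = -D`, sends `-2 D` to `2 |D|⁻² Jᵀ D`, the differential of `log |D|²`.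
    change ((jacobian ψ x)ᵀ *ᵥ w x) i + _ = ((jacobian (invertMap ψ c) x)ᵀ *ᵥ _) i
    rw [h.jacobian_invertMap hc hx, transpose_smul, transpose_mul, reflMat_transpose, mulVec_sub,
      mulVec_smul, mulVec_smul, smul_mulVec, smul_mulVec, mulVec_mulVec, mul_assoc,
      reflMat_mul_self hD, mul_one, ← mulVec_mulVec, reflMat_mulVec hD, mulVec_neg]
    simp only [Pi.sub_apply, Pi.smul_apply, Pi.neg_apply, smul_eq_mul]
    field_simp
    ring

/-- The duality divides by `|w|²`, so critical points of the conformal factor must be avoided. If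
`w` vanishes at `p`, an inversion replaces it there by `-2` times the nonzero displacement from the
centre. Non-vanishing then persists on a neighbourhood. -/
theorem exists_grad_ne_zero (hn : 0 < n) (h : IsConformalChart G ψ s w Ω) (hp : p ∈ Ω) :
    ∃ Ω' ψ' s' w', p ∈ Ω' ∧ Ω' ⊆ Ω ∧ IsConformalChart G ψ' s' w' Ω' ∧
      ∀ x ∈ Ω', w' x ⬝ᵥ w' x ≠ 0 := by
  have shrink : ∀ {Ω₁ ψ₁ s₁ w₁}, p ∈ Ω₁ → Ω₁ ⊆ Ω → IsConformalChart G ψ₁ s₁ w₁ Ω₁ →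
      w₁ p ⬝ᵥ w₁ p ≠ 0 → ∃ Ω' ψ' s' w', p ∈ Ω' ∧ Ω' ⊆ Ω ∧ IsConformalChart G ψ' s' w' Ω' ∧
        ∀ x ∈ Ω', w' x ⬝ᵥ w' x ≠ 0 := by
    intro Ω₁ ψ₁ s₁ w₁ hp₁ hs h₁ hw
    exact ⟨Ω₁ ∩ {x | w₁ x ⬝ᵥ w₁ x ≠ 0}, ψ₁, s₁, w₁, ⟨hp₁, hw⟩, inter_subset_left.trans hs,
      h₁.mono (h₁.contDiffOn_dotProduct.continuousOn.isOpen_inter_preimage h₁.isOpen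
        isOpen_compl_singleton) inter_subset_left, fun x hx => hx.2⟩
  by_cases hw : w p ⬝ᵥ w p = 0
  -- The centre lies at distance one from `ψ p`, so the inversion is regular near `p` and the
  -- displacement at `p` is a unit vector.
  · let c : Fin n → ℝ := (ψ p).ofLp - Pi.single ⟨0, hn⟩ 1
    have hcp : displacement ψ c p = Pi.single ⟨0, hn⟩ 1 := by
      ext a
      simp [displacement, c]
    have hcp' : displacement ψ c p ⬝ᵥ displacement ψ c p = 1 := by simp [hcp]
    have hopen : IsOpen (Ω ∩ {x | displacement ψ c x ⬝ᵥ displacement ψ c x ≠ 0}) :=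
      (h.smooth_dist c).continuousOn.isOpen_inter_preimage h.isOpen isOpen_compl_singleton
    refine shrink (Ω₁ := Ω ∩ {x | displacement ψ c x ⬝ᵥ displacement ψ c x ≠ 0}) ⟨hp, ?_⟩
      inter_subset_left ((h.mono hopen inter_subset_left).invert fun x hx => hx.2) ?_
    · rw [mem_ofPred_eq, hcp']
      exact one_ne_zero
    · rw [dotProduct_self_eq_zero.1 hw, mulVec_zero, smul_zero, zero_sub, hcp]
      simp
  · exact shrink hp Subset.rfl h hw

end IsConformalChart

/-! ### The duality in local coordinates -/

section Duality

open Set Filter Topology Matrix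

variable {n : ℕ} {Ω : Set (EuclideanSpace ℝ (Fin n))} {p : EuclideanSpace ℝ (Fin n)}
  {G : EuclideanSpace ℝ (Fin n) → Matrix (Fin n) (Fin n) ℝ} {σ : EuclideanSpace ℝ (Fin n) → ℝ}

/-- A conformally flat metric has a conformal chart near each point. -/
theorem exists_isConformalChart (hn : 0 < n) (hG : IsMetricOn G Ω) (hpos : ∀ x ∈ Ω, (G x).PosDef)
    (hσ : ContDiffOn ℝ ∞ σ Ω)
    (h0 : ∀ x ∈ Ω, ∀ i j, connCurv (leviCivita fun x => Real.exp (2 * σ x) • G x) i j x = 0)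
    (hp : p ∈ Ω) : ∃ Ω' ψ s w, p ∈ Ω' ∧ Ω' ⊆ Ω ∧ IsConformalChart G ψ s w Ω' ∧
      ∀ x ∈ Ω', w x ⬝ᵥ w x ≠ 0 := by
  have hH : IsMetricOn (fun x => Real.exp (2 * σ x) • G x) Ω := by
    refine ⟨hG.isOpen, MatSmoothOn.smul (contDiffOn_const.mul hσ).exp hG.smooth, fun x hx => ?_,
      fun x hx => ?_⟩
    · rw [transpose_smul, hG.symm x hx]
    · rw [det_smul]
      exact mul_ne_zero (pow_ne_zero _ (Real.exp_ne_zero _)) (hG.det_ne x hx)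
  obtain ⟨r, hr, hrΩ, ψ, hψ, h⟩ :=
    exists_flat_coordinates hH h0 hp ((hpos p hp).smul (Real.exp_pos _))
  -- The flat metric is `e^{2σ} G = Jᵀ J`, so the factor of `G` itself is `-σ`.
  have hchart := IsConformalChart.of_eq (G := G) (s := fun x => -σ x) Metric.isOpen_ball hψ
    (hσ.mono hrΩ).neg (fun x hx => (h x hx).1) fun x hx => by
      rw [← (h x hx).2, smul_smul, ← Real.exp_add, mul_neg, neg_add_cancel, Real.exp_zero, one_smul]
  obtain ⟨Ω', ψ', s', w', h1, h2, h3, h4⟩ :=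
    hchart.exists_grad_ne_zero hn (Metric.mem_ball_self hr)
  exact ⟨Ω', ψ', s', w', h1, h2.trans hrΩ, h3, h4⟩

/-- Local form of the duality between a conformally flat metric and the metric `A g⁻¹ A`. -/
theorem exists_conformal_factor_dualCoord (hn : 3 ≤ n) (hG : IsMetricOn G Ω)
    (hpos : ∀ x ∈ Ω, (G x).PosDef) (hσ : ContDiffOn ℝ ∞ σ Ω)
    (h0 : ∀ x ∈ Ω, ∀ i j, connCurv (leviCivita fun x => Real.exp (2 * σ x) • G x) i j x = 0)
    (hA : ∀ x ∈ Ω, (schoutenCoord G x).det ≠ 0) (hp : p ∈ Ω) :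
    ∃ Ω', IsOpen Ω' ∧ p ∈ Ω' ∧ Ω' ⊆ Ω ∧
      (∀ x ∈ Ω', (schoutenCoord G x)ᵀ = schoutenCoord G x) ∧
      (∀ x ∈ Ω', schoutenCoord (dualCoord G) x = schoutenCoord G x) ∧
      ∃ τ : EuclideanSpace ℝ (Fin n) → ℝ, ContDiffOn ℝ ∞ τ Ω' ∧ ∀ x ∈ Ω', ∀ i j,
        connCurv (leviCivita fun x => Real.exp (2 * τ x) • dualCoord G x) i j x = 0 := by
  obtain ⟨Ω', ψ, s, w, hp', hs, h, hw⟩ :=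
    exists_isConformalChart (by omega) hG hpos hσ h0 hp
  have hA' : ∀ x ∈ Ω', (schoutenCoord G x).det ≠ 0 := fun x hx => hA x (hs hx)
  have hd := h.dual hn hw hA'
  exact ⟨Ω', h.isOpen, hp', hs, fun x hx => h.schoutenCoord_symm hn hx,
    fun x hx => h.schoutenCoord_dual hn hw hA' hx, _, hd.smooth_factor.neg,
    fun x hx i j => hd.exp_neg_smul.connCurv_eq_zero hx i j⟩

end Duality

/-! ### Vanishing sectional curvature implies vanishing curvature -/

section SectionalCurvature

open Set Filter Topology Matrix

/-- A curvature-like 4-linear form with vanishing sectional curvatures is zero. -/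
theorem eq_zero_of_sectional_eq_zero {E : Type*} [AddCommGroup E] {Q : E → E → E → E → ℝ}
    (hadd₁ : ∀ v v' w x y, Q (v + v') w x y = Q v w x y + Q v' w x y)
    (hadd₃ : ∀ v w x x' y, Q v w (x + x') y = Q v w x y + Q v w x' y)
    (h₁₂ : ∀ v w x y, Q v w x y = -Q w v x y) (h₃₄ : ∀ v w x y, Q v w x y = -Q v w y x)
    (hcyc : ∀ v w x y, Q v w x y + Q w x v y + Q x v w y = 0)
    (h : ∀ v w, Q v w w v = 0) (v w x y : E) : Q v w x y = 0 := by
  have hadd₂ : ∀ v w w' x y, Q v (w + w') x y = Q v w x y + Q v w' x y := by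
    intro v w w' x y
    rw [h₁₂, hadd₁, h₁₂ w, h₁₂ w']
    ring
  have hadd₄ : ∀ v w x y y', Q v w x (y + y') = Q v w x y + Q v w x y' := by
    intro v w x y y'
    rw [h₃₄, hadd₃, h₃₄ v w y, h₃₄ v w y']
    ring
  -- Pair symmetry follows by combining the four cyclic identities with the two skew-symmetries.
  have hpair : ∀ v w x y, Q v w x y = Q x y v w := by
    intro v w x y
    linarith [hcyc v w x y, hcyc w x y v, hcyc x y v w, hcyc y v w x, h₁₂ v w x y, h₃₄ v w x y,
      h₁₂ w x v y, h₃₄ w x v y, h₁₂ x v w y, h₃₄ x v w y, h₁₂ y v w x, h₃₄ y v w x,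
      h₁₂ x y w v, h₃₄ x y v w, h₁₂ w y x v, h₃₄ w y x v, h₁₂ y w x v, h₁₂ v y x w, h₁₂ x y v w,
      h₃₄ w x y v, h₃₄ x v y w, h₃₄ y v x w, h₃₄ v y x w, h₃₄ y w v x, h₁₂ v y w x, h₃₄ w y v x,
      h₁₂ w y v x, h₁₂ x v y w, h₁₂ v x y w, h₃₄ v x w y]
  -- Polarize in the two middle slots; pair symmetry makes the two cross terms equal. Polarizing the
  -- outer slots next gives `h14`.
  have h1 : ∀ v w x, Q v w x v = 0 := by
    intro v w x
    have e := h v (w + x)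
    rw [hadd₂, hadd₃, hadd₃, h v w, h v x] at e
    linarith [hpair v x w v, h₁₂ w v v x, h₃₄ v w v x]
  have h14 : ∀ v w x y, Q v w x y = -Q y w x v := by
    intro v w x y
    have e := h1 (v + y) w x
    rw [hadd₁, hadd₄, hadd₄, h1, h1] at e
    linarith
  -- Skew in slots 1-2, 3-4 and 1-4, `Q` is totally antisymmetric, so the cyclic sum equals `3 Q`.
  linarith [hcyc v w x y, h₁₂ w x v y, h14 w x v y, h14 x v w y, h₃₄ y x v w, h14 y x w v,
    h₁₂ v x w y, h14 v x w y, h₃₄ y x w v, h14 x w v y, h₃₄ y w v x, h14 y w x v, h₁₂ x w v y,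
    h₁₂ x v w y, h₃₄ y v w x, h14 y v x w, h₁₂ w v x y]

variable {n : ℕ} {Ω : Set (EuclideanSpace ℝ (Fin n))} {u : EuclideanSpace ℝ (Fin n)}
  {G : EuclideanSpace ℝ (Fin n) → Matrix (Fin n) (Fin n) ℝ}

theorem connCurv_swap (Γ : Fin n → EuclideanSpace ℝ (Fin n) → Matrix (Fin n) (Fin n) ℝ)
    (i j : Fin n) : connCurv Γ i j u = -connCurv Γ j i u := by
  simp only [connCurv]
  abel

/-- Differentiate `∂_j G = Γ_jᵀ G + G Γ_j` once more and use that second derivatives of `G` commute: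
the curvature is skew-adjoint. -/
theorem IsMetricOn.transpose_mul_connCurv (hG : IsMetricOn G Ω) (hu : u ∈ Ω) (i j : Fin n) :
    (connCurv (leviCivita G) i j u)ᵀ * G u + G u * connCurv (leviCivita G) i j u = 0 := by
  have hΓ := hG.smooth_leviCivita
  have hd : ∀ i j, matDeriv i (matDeriv j G) u =
      (matDeriv i (leviCivita G j) u)ᵀ * G u +
        (leviCivita G j u)ᵀ * ((leviCivita G i u)ᵀ * G u + G u * leviCivita G i u) +
        (((leviCivita G i u)ᵀ * G u + G u * leviCivita G i u) * leviCivita G j u +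
          G u * matDeriv i (leviCivita G j) u) := by
    intro i j
    rw [matDeriv_congr hG.isOpen hu
        (B := fun x => (leviCivita G j x)ᵀ * G x + G x * leviCivita G j x)
        (fun x hx => hG.matDeriv_eq hx j),
      matDeriv_add hG.isOpen ((hΓ j).transpose.mul hG.smooth) (hG.smooth.mul (hΓ j)) hu,
      matDeriv_mul hG.isOpen (hΓ j).transpose hG.smooth hu,
      matDeriv_mul hG.isOpen hG.smooth (hΓ j) hu, matDeriv_transpose, hG.matDeriv_eq hu]
  have h := matDeriv_comm hG.isOpen hG.smooth hu i j
  rw [hd, hd, ← sub_eq_zero] at h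
  rw [← h]
  simp only [connCurv, transpose_add, transpose_sub, transpose_mul]
  noncomm_ring

/-- First Bianchi identity: torsion-freeness exchanges lower indices, after which the terms of the
cyclic sum cancel in pairs. -/
theorem IsMetricOn.connCurv_cyclic (hG : IsMetricOn G Ω) (hu : u ∈ Ω) (i j k l : Fin n) :
    connCurv (leviCivita G) i j u l k + connCurv (leviCivita G) j k u l i +
      connCurv (leviCivita G) k i u l j = 0 := by
  have h1 : ∀ i j k, matDeriv i (leviCivita G j) u l k = matDeriv i (leviCivita G k) u l j :=
    fun i j k => partialDeriv_congr hG.isOpen hu (fun x hx => hG.leviCivita_symm hx j k l) i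
  have h2 : ∀ i j k, (leviCivita G i u * leviCivita G j u) l k =
      (leviCivita G i u * leviCivita G k u) l j := by
    intro i j k
    simp only [Matrix.mul_apply]
    exact Finset.sum_congr rfl fun m _ => by rw [hG.leviCivita_symm hu j k]
  simp only [connCurv, Matrix.add_apply, Matrix.sub_apply]
  rw [h1 i j k, h1 j k i, h1 k i j, h2 i j k, h2 j k i, h2 k i j]
  ring

/-- The covariant curvature tensor `g(R(v, w) x, y)`. -/
def curvForm (G : EuclideanSpace ℝ (Fin n) → Matrix (Fin n) (Fin n) ℝ)
    (u v w x y : EuclideanSpace ℝ (Fin n)) : ℝ :=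
  ∑ i, ∑ j, ∑ k, ∑ l, (G u * connCurv (leviCivita G) i j u) l k * v i * w j * x k * y l

theorem curvForm_single (i j k l : Fin n) :
    curvForm G u (EuclideanSpace.single i 1) (EuclideanSpace.single j 1)
      (EuclideanSpace.single k 1) (EuclideanSpace.single l 1) =
        (G u * connCurv (leviCivita G) i j u) l k := by
  simp [curvForm]

theorem sectionalCoord_eq (hG : (G u)ᵀ = G u) (v w : EuclideanSpace ℝ (Fin n)) :
    sectionalCoord G u v w = curvForm G u v w w v /
      ((∑ i, ∑ j, G u i j * v i * v j) * (∑ i, ∑ j, G u i j * w i * w j)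
        - (∑ i, ∑ j, G u i j * v i * w j) ^ 2) := by
  rw [sectionalCoord, curvForm]
  congr 1
  refine Finset.sum_congr rfl fun i _ => Finset.sum_congr rfl fun j _ =>
    Finset.sum_congr rfl fun k _ => ?_
  rw [Finset.sum_comm]
  refine Finset.sum_congr rfl fun m _ => ?_
  simp only [Matrix.mul_apply, Finset.sum_mul]
  refine Finset.sum_congr rfl fun l _ => ?_
  rw [riemannCoord_eq, show G u l m = G u m l from congrFun₂ hG m l]
  ring

/-- The strict Cauchy–Schwarz inequality for a positive definite matrix. -/
theorem Matrix.PosDef.gram_pos {A : Matrix (Fin n) (Fin n) ℝ} (hA : A.PosDef)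
    {v w : EuclideanSpace ℝ (Fin n)} (h : LinearIndependent ℝ ![v, w]) :
    0 < (∑ i, ∑ j, A i j * v i * v j) * (∑ i, ∑ j, A i j * w i * w j)
        - (∑ i, ∑ j, A i j * v i * w j) ^ 2 := by
  have hB : ∀ v w : EuclideanSpace ℝ (Fin n), ∑ i, ∑ j, A i j * v i * w j =
      Matrix.toBilin' A v w := by
    intro v w
    rw [Matrix.toBilin'_apply]
    exact Finset.sum_congr rfl fun i _ => Finset.sum_congr rfl fun j _ => by ring
  have hpos : ∀ v : EuclideanSpace ℝ (Fin n), v ≠ 0 → 0 < Matrix.toBilin' A v v := by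
    intro v hv
    rw [Matrix.toBilin'_apply']
    have := hA.dotProduct_mulVec_pos (x := v.ofLp) (by simpa using hv)
    simpa using this
  have hsymm : Matrix.toBilin' A w v = Matrix.toBilin' A v w := by
    rw [Matrix.toBilin'_apply, Matrix.toBilin'_apply, Finset.sum_comm]
    refine Finset.sum_congr rfl fun i _ => Finset.sum_congr rfl fun j _ => ?_
    have : A j i = A i j := by simpa using hA.isHermitian.apply i j
    rw [this]
    ring
  rw [LinearIndependent.pair_iff] at h
  rw [hB, hB, hB]
  have hw : w ≠ 0 := fun h0 => by simpa using (h 0 1 (by simp [h0])).2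
  set a := Matrix.toBilin' A w w with ha
  set b := Matrix.toBilin' A v w with hb
  have ha0 : 0 < a := hpos w hw
  -- The form at `a • v - b • w`, a multiple of the component of `v` orthogonal to `w`, equals `a`
  -- times the Gram determinant.
  have hx : a • v - b • w ≠ 0 := fun h0 =>
    ha0.ne' (h a (-b) (by rw [neg_smul, ← sub_eq_add_neg, h0])).1
  have := hpos _ hx
  have e : Matrix.toBilin' A (a • v - b • w).ofLp (a • v - b • w).ofLp =
      a * (Matrix.toBilin' A v v * a - b ^ 2) := by
    simp only [WithLp.ofLp_sub, WithLp.ofLp_smul, map_sub, map_smul, LinearMap.sub_apply,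
      LinearMap.smul_apply, smul_eq_mul, hsymm, ← ha, ← hb]
    ring
  rw [e] at this
  exact pos_of_mul_pos_right this ha0.le

theorem IsMetricOn.connCurv_eq_zero_of_sectional (hG : IsMetricOn G Ω) (hu : u ∈ Ω)
    (hpos : (G u).PosDef) (h : ∀ v w : EuclideanSpace ℝ (Fin n), LinearIndependent ℝ ![v, w] →
      sectionalCoord G u v w = 0) (i j : Fin n) : connCurv (leviCivita G) i j u = 0 := by
  have hsmul : ∀ (c : ℝ) v w x y, curvForm G u (c • v) w x y = c * curvForm G u v w x y := by
    intro c v w x y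
    simp only [curvForm, Finset.mul_sum, PiLp.smul_apply, smul_eq_mul]
    exact Finset.sum_congr rfl fun i _ => Finset.sum_congr rfl fun j _ =>
      Finset.sum_congr rfl fun k _ => Finset.sum_congr rfl fun l _ => by ring
  have h₁₂ : ∀ v w x y, curvForm G u v w x y = -curvForm G u w v x y := by
    intro v w x y
    simp only [curvForm, ← Finset.sum_neg_distrib]
    rw [Finset.sum_comm]
    refine Finset.sum_congr rfl fun i _ => Finset.sum_congr rfl fun j _ =>
      Finset.sum_congr rfl fun k _ => Finset.sum_congr rfl fun l _ => ?_
    rw [connCurv_swap, mul_neg, Matrix.neg_apply]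
    ring
  have h₃₄ : ∀ v w x y, curvForm G u v w x y = -curvForm G u v w y x := by
    intro v w x y
    simp only [curvForm, ← Finset.sum_neg_distrib]
    refine Finset.sum_congr rfl fun i _ => Finset.sum_congr rfl fun j _ => ?_
    rw [Finset.sum_comm]
    refine Finset.sum_congr rfl fun k _ => Finset.sum_congr rfl fun l _ => ?_
    have e := congrFun₂ (hG.transpose_mul_connCurv hu i j) l k
    have e2 : ((connCurv (leviCivita G) i j u)ᵀ * G u) l k =
        (G u * connCurv (leviCivita G) i j u) k l := by
      rw [← Matrix.transpose_apply (G u * _), transpose_mul, hG.symm u hu]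
    rw [Matrix.add_apply, e2, Matrix.zero_apply] at e
    rw [eq_neg_of_add_eq_zero_left e]
    ring
  have hself : ∀ v x y, curvForm G u v v x y = 0 := fun v x y => by linarith [h₁₂ v v x y]
  -- The hypothesis covers independent pairs, where the Gram determinant can be divided out. For
  -- dependent pairs the form vanishes by skew-symmetry.
  have hsec : ∀ v w, curvForm G u v w w v = 0 := by
    intro v w
    by_cases hvw : LinearIndependent ℝ ![v, w]
    · have := h v w hvw
      rw [sectionalCoord_eq (hG.symm u hu), div_eq_zero_iff] at this
      exact this.resolve_right (hpos.gram_pos hvw).ne'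
    · rw [LinearIndependent.pair_iff] at hvw
      push Not at hvw
      obtain ⟨s, t, hst, hne⟩ := hvw
      by_cases hs : s = 0
      · have ht := hne hs
        have hw : w = (0 : ℝ) • w := by
          rw [hs, zero_smul, zero_add] at hst
          rw [(smul_eq_zero.1 hst).resolve_left ht, smul_zero]
        rw [h₁₂, hw, hsmul, zero_mul, neg_zero]
      · have hv : v = (-(s⁻¹ * t)) • w := by
          rw [neg_smul, mul_smul, ← smul_neg, ← eq_neg_of_add_eq_zero_left hst, smul_smul,
            inv_mul_cancel₀ hs, one_smul]
        have : ∀ z, curvForm G u v w w z = 0 := fun z => by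
          rw [hv, hsmul, hself, mul_zero]
        exact this v
  have hzero : ∀ v w x y, curvForm G u v w x y = 0 := by
    refine eq_zero_of_sectional_eq_zero ?_ ?_ h₁₂ h₃₄ ?_ hsec
    · intro v v' w x y
      simp only [curvForm, ← Finset.sum_add_distrib, PiLp.add_apply]
      exact Finset.sum_congr rfl fun i _ => Finset.sum_congr rfl fun j _ =>
        Finset.sum_congr rfl fun k _ => Finset.sum_congr rfl fun l _ => by ring
    · intro v w x x' y
      simp only [curvForm, ← Finset.sum_add_distrib, PiLp.add_apply]
      exact Finset.sum_congr rfl fun i _ => Finset.sum_congr rfl fun j _ =>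
        Finset.sum_congr rfl fun k _ => Finset.sum_congr rfl fun l _ => by ring
    · intro v w x y
      have e1 : curvForm G u w x v y = ∑ i, ∑ j, ∑ k, ∑ l,
          (G u * connCurv (leviCivita G) j k u) l i * v i * w j * x k * y l := by
        rw [curvForm]
        calc _ = ∑ j, ∑ i, ∑ k, ∑ l,
            (G u * connCurv (leviCivita G) j k u) l i * w j * x k * v i * y l :=
              Finset.sum_congr rfl fun j _ => Finset.sum_comm
          _ = _ := by
            rw [Finset.sum_comm]
            exact Finset.sum_congr rfl fun i _ => Finset.sum_congr rfl fun j _ =>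
              Finset.sum_congr rfl fun k _ => Finset.sum_congr rfl fun l _ => by ring
      have e2 : curvForm G u x v w y = ∑ i, ∑ j, ∑ k, ∑ l,
          (G u * connCurv (leviCivita G) k i u) l j * v i * w j * x k * y l := by
        rw [curvForm, Finset.sum_comm]
        refine Finset.sum_congr rfl fun i _ => ?_
        rw [Finset.sum_comm]
        exact Finset.sum_congr rfl fun j _ => Finset.sum_congr rfl fun k _ =>
          Finset.sum_congr rfl fun l _ => by ring
      rw [e1, e2, curvForm]
      simp only [← Finset.sum_add_distrib, ← add_mul]
      refine Finset.sum_eq_zero fun i _ => Finset.sum_eq_zero fun j _ =>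
        Finset.sum_eq_zero fun k _ => Finset.sum_eq_zero fun l _ => ?_
      have : (G u * connCurv (leviCivita G) i j u) l k + (G u * connCurv (leviCivita G) j k u) l i +
          (G u * connCurv (leviCivita G) k i u) l j = 0 := by
        simp only [Matrix.mul_apply, ← Finset.sum_add_distrib, ← mul_add]
        exact Finset.sum_eq_zero fun m _ => by rw [hG.connCurv_cyclic hu, mul_zero]
      rw [this]
      ring
  have hmul : G u * connCurv (leviCivita G) i j u = 0 := by
    ext l k
    rw [← curvForm_single, hzero, Matrix.zero_apply]
  rw [← one_mul (connCurv _ i j u), ← hG.inv_mul hu, mul_assoc, hmul, mul_zero]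

theorem sectionalCoord_eq_zero (h : ∀ i j, connCurv (leviCivita G) i j u = 0)
    (v w : EuclideanSpace ℝ (Fin n)) : sectionalCoord G u v w = 0 := by
  simp [sectionalCoord, riemannCoord_eq, h]

end SectionalCurvature

/-! ### Transition maps and components of tensors -/

section Transition

open Set Filter Topology Matrix

variable {n : ℕ} {M : Type*} [TopologicalSpace M]
  {e e' e'' : OpenPartialHomeomorph M (EuclideanSpace ℝ (Fin n))} {u : EuclideanSpace ℝ (Fin n)}

/-- The transition map between two charts. -/
def transition (e e' : OpenPartialHomeomorph M (EuclideanSpace ℝ (Fin n)))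
    (x : EuclideanSpace ℝ (Fin n)) : EuclideanSpace ℝ (Fin n) := e' (e.symm x)

/-- The coordinates in the chart `e` of the points of `U`. -/
def coordSet (e : OpenPartialHomeomorph M (EuclideanSpace ℝ (Fin n))) (U : Set M) :
    Set (EuclideanSpace ℝ (Fin n)) := e.target ∩ e.symm ⁻¹' U

theorem isOpen_coordSet (e : OpenPartialHomeomorph M (EuclideanSpace ℝ (Fin n))) {U : Set M}
    (hU : IsOpen U) : IsOpen (coordSet e U) := e.isOpen_inter_preimage_symm hU

theorem jacobian_comp {φ ψ : EuclideanSpace ℝ (Fin n) → EuclideanSpace ℝ (Fin n)}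
    (hφ : DifferentiableAt ℝ φ (ψ u)) (hψ : DifferentiableAt ℝ ψ u) :
    jacobian (fun x => φ (ψ x)) u = jacobian φ (ψ u) * jacobian ψ u := by
  ext a i
  have hφa : DifferentiableAt ℝ (fun x => φ x a) (ψ u) :=
    (EuclideanSpace.proj (𝕜 := ℝ) a : EuclideanSpace ℝ (Fin n) →L[ℝ] ℝ).differentiableAt.comp _ hφ
  rw [Matrix.mul_apply]
  refine (partialDeriv_comp hφa hψ i).trans (Finset.sum_congr rfl fun b _ => mul_comm _ _)

theorem jacobian_congr {φ ψ : EuclideanSpace ℝ (Fin n) → EuclideanSpace ℝ (Fin n)}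
    (h : φ =ᶠ[𝓝 u] ψ) : jacobian φ u = jacobian ψ u := by
  ext a i
  have : (fun x => φ x a) =ᶠ[𝓝 u] fun x => ψ x a := h.fun_comp fun y => y a
  simp only [jacobian, Matrix.of_apply, partialDeriv, this.fderiv_eq]

theorem jacobian_id : jacobian (fun x => x) u = (1 : Matrix (Fin n) (Fin n) ℝ) := by
  ext a i
  rw [jacobian_apply differentiableAt_fun_id, fderiv_fun_id]
  simp [Matrix.one_apply]

theorem transition_comp (h' : e.symm u ∈ e'.source) :
    transition e' e'' (transition e e' u) = transition e e'' u := by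
  simp only [transition, e'.left_inv h']

theorem transition_mem (h' : e.symm u ∈ e'.source) : transition e e' u ∈ e'.target :=
  e'.map_source h'

theorem transition_self (hu : u ∈ e.target) : transition e e u = u := e.right_inv hu

theorem jacobian_transition_self (hu : u ∈ e.target) : jacobian (transition e e) u = 1 := by
  rw [← jacobian_id (u := u)]
  exact jacobian_congr (Filter.eventually_of_mem (e.open_target.mem_nhds hu)
    fun x hx => transition_self hx)

variable [ChartedSpace (EuclideanSpace ℝ (Fin n)) M]

theorem contDiffOn_transition (he : e ∈ IsManifold.maximalAtlas (𝓡 n) ∞ M)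
    (he' : e' ∈ IsManifold.maximalAtlas (𝓡 n) ∞ M) :
    ContDiffOn ℝ ∞ (transition e e') (coordSet e e'.source) := by
  have h1 := contMDiffOn_symm_of_mem_maximalAtlas he
  have h2 := contMDiffOn_of_mem_maximalAtlas he'
  rw [← contMDiffOn_iff_contDiffOn]
  exact h2.comp (h1.mono inter_subset_left) inter_subset_right

/-- The matrix of a 2-tensor at `p` in the identification of `T_p M` with `ℝⁿ`. -/
def tensorMat (T : TwoTensor n M) (p : M) : Matrix (Fin n) (Fin n) ℝ :=
  Matrix.of fun i j => T p (EuclideanSpace.single i (1 : ℝ) : EuclideanSpace ℝ (Fin n))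
    (EuclideanSpace.single j (1 : ℝ) : EuclideanSpace ℝ (Fin n))

theorem apply_eq_tensorMat (T : TwoTensor n M) (p : M) (v w : EuclideanSpace ℝ (Fin n)) :
    T p v w = ∑ i, ∑ j, v i * w j * tensorMat T p i j := by
  have key : ∀ L : EuclideanSpace ℝ (Fin n) →L[ℝ] EuclideanSpace ℝ (Fin n) →L[ℝ] ℝ, L v w =
      ∑ i, ∑ j, v i * w j * L (EuclideanSpace.single i 1) (EuclideanSpace.single j 1) := by
    intro L
    conv_lhs => rw [sum_single_eq v, sum_single_eq w]
    simp only [map_sum, map_smul, _root_.sum_apply, _root_.smul_apply, smul_eq_mul, Finset.mul_sum]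
    rw [Finset.sum_comm]
    exact Finset.sum_congr rfl fun i _ => Finset.sum_congr rfl fun j _ => by ring
  exact key (T p)

theorem tensorMat_bilinOfMatrix (B : M → Matrix (Fin n) (Fin n) ℝ) (p : M) :
    tensorMat (fun q => (bilinOfMatrix (B q) : EuclideanSpace ℝ (Fin n) →L[ℝ]
      EuclideanSpace ℝ (Fin n) →L[ℝ] ℝ)) p = B p := by
  ext i j
  refine (bilinOfMatrix_apply _ _ _).trans ?_
  simp

theorem differentiableAt_transition (he : e ∈ IsManifold.maximalAtlas (𝓡 n) ∞ M)
    (he' : e' ∈ IsManifold.maximalAtlas (𝓡 n) ∞ M) (hu : u ∈ e.target)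
    (h' : e.symm u ∈ e'.source) : DifferentiableAt ℝ (transition e e') u :=
  ((contDiffOn_transition he he').differentiableOn (by simp)).differentiableAt
    ((isOpen_coordSet e e'.open_source).mem_nhds ⟨hu, h'⟩)

theorem jacobian_transition_mul (he : e ∈ IsManifold.maximalAtlas (𝓡 n) ∞ M)
    (he' : e' ∈ IsManifold.maximalAtlas (𝓡 n) ∞ M)
    (he'' : e'' ∈ IsManifold.maximalAtlas (𝓡 n) ∞ M) (hu : u ∈ e.target)
    (h' : e.symm u ∈ e'.source) (h'' : e.symm u ∈ e''.source) :
    jacobian (transition e e'') u =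
      jacobian (transition e' e'') (transition e e' u) * jacobian (transition e e') u := by
  have hl : e'.symm (transition e e' u) = e.symm u := e'.left_inv h'
  rw [← jacobian_comp (differentiableAt_transition he' he'' (transition_mem h') (by rwa [hl]))
    (differentiableAt_transition he he' hu h')]
  refine jacobian_congr (Filter.eventually_of_mem
    ((isOpen_coordSet e e'.open_source).mem_nhds ⟨hu, h'⟩) fun x hx => ?_)
  exact (transition_comp hx.2).symm

/-- By the chain rule, the product with the Jacobian of the reverse transition is the identity. -/
theorem det_jacobian_transition (he : e ∈ IsManifold.maximalAtlas (𝓡 n) ∞ M)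
    (he' : e' ∈ IsManifold.maximalAtlas (𝓡 n) ∞ M) (hu : u ∈ e.target)
    (h' : e.symm u ∈ e'.source) : (jacobian (transition e e') u).det ≠ 0 := by
  intro h0
  have := congrArg Matrix.det
    (jacobian_transition_mul he he' he hu h' (e.map_target hu))
  rw [jacobian_transition_self hu, det_one, det_mul, h0, mul_zero] at this
  exact one_ne_zero this

variable [IsManifold (𝓡 n) ∞ M]

/-- Since `T_p M` is `ℝⁿ` through the preferred chart at `p`, the differential of `e.symm` is the
Jacobian of the transition from `e` to that chart. -/
theorem coordVector_apply (he : e ∈ IsManifold.maximalAtlas (𝓡 n) ∞ M) (hu : u ∈ e.target)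
    (i a : Fin n) : WithLp.ofLp (p := 2) (V := Fin n → ℝ) (coordVector e i u) a =
      jacobian (transition e (chartAt (EuclideanSpace ℝ (Fin n)) (e.symm u))) u a i := by
  have hd : MDifferentiableAt (𝓡 n) (𝓡 n) e.symm u :=
    ((contMDiffOn_symm_of_mem_maximalAtlas he).contMDiffAt
      (e.open_target.mem_nhds hu)).mdifferentiableAt (by simp)
  rw [jacobian_apply (differentiableAt_transition he
    (IsManifold.chart_mem_maximalAtlas (e.symm u)) hu (mem_chart_source _ _))]
  change WithLp.ofLp (p := 2) (V := Fin n → ℝ)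
    (mfderiv (𝓡 n) (𝓡 n) e.symm u (EuclideanSpace.single i (1 : ℝ))) a = _
  rw [hd.mfderiv]
  simp [writtenInExtChartAt]
  rfl

theorem tensorCoord_eq_tensorMat (he : e ∈ IsManifold.maximalAtlas (𝓡 n) ∞ M) (T : TwoTensor n M)
    (hu : u ∈ e.target) : tensorCoord e T u =
      (jacobian (transition e (chartAt (EuclideanSpace ℝ (Fin n)) (e.symm u))) u)ᵀ *
        tensorMat T (e.symm u) *
        jacobian (transition e (chartAt (EuclideanSpace ℝ (Fin n)) (e.symm u))) u := by
  ext i j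
  have h := apply_eq_tensorMat T (e.symm u) (coordVector e i u) (coordVector e j u)
  refine h.trans ?_
  simp only [coordVector_apply he hu, Matrix.mul_apply, Matrix.transpose_apply, Finset.sum_mul]
  rw [Finset.sum_comm]
  exact Finset.sum_congr rfl fun a _ => Finset.sum_congr rfl fun b _ => by ring

/-- Change of the components of a 2-tensor under a change of charts. -/
theorem tensorCoord_transition (he : e ∈ IsManifold.maximalAtlas (𝓡 n) ∞ M)
    (he' : e' ∈ IsManifold.maximalAtlas (𝓡 n) ∞ M) (T : TwoTensor n M) (hu : u ∈ e.target)
    (h' : e.symm u ∈ e'.source) : tensorCoord e T u =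
      (jacobian (transition e e') u)ᵀ * tensorCoord e' T (transition e e' u) *
        jacobian (transition e e') u := by
  have hl : e'.symm (transition e e' u) = e.symm u := e'.left_inv h'
  rw [tensorCoord_eq_tensorMat he T hu, tensorCoord_eq_tensorMat he' T (transition_mem h'), hl,
    jacobian_transition_mul he he' (IsManifold.chart_mem_maximalAtlas (e.symm u)) hu h'
      (mem_chart_source _ _), transpose_mul]
  simp only [mul_assoc]

end Transition

/-! ### Metrics on the manifold in terms of their components -/

section MetricTensor

open Set Filter Topology Matrix

variable {n : ℕ} {M : Type*} [TopologicalSpace M] [ChartedSpace (EuclideanSpace ℝ (Fin n)) M]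

/-- `T` is a Riemannian metric on `U`, in terms of its components in charts. -/
structure IsMetricTensorOn (T : TwoTensor n M) (U : Set M) : Prop where
  isOpen : IsOpen U
  smooth : ∀ e ∈ IsManifold.maximalAtlas (𝓡 n) ∞ M, MatSmoothOn (tensorCoord e T) (coordSet e U)
  posDef : ∀ p ∈ U, (tensorMat T p).PosDef

namespace IsMetricTensorOn

variable {T : TwoTensor n M} {U W : Set M}
  {e e' : OpenPartialHomeomorph M (EuclideanSpace ℝ (Fin n))} {u : EuclideanSpace ℝ (Fin n)} {p : M}

theorem mono (hT : IsMetricTensorOn T U) (hW : IsOpen W) (h : W ⊆ U) : IsMetricTensorOn T W :=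
  ⟨hW, fun e he => (hT.smooth e he).mono fun _ hx => ⟨hx.1, h hx.2⟩, fun p hp => hT.posDef p (h hp)⟩

theorem mem_coordSet_chartAt (hp : p ∈ U) : chartAt (EuclideanSpace ℝ (Fin n)) p p ∈
    coordSet (chartAt (EuclideanSpace ℝ (Fin n)) p) U :=
  ⟨mem_chart_target _ p, by
    rwa [mem_preimage, (chartAt (EuclideanSpace ℝ (Fin n)) p).left_inv (mem_chart_source _ p)]⟩

theorem tensorCoord_exp_smul (σ : M → ℝ) (x : EuclideanSpace ℝ (Fin n)) :
    tensorCoord e (fun q => Real.exp (2 * σ q) • T q) x =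
      Real.exp (2 * σ (e.symm x)) • tensorCoord e T x := rfl

theorem contDiffOn_comp_symm {σ : M → ℝ} (he : e ∈ IsManifold.maximalAtlas (𝓡 n) ∞ M)
    (hσ : ContMDiffOn (𝓡 n) 𝓘(ℝ, ℝ) ∞ σ U) :
    ContDiffOn ℝ ∞ (fun x => σ (e.symm x)) (coordSet e U) := by
  rw [← contMDiffOn_iff_contDiffOn]
  exact hσ.comp ((contMDiffOn_symm_of_mem_maximalAtlas he).mono inter_subset_left)
    inter_subset_right

theorem exp_smul (hT : IsMetricTensorOn T U) {σ : M → ℝ}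
    (hσ : ContMDiffOn (𝓡 n) 𝓘(ℝ, ℝ) ∞ σ U) :
    IsMetricTensorOn (fun q => Real.exp (2 * σ q) • T q) U where
  isOpen := hT.isOpen
  smooth e he := MatSmoothOn.smul (contDiffOn_const.mul (contDiffOn_comp_symm he hσ)).exp
    (hT.smooth e he)
  posDef p hp := (hT.posDef p hp).smul (Real.exp_pos (2 * σ p))

variable [IsManifold (𝓡 n) ∞ M]

theorem posDef_tensorCoord (hT : IsMetricTensorOn T U)
    (he : e ∈ IsManifold.maximalAtlas (𝓡 n) ∞ M) (hu : u ∈ coordSet e U) :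
    (tensorCoord e T u).PosDef := by
  rw [tensorCoord_eq_tensorMat he T hu.1]
  have hdet := det_jacobian_transition he (IsManifold.chart_mem_maximalAtlas (e.symm u)) hu.1
    (mem_chart_source _ _)
  have := (hT.posDef _ hu.2).conjTranspose_mul_mul_same
    (Matrix.mulVec_injective_iff_isUnit.2 ((Matrix.isUnit_iff_isUnit_det _).2 hdet.isUnit))
  rwa [conjTranspose_eq_transpose_of_trivial] at this

theorem isMetricOn (hT : IsMetricTensorOn T U) (he : e ∈ IsManifold.maximalAtlas (𝓡 n) ∞ M) :
    IsMetricOn (tensorCoord e T) (coordSet e U) where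
  isOpen := isOpen_coordSet e hT.isOpen
  smooth := hT.smooth e he
  symm x hx := by
    have := (hT.posDef_tensorCoord he hx).isHermitian
    rwa [Matrix.IsHermitian, conjTranspose_eq_transpose_of_trivial] at this
  det_ne x hx := (hT.posDef_tensorCoord he hx).det_pos.ne'

theorem isPullback (hT : IsMetricTensorOn T U) (he : e ∈ IsManifold.maximalAtlas (𝓡 n) ∞ M)
    (he' : e' ∈ IsManifold.maximalAtlas (𝓡 n) ∞ M) :
    IsPullback (transition e e') (tensorCoord e T) (tensorCoord e' T)
      (coordSet e (U ∩ e'.source)) (coordSet e' U) where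
  isOpen := isOpen_coordSet e (hT.isOpen.inter e'.open_source)
  smooth := (contDiffOn_transition he he').mono fun x hx => ⟨hx.1, hx.2.2⟩
  mapsTo x hx := ⟨transition_mem hx.2.2, by
    have : e'.symm (transition e e' x) = e.symm x := e'.left_inv hx.2.2
    rw [mem_preimage, this]
    exact hx.2.1⟩
  det_ne x hx := det_jacobian_transition he he' hx.1 hx.2.2
  eq x hx := tensorCoord_transition he he' T hx.1 hx.2.2

/-- `schoutenTensor` is computed at each point in that point's own preferred chart. Naturality
replaces this moving chart by the fixed chart `e`, as is necessary before anything can be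
differentiated. -/
theorem tensorCoord_schoutenTensor (hT : IsMetricTensorOn T U)
    (he : e ∈ IsManifold.maximalAtlas (𝓡 n) ∞ M) (hu : u ∈ coordSet e U) :
    tensorCoord e (schoutenTensor T) u = schoutenCoord (tensorCoord e T) u := by
  have hc := IsManifold.chart_mem_maximalAtlas (I := 𝓡 n) (n := ∞) (e.symm u)
  rw [tensorCoord_eq_tensorMat he _ hu.1,
    (hT.isPullback he hc).schoutenCoord_eq (hT.isMetricOn hc) ⟨hu.1, hu.2, mem_chart_source _ _⟩]
  congr 2
  exact tensorMat_bilinOfMatrix (fun q => schoutenCoord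
    (tensorCoord (chartAt (EuclideanSpace ℝ (Fin n)) q) T)
    (chartAt (EuclideanSpace ℝ (Fin n)) q q)) (e.symm u)

theorem dualTensor_apply (hT : IsMetricTensorOn T U) (hp : p ∈ U) :
    dualTensor T p = bilinOfMatrix (dualCoord (tensorCoord (chartAt (EuclideanSpace ℝ (Fin n)) p) T)
      (chartAt (EuclideanSpace ℝ (Fin n)) p p)) := by
  have h := hT.tensorCoord_schoutenTensor
    (IsManifold.chart_mem_maximalAtlas (I := 𝓡 n) (n := ∞) p) (mem_coordSet_chartAt hp)
  simp only [dualTensor]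
  rw [h]
  congr 1
  ext i j
  rw [dualCoord_apply]
  rfl

theorem tensorMat_dualTensor (hT : IsMetricTensorOn T U) (hp : p ∈ U) :
    tensorMat (dualTensor T) p = dualCoord (tensorCoord (chartAt (EuclideanSpace ℝ (Fin n)) p) T)
      (chartAt (EuclideanSpace ℝ (Fin n)) p p) := by
  rw [← tensorMat_bilinOfMatrix (fun q => dualCoord
    (tensorCoord (chartAt (EuclideanSpace ℝ (Fin n)) q) T)
    (chartAt (EuclideanSpace ℝ (Fin n)) q q)) p, tensorMat, hT.dualTensor_apply hp]
  rfl

/-- This is the coordinate independence of the dual tensor: the Jacobians in `A`, `g⁻¹` and `Aᵀ`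
cancel except for the outer pair. -/
theorem tensorCoord_dualTensor (hT : IsMetricTensorOn T U)
    (he : e ∈ IsManifold.maximalAtlas (𝓡 n) ∞ M) (hu : u ∈ coordSet e U) :
    tensorCoord e (dualTensor T) u = dualCoord (tensorCoord e T) u := by
  have hc := IsManifold.chart_mem_maximalAtlas (I := 𝓡 n) (n := ∞) (e.symm u)
  have hP := hT.isPullback he hc
  have hu' : u ∈ coordSet e (U ∩ (chartAt (EuclideanSpace ℝ (Fin n)) (e.symm u)).source) :=
    ⟨hu.1, hu.2, mem_chart_source _ _⟩
  rw [tensorCoord_eq_tensorMat he _ hu.1, hT.tensorMat_dualTensor hu.2, dualCoord, dualCoord,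
    hP.schoutenCoord_eq (hT.isMetricOn hc) hu', hP.inv_eq hu']
  set J := jacobian (transition e (chartAt (EuclideanSpace ℝ (Fin n)) (e.symm u))) u
  have h1 : J * J⁻¹ = 1 := hP.jacobian_mul_inv hu'
  have h2 : (Jᵀ)⁻¹ * Jᵀ = 1 := by
    rw [← transpose_nonsing_inv, ← transpose_mul, h1, transpose_one]
  simp only [transpose_mul, transpose_transpose, transition]
  set S := schoutenCoord (tensorCoord (chartAt (EuclideanSpace ℝ (Fin n)) (e.symm u)) T)
    (chartAt (EuclideanSpace ℝ (Fin n)) (e.symm u) (e.symm u))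
  set G := tensorCoord (chartAt (EuclideanSpace ℝ (Fin n)) (e.symm u)) T
    (chartAt (EuclideanSpace ℝ (Fin n)) (e.symm u) (e.symm u))
  calc Jᵀ * (S * G⁻¹ * Sᵀ) * J = Jᵀ * S * 1 * G⁻¹ * 1 * Sᵀ * J := by simp only [mul_one, mul_assoc]
    _ = Jᵀ * S * (J * J⁻¹) * G⁻¹ * ((Jᵀ)⁻¹ * Jᵀ) * Sᵀ * J := by rw [h1, h2]
    _ = _ := by simp only [mul_assoc]

theorem connCurv_eq_zero (hT : IsMetricTensorOn T U) (he : e ∈ IsManifold.maximalAtlas (𝓡 n) ∞ M)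
    (he' : e' ∈ IsManifold.maximalAtlas (𝓡 n) ∞ M) (hu : u ∈ coordSet e (U ∩ e'.source))
    (h : ∀ i j, connCurv (leviCivita (tensorCoord e' T)) i j (transition e e' u) = 0) (i j : Fin n) :
    connCurv (leviCivita (tensorCoord e T)) i j u = 0 := by
  have hP := hT.isPullback he he'
  have := hP.connCurv_eq (hT.isMetricOn he') hu i j
  simp only [h, smul_zero, Finset.sum_const_zero, zero_mul] at this
  rw [← one_mul (connCurv _ i j u), ← hP.inv_mul_jacobian hu, mul_assoc, this, mul_zero]

/-- `sectionalCurvature` refers to the preferred chart at the point. The full curvature vanishes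
there first and is then carried to `e`. -/
theorem connCurv_eq_zero_of_sectionalCurvature (hT : IsMetricTensorOn T U)
    (he : e ∈ IsManifold.maximalAtlas (𝓡 n) ∞ M) (hu : u ∈ coordSet e U)
    (h : ∀ v w : TangentSpace (𝓡 n) (e.symm u), LinearIndependent ℝ ![v, w] →
      sectionalCurvature T (e.symm u) v w = 0) (i j : Fin n) :
    connCurv (leviCivita (tensorCoord e T)) i j u = 0 := by
  have hc := IsManifold.chart_mem_maximalAtlas (I := 𝓡 n) (n := ∞) (e.symm u)
  have hu' := mem_coordSet_chartAt (n := n) (show e.symm u ∈ U from hu.2)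
  exact hT.connCurv_eq_zero he hc ⟨hu.1, hu.2, mem_chart_source _ _⟩
    ((hT.isMetricOn hc).connCurv_eq_zero_of_sectional hu' (hT.posDef_tensorCoord hc hu') h) i j

theorem sectionalCurvature_eq_zero (hT : IsMetricTensorOn T U)
    (he : e ∈ IsManifold.maximalAtlas (𝓡 n) ∞ M) (hp : p ∈ U) (hpe : p ∈ e.source)
    (h : ∀ i j, connCurv (leviCivita (tensorCoord e T)) i j (e p) = 0)
    (v w : TangentSpace (𝓡 n) p) : sectionalCurvature T p v w = 0 := by
  have hl := (chartAt (EuclideanSpace ℝ (Fin n)) p).left_inv (mem_chart_source _ p)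
  refine sectionalCoord_eq_zero (hT.connCurv_eq_zero (IsManifold.chart_mem_maximalAtlas p) he
    ⟨mem_chart_target _ p, ?_⟩ ?_) v w
  · rw [mem_preimage, hl]
    exact ⟨hp, hpe⟩
  · rwa [transition, hl]

end IsMetricTensorOn

end MetricTensor

/-! ### From smooth components to a smooth section of the bundle of bilinear forms -/

section RiemannianMetric

open Set Filter Topology Matrix

theorem apply_mem_coordSet {n : ℕ} {M : Type*} [TopologicalSpace M]
    {e : OpenPartialHomeomorph M (EuclideanSpace ℝ (Fin n))} {U : Set M} {q : M} (hq : q ∈ U)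
    (hqe : q ∈ e.source) : e q ∈ coordSet e U :=
  ⟨e.map_source hqe, by rwa [mem_preimage, e.left_inv hqe]⟩

theorem fderiv_apply_eq_sum {n : ℕ} {ψ : EuclideanSpace ℝ (Fin n) → EuclideanSpace ℝ (Fin n)}
    {u : EuclideanSpace ℝ (Fin n)} (hψ : DifferentiableAt ℝ ψ u) (v : EuclideanSpace ℝ (Fin n))
    (a : Fin n) : fderiv ℝ ψ u v a = ∑ k, jacobian ψ u a k * v k := by
  conv_lhs => rw [sum_single_eq v, map_sum, WithLp.ofLp_sum, Finset.sum_apply]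
  refine Finset.sum_congr rfl fun k _ => ?_
  rw [map_smul, PiLp.smul_apply, jacobian_apply hψ, smul_eq_mul, mul_comm]

theorem contDiffOn_bilinOfMatrix {n : ℕ} {Ω : Set (EuclideanSpace ℝ (Fin n))}
    {A : EuclideanSpace ℝ (Fin n) → Matrix (Fin n) (Fin n) ℝ} (hA : MatSmoothOn A Ω) :
    ContDiffOn ℝ ∞ (fun x => bilinOfMatrix (A x)) Ω :=
  ContDiffOn.sum fun i _ => ContDiffOn.sum fun j _ => contDiffOn_smul_const (hA i j) _

variable {n : ℕ} {M : Type*} [TopologicalSpace M] [ChartedSpace (EuclideanSpace ℝ (Fin n)) M]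
  [IsManifold (𝓡 n) ∞ M] {T : TwoTensor n M} {U : Set M}

/-- The fibre over `q` is read in the preferred chart at `q`, the trivialization in the chart at
`p`; the transition between the two charts relates them. -/
theorem symm_trivializationAt_eq {p q : M}
    (hq : q ∈ (chartAt (EuclideanSpace ℝ (Fin n)) p).source) (v : EuclideanSpace ℝ (Fin n)) :
    (trivializationAt (EuclideanSpace ℝ (Fin n)) (TangentSpace (𝓡 n)) p).symm q v =
      fderiv ℝ (transition (chartAt (EuclideanSpace ℝ (Fin n)) p)
        (chartAt (EuclideanSpace ℝ (Fin n)) q)) (chartAt (EuclideanSpace ℝ (Fin n)) p q) v := by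
  have h := TangentBundle.symmL_trivializationAt_eq_core (I := 𝓡 n) (𝕜 := ℝ) hq
  have h2 := DFunLike.congr_fun h v
  rw [Trivialization.symmL_apply _ (by simpa using hq)] at h2
  rw [h2, tangentBundleCore_coordChange_achart]
  have : fderivWithin ℝ (extChartAt (𝓡 n) q ∘ (extChartAt (𝓡 n) p).symm) (range (𝓡 n))
      (extChartAt (𝓡 n) p q) = fderiv ℝ (transition (chartAt (EuclideanSpace ℝ (Fin n)) p)
        (chartAt (EuclideanSpace ℝ (Fin n)) q)) (chartAt (EuclideanSpace ℝ (Fin n)) p q) := by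
    simp [extChartAt]
    rfl
  exact DFunLike.congr_fun this v

/-- In the trivialization at `p`, the section is the component matrix in the chart at `p`, so bundle
smoothness reduces to smoothness of the entries. -/
theorem inCoordinates_eq_bilinOfMatrix {p q : M}
    (hq : q ∈ (chartAt (EuclideanSpace ℝ (Fin n)) p).source) :
    ContinuousLinearMap.inCoordinates (EuclideanSpace ℝ (Fin n)) (TangentSpace (𝓡 n))
      (EuclideanSpace ℝ (Fin n) →L[ℝ] ℝ) (fun q : M => TangentSpace (𝓡 n) q →L[ℝ] ℝ) p q p q (T q) =
    bilinOfMatrix (tensorCoord (chartAt (EuclideanSpace ℝ (Fin n)) p) T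
      (chartAt (EuclideanSpace ℝ (Fin n)) p q)) := by
  have hp := IsManifold.chart_mem_maximalAtlas (I := 𝓡 n) (n := ∞) p
  have hq' := IsManifold.chart_mem_maximalAtlas (I := 𝓡 n) (n := ∞) q
  have hl := (chartAt (EuclideanSpace ℝ (Fin n)) p).left_inv hq
  have hd := differentiableAt_transition hp hq'
    ((chartAt (EuclideanSpace ℝ (Fin n)) p).map_source hq)
    (by rw [hl]; exact mem_chart_source _ q)
  refine ContinuousLinearMap.ext fun v => ContinuousLinearMap.ext fun w => ?_
  rw [inCoordinates_apply_eq₂ (E₃ := Bundle.Trivial M ℝ) (by simpa using hq) (by simpa using hq)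
    (by simp), symm_trivializationAt_eq hq, symm_trivializationAt_eq hq]
  have htriv : ∀ c : ℝ,
      (trivializationAt ℝ (Bundle.Trivial M ℝ) p).linearMapAt ℝ q c = c := fun c => by simp
  refine (htriv _).trans ((apply_eq_tensorMat T q _ _).trans ?_)
  rw [bilinOfMatrix_apply, tensorCoord_eq_tensorMat hp T
    ((chartAt (EuclideanSpace ℝ (Fin n)) p).map_source hq), hl]
  simp only [fderiv_apply_eq_sum hd]
  set J := jacobian (transition (chartAt (EuclideanSpace ℝ (Fin n)) p)
    (chartAt (EuclideanSpace ℝ (Fin n)) q)) (chartAt (EuclideanSpace ℝ (Fin n)) p q)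
  set A := tensorMat T q
  have e1 : ∑ i, ∑ j, (∑ k, J i k * v k) * (∑ k, J j k * w k) * A i j =
      (J *ᵥ v) ⬝ᵥ (A *ᵥ (J *ᵥ w)) := by
    simp only [dotProduct, mulVec]
    refine Finset.sum_congr rfl fun i _ => ?_
    rw [Finset.mul_sum]
    exact Finset.sum_congr rfl fun j _ => by ring
  have e2 : ∑ i, ∑ j, (Jᵀ * A * J) i j * v i * w j = v ⬝ᵥ ((Jᵀ * A * J) *ᵥ w) := by
    simp only [dotProduct, mulVec, Finset.mul_sum]
    exact Finset.sum_congr rfl fun i _ => Finset.sum_congr rfl fun j _ => by ring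
  rw [e1, e2, ← mulVec_mulVec, ← mulVec_mulVec, dotProduct_mulVec v, vecMul_transpose]

theorem IsMetricTensorOn.isRiemannianMetricOn (hT : IsMetricTensorOn T U) :
    IsRiemannianMetricOn T U where
  isOpen := hT.isOpen
  symm p hp v w := by
    have h : ∀ i j, tensorMat T p j i = tensorMat T p i j := fun i j => by
      simpa using (hT.posDef p hp).isHermitian.apply i j
    refine (apply_eq_tensorMat T p v w).trans (Eq.trans ?_ (apply_eq_tensorMat T p w v).symm)
    rw [Finset.sum_comm]
    exact Finset.sum_congr rfl fun i _ => Finset.sum_congr rfl fun j _ => by rw [h]; ring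
  pos p hp v hv := by
    have h := (hT.posDef p hp).dotProduct_mulVec_pos
      (x := WithLp.ofLp (p := 2) (V := Fin n → ℝ) v) fun h0 => hv (WithLp.ofLp_injective 2 h0)
    refine h.trans_eq (Eq.trans ?_ (apply_eq_tensorMat T p v v).symm)
    simp only [dotProduct, mulVec, Finset.mul_sum, star_trivial]
    exact Finset.sum_congr rfl fun i _ => Finset.sum_congr rfl fun j _ => by ring
  smooth := by
    intro p hp
    rw [Bundle.contMDiffWithinAt_section]
    have hc := IsManifold.chart_mem_maximalAtlas (I := 𝓡 n) (n := ∞) p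
    have h1 : ContMDiffAt (𝓡 n) 𝓘(ℝ, EuclideanSpace ℝ (Fin n) →L[ℝ]
        EuclideanSpace ℝ (Fin n) →L[ℝ] ℝ) ∞ (fun q => bilinOfMatrix
          (tensorCoord (chartAt (EuclideanSpace ℝ (Fin n)) p) T
            (chartAt (EuclideanSpace ℝ (Fin n)) p q))) p := by
      have h2 : ContDiffAt ℝ ∞ (fun x => bilinOfMatrix
          (tensorCoord (chartAt (EuclideanSpace ℝ (Fin n)) p) T x))
            (chartAt (EuclideanSpace ℝ (Fin n)) p p) :=
        (contDiffOn_bilinOfMatrix (hT.smooth _ hc)).contDiffAt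
          ((isOpen_coordSet _ hT.isOpen).mem_nhds (apply_mem_coordSet hp (mem_chart_source _ p)))
      exact (contMDiffAt_iff_contDiffAt.2 h2).comp p
        (contMDiffAt_of_mem_maximalAtlas hc (mem_chart_source _ p))
    refine (h1.congr_of_eventuallyEq ?_).contMDiffWithinAt
    filter_upwards [chart_source_mem_nhds (EuclideanSpace ℝ (Fin n)) p] with q hq
    exact inCoordinates_eq_bilinOfMatrix hq

end RiemannianMetric

/-! ### The induced metric of a GCF-manifold, and its dual -/

section InducedMetric

open Set Filter Topology Matrix

/-- A coordinate field is the tangent map of `e.symm` applied to a constant field. -/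
theorem contMDiffOn_coordVector {n : ℕ} {M : Type*} [TopologicalSpace M]
    [ChartedSpace (EuclideanSpace ℝ (Fin n)) M] [IsManifold (𝓡 n) ∞ M]
    {e : OpenPartialHomeomorph M (EuclideanSpace ℝ (Fin n))}
    (he : e ∈ IsManifold.maximalAtlas (𝓡 n) ∞ M) (i : Fin n) :
    ContMDiffOn (𝓡 n) (𝓡 n).tangent ∞
      (fun u => (⟨e.symm u, coordVector e i u⟩ : TangentBundle (𝓡 n) M)) e.target := by
  have h := (contMDiffOn_symm_of_mem_maximalAtlas he).contMDiffOn_tangentMapWithin (m := ∞)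
    (by simp) e.open_target.uniqueMDiffOn
  have hs : ContMDiff (𝓡 n) (𝓡 n).tangent ∞ (fun u : EuclideanSpace ℝ (Fin n) =>
      (⟨u, (EuclideanSpace.single i (1 : ℝ) : EuclideanSpace ℝ (Fin n))⟩ :
        TangentBundle (𝓡 n) (EuclideanSpace ℝ (Fin n)))) :=
    contMDiff_vectorSpace_iff_contDiff.2 contDiff_const
  refine (h.comp hs.contMDiffOn fun x hx => hx).congr fun x hx => ?_
  simp only [Function.comp, tangentMapWithin, coordVector]
  rw [mfderivWithin_of_isOpen e.open_target hx]

variable {n : ℕ} {M : Type*} [TopologicalSpace M]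
  [ChartedSpace (EuclideanSpace ℝ (Fin n)) M] [IsManifold (𝓡 n) ∞ M]
  {F : Type*} [NormedAddCommGroup F] [NormedSpace ℝ F] [FiniteDimensional ℝ F]
  {V : M → Type*} [TopologicalSpace (TotalSpace F V)]
  [∀ p, NormedAddCommGroup (V p)] [∀ p, InnerProductSpace ℝ (V p)]
  [FiberBundle F V] [VectorBundle ℝ F V] [ContMDiffVectorBundle ∞ F V (𝓡 n)]
  [IsContMDiffRiemannianBundle (𝓡 n) ∞ F V] (B : CoherentTangentBundle n M F V)
  {e : OpenPartialHomeomorph M (EuclideanSpace ℝ (Fin n))}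

namespace CoherentTangentBundle

/-- The component `g_{ij}` is the fibre inner product of the smooth sections `φ ∂_i` and `φ ∂_j`
along `e.symm`. -/
theorem smooth_tensorCoord_inducedMetric (he : e ∈ IsManifold.maximalAtlas (𝓡 n) ∞ M) :
    MatSmoothOn (tensorCoord e B.inducedMetric) e.target := by
  have hφ : ContMDiffOn (𝓡 n) ((𝓡 n).prod 𝓘(ℝ, EuclideanSpace ℝ (Fin n) →L[ℝ] F)) ∞
      (fun u => TotalSpace.mk' (EuclideanSpace ℝ (Fin n) →L[ℝ] F)
        (E := fun p : M => TangentSpace (𝓡 n) p →L[ℝ] V p) (e.symm u) (B.φ (e.symm u))) e.target :=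
    B.smooth_φ.comp_contMDiffOn (contMDiffOn_symm_of_mem_maximalAtlas he)
  have hv : ∀ i, ContMDiffOn (𝓡 n) ((𝓡 n).prod 𝓘(ℝ, F)) ∞
      (fun u => TotalSpace.mk' F (E := V) (e.symm u) (B.φ (e.symm u) (coordVector e i u)))
        e.target := fun i => hφ.clm_bundle_apply (contMDiffOn_coordVector he i)
  intro i j
  rw [← contMDiffOn_iff_contDiffOn]
  exact (hv i).inner_bundle (hv j)

theorem posDef_inducedMetric {p : M} (hp : p ∈ B.regularSet) :
    (tensorMat B.inducedMetric p).PosDef := by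
  have hinner : ∀ v w : TangentSpace (𝓡 n) p, B.inducedMetric p v w = B.inducedMetric p w v :=
    fun v w => by rw [inducedMetric_apply, inducedMetric_apply, real_inner_comm]
  refine Matrix.PosDef.of_dotProduct_mulVec_pos ?_ fun x hx => ?_
  · ext i j
    exact hinner _ _
  · have h := apply_eq_tensorMat B.inducedMetric p (WithLp.toLp 2 x) (WithLp.toLp 2 x)
    have hpos : 0 < B.inducedMetric p
        (WithLp.toLp 2 x : EuclideanSpace ℝ (Fin n)) (WithLp.toLp 2 x : EuclideanSpace ℝ (Fin n)) := by
      refine (real_inner_self_pos (F := V p)).2 fun h0 => hx ?_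
      have h1 := hp (h0.trans (map_zero (B.φ p)).symm)
      exact congrArg (WithLp.ofLp (p := 2) (V := Fin n → ℝ)) h1
    refine (hpos.trans_eq h).trans_eq ?_
    simp only [dotProduct, mulVec, Finset.mul_sum, star_trivial]
    exact Finset.sum_congr rfl fun i _ => Finset.sum_congr rfl fun j _ => by ring

variable {B}

/-- Conformal flatness already provides, at each regular point, an open neighbourhood contained in
the regular set. -/
theorem IsGCF.isOpen_regularSet (hB : B.IsGCF) : IsOpen B.regularSet :=
  isOpen_iff_forall_mem_open.2 fun p hp => by
    obtain ⟨W, hW, hpW, hWU, -⟩ := hB.conformallyFlat p hp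
    exact ⟨W, hWU, hW, hpW⟩

theorem IsGCF.isMetricTensorOn (hB : B.IsGCF) : IsMetricTensorOn B.inducedMetric B.regularSet where
  isOpen := hB.isOpen_regularSet
  smooth _ he := (B.smooth_tensorCoord_inducedMetric he).mono inter_subset_left
  posDef _ hp := B.posDef_inducedMetric hp

theorem bilinOfMatrix_nondegenerate_iff {A : Matrix (Fin n) (Fin n) ℝ} :
    (∀ v : EuclideanSpace ℝ (Fin n), (∀ w, bilinOfMatrix A v w = 0) → v = 0) ↔ A.det ≠ 0 := by
  have key : ∀ v w : EuclideanSpace ℝ (Fin n), bilinOfMatrix A v w = (v ᵥ* A) ⬝ᵥ w := by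
    intro v w
    rw [bilinOfMatrix_apply, ← dotProduct_mulVec]
    simp only [dotProduct, mulVec, Finset.mul_sum]
    exact Finset.sum_congr rfl fun i _ => Finset.sum_congr rfl fun j _ => by ring
  rw [Ne, ← Matrix.exists_vecMul_eq_zero_iff]
  constructor
  · rintro h ⟨v, hv, hv0⟩
    refine hv (congrArg WithLp.ofLp (h (WithLp.toLp 2 v) fun w => ?_))
    rw [key, hv0, zero_dotProduct]
  · intro h v hv
    by_contra hne
    refine h ⟨v, fun h0 => hne (WithLp.ofLp_injective 2 h0), ?_⟩
    exact dotProduct_eq_zero _ fun w => (key v (WithLp.toLp 2 w)).symm.trans (hv _)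

/-- Naturality changes the Schouten matrix only by a congruence with an invertible Jacobian, so
non-degeneracy can be tested by a determinant in any chart; openness follows by continuity. -/
theorem IsGCF.mem_nonParabolicSet_iff (hB : B.IsGCF)
    (he : e ∈ IsManifold.maximalAtlas (𝓡 n) ∞ M) {u : EuclideanSpace ℝ (Fin n)}
    (hu : u ∈ coordSet e B.regularSet) :
    e.symm u ∈ B.nonParabolicSet ↔ (schoutenCoord (tensorCoord e B.inducedMetric) u).det ≠ 0 := by
  have hT := hB.isMetricTensorOn
  have hc := IsManifold.chart_mem_maximalAtlas (I := 𝓡 n) (n := ∞) (e.symm u)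
  have h1 : e.symm u ∈ B.nonParabolicSet ↔ (schoutenCoord
      (tensorCoord (chartAt (EuclideanSpace ℝ (Fin n)) (e.symm u)) B.inducedMetric)
      (chartAt (EuclideanSpace ℝ (Fin n)) (e.symm u) (e.symm u))).det ≠ 0 :=
    (and_iff_right hu.2).trans bilinOfMatrix_nondegenerate_iff
  rw [h1, (hT.isPullback he hc).schoutenCoord_eq (hT.isMetricOn hc)
    ⟨hu.1, hu.2, mem_chart_source _ _⟩, det_mul, det_mul, det_transpose]
  have hJ := det_jacobian_transition he hc hu.1 (mem_chart_source _ _)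
  simp [hJ, transition]

theorem IsGCF.isOpen_nonParabolicSet (hB : B.IsGCF) : IsOpen B.nonParabolicSet := by
  have hT := hB.isMetricTensorOn
  refine isOpen_iff_forall_mem_open.2 fun p hp => ?_
  have hc := IsManifold.chart_mem_maximalAtlas (I := 𝓡 n) (n := ∞) p
  set c := chartAt (EuclideanSpace ℝ (Fin n)) p with hcdef
  have hpc : p ∈ c.source := mem_chart_source _ p
  have hG := hT.isMetricOn hc
  have hO : IsOpen (coordSet c B.regularSet ∩
      {x | (schoutenCoord (tensorCoord c B.inducedMetric) x).det ≠ 0}) :=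
    hG.smooth_schoutenCoord.det.continuousOn.isOpen_inter_preimage hG.isOpen isOpen_compl_singleton
  refine ⟨c.source ∩ c ⁻¹' (coordSet c B.regularSet ∩
      {x | (schoutenCoord (tensorCoord c B.inducedMetric) x).det ≠ 0}), fun q hq => ?_,
    c.isOpen_inter_preimage hO, hpc, apply_mem_coordSet hp.1 hpc, ?_⟩
  · have := (hB.mem_nonParabolicSet_iff hc hq.2.1).2 hq.2.2
    rwa [c.left_inv hq.1] at this
  · refine (hB.mem_nonParabolicSet_iff hc (apply_mem_coordSet hp.1 hpc)).1 ?_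
    rwa [c.left_inv hpc]

theorem IsGCF.isMetricTensorOn_dualTensor (hB : B.IsGCF) :
    IsMetricTensorOn (dualTensor B.inducedMetric) B.nonParabolicSet where
  isOpen := hB.isOpen_nonParabolicSet
  smooth e he := by
    have hT := hB.isMetricTensorOn
    have hG := hT.isMetricOn he
    have hS := hG.smooth_schoutenCoord
    exact (((hS.mul (hG.smooth.inv hG.det_ne)).mul hS.transpose).mono fun x hx =>
      ⟨hx.1, hx.2.1⟩).congr fun x hx => hT.tensorCoord_dualTensor he ⟨hx.1, hx.2.1⟩
  posDef p hp := by
    have hT := hB.isMetricTensorOn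
    have hc := IsManifold.chart_mem_maximalAtlas (I := 𝓡 n) (n := ∞) p
    have hpc := IsMetricTensorOn.mem_coordSet_chartAt (n := n) hp.1
    have hA := (hB.mem_nonParabolicSet_iff hc hpc).1 (by
      rwa [(chartAt (EuclideanSpace ℝ (Fin n)) p).left_inv (mem_chart_source _ p)])
    -- The dual metric is the congruence of the positive definite inverse metric by the invertible
    -- matrix `Aᵀ`.
    have h := (hT.posDef_tensorCoord hc hpc).inv.conjTranspose_mul_mul_same
      (B := (schoutenCoord (tensorCoord (chartAt (EuclideanSpace ℝ (Fin n)) p) B.inducedMetric)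
        (chartAt (EuclideanSpace ℝ (Fin n)) p p))ᵀ)
      (Matrix.mulVec_injective_iff_isUnit.2 ((Matrix.isUnit_iff_isUnit_det _).2
        (by rw [det_transpose]; exact hA.isUnit)))
    rw [conjTranspose_eq_transpose_of_trivial, transpose_transpose] at h
    rw [hT.tensorMat_dualTensor hp.1]
    exact h

/-- Local form of the duality on the manifold: the Schouten tensor and a conformal factor of the
dual metric near a point. -/
theorem IsGCF.exists_conformal_factor (hn : 3 ≤ n) (hB : B.IsGCF)
    (he : e ∈ IsManifold.maximalAtlas (𝓡 n) ∞ M) {u : EuclideanSpace ℝ (Fin n)}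
    (hu : u ∈ coordSet e B.nonParabolicSet) :
    ∃ Ω, IsOpen Ω ∧ u ∈ Ω ∧ Ω ⊆ coordSet e B.nonParabolicSet ∧
      (∀ x ∈ Ω, schoutenCoord (tensorCoord e (dualTensor B.inducedMetric)) x =
        schoutenCoord (tensorCoord e B.inducedMetric) x) ∧
      ∃ τ : EuclideanSpace ℝ (Fin n) → ℝ, ContDiffOn ℝ ∞ τ Ω ∧ ∀ x ∈ Ω, ∀ i j,
        connCurv (leviCivita fun x => Real.exp (2 * τ x) •
          tensorCoord e (dualTensor B.inducedMetric) x) i j x = 0 := by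
  have hT := hB.isMetricTensorOn
  obtain ⟨W, hW, huW, hWR, σ, hσ, hflat⟩ := hB.conformallyFlat (e.symm u) hu.2.1
  have hTW := hT.mono hW hWR
  have hΩ₀ := isOpen_coordSet e (hW.inter hB.isOpen_nonParabolicSet)
  have hW₀ : coordSet e (W ∩ B.nonParabolicSet) ⊆ coordSet e W := fun x hx => ⟨hx.1, hx.2.1⟩
  have hR₀ : coordSet e (W ∩ B.nonParabolicSet) ⊆ coordSet e B.regularSet :=
    fun x hx => ⟨hx.1, hx.2.2.1⟩
  obtain ⟨Ω, hΩ, huΩ, hs, -, hsch, τ, hτ, hcurv⟩ := exists_conformal_factor_dualCoord hn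
    ((hT.isMetricOn he).mono hΩ₀ hR₀) (fun x hx => hT.posDef_tensorCoord he (hR₀ hx))
    ((IsMetricTensorOn.contDiffOn_comp_symm he hσ).mono hW₀)
    (fun x hx => (hTW.exp_smul hσ).connCurv_eq_zero_of_sectionalCurvature he (hW₀ hx)
      fun v w hvw => hflat _ hx.2.1 v w hvw)
    (fun x hx => (hB.mem_nonParabolicSet_iff he (hR₀ hx)).1 hx.2.2) ⟨hu.1, huW, hu.2⟩
  -- Equality on the open set `Ω`, not just at `u`, since both conclusions involve derivatives of
  -- the dual metric.
  have heq : EqOn (tensorCoord e (dualTensor B.inducedMetric))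
      (dualCoord (tensorCoord e B.inducedMetric)) Ω :=
    fun x hx => hT.tensorCoord_dualTensor he (hR₀ (hs hx))
  refine ⟨Ω, hΩ, huΩ, fun x hx => ⟨(hs hx).1, (hs hx).2.2⟩, fun x hx => ?_, τ, hτ,
    fun x hx i j => ?_⟩
  · rw [schoutenCoord_congr hΩ heq hx, hsch x hx]
  · rw [connCurv_congr hΩ (fun y hy => by rw [heq hy]) hx, hcurv x hx]

/-- The conformal factor found in the chart at `p` is pulled back to the manifold. Its sectional
curvatures at nearby `q` refer to the chart at `q`, which is why curvature is transported once more
between charts. -/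
theorem IsGCF.isConformallyFlatOn_dualTensor (hn : 3 ≤ n) (hB : B.IsGCF) :
    IsConformallyFlatOn (dualTensor B.inducedMetric) B.nonParabolicSet := by
  intro p hp
  have hc := IsManifold.chart_mem_maximalAtlas (I := 𝓡 n) (n := ∞) p
  obtain ⟨Ω, hΩ, hpΩ, hs, -, τ, hτ, hcurv⟩ :=
    hB.exists_conformal_factor hn hc (IsMetricTensorOn.mem_coordSet_chartAt hp)
  set c := chartAt (EuclideanSpace ℝ (Fin n)) p with hcdef
  have hpc : p ∈ c.source := mem_chart_source _ p
  have hWo : IsOpen (c.source ∩ c ⁻¹' Ω) := c.isOpen_inter_preimage hΩ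
  have hWs : c.source ∩ c ⁻¹' Ω ⊆ B.nonParabolicSet := fun q hq => by
    have := (hs hq.2).2
    rwa [mem_preimage, c.left_inv hq.1] at this
  have hσ : ContMDiffOn (𝓡 n) 𝓘(ℝ, ℝ) ∞ (fun q => τ (c q)) (c.source ∩ c ⁻¹' Ω) :=
    (contMDiffOn_iff_contDiffOn.2 hτ).comp
      ((contMDiffOn_of_mem_maximalAtlas hc).mono inter_subset_left) inter_subset_right
  refine ⟨c.source ∩ c ⁻¹' Ω, hWo, ⟨hpc, hpΩ⟩, hWs, fun q => τ (c q), hσ, fun q hq v w _ => ?_⟩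
  refine ((hB.isMetricTensorOn_dualTensor.mono hWo hWs).exp_smul hσ).sectionalCurvature_eq_zero
    hc hq hq.1 (fun i j => ?_) v w
  refine (connCurv_congr hΩ (fun x hx => ?_) hq.2 i j).trans (hcurv _ hq.2 i j)
  rw [IsMetricTensorOn.tensorCoord_exp_smul, c.right_inv (hs hx).1]

end CoherentTangentBundle

end InducedMetric

end

/-- For a GCF-manifold `B` of dimension `n ≥ 3` with induced metric `g` and Schouten tensor `A`, the
dual tensor is a conformally flat metric on the set of non-parabolic points, it is given by
`∑ A_{ia} A_{jb} g^{ab} du^i ⊗ du^j` in every local coordinate system, and its Schouten tensor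
is `A`. -/
theorem theorem1 {n : ℕ} (hn : 3 ≤ n) {M : Type*} [TopologicalSpace M] [T2Space M]
    [ChartedSpace (EuclideanSpace ℝ (Fin n)) M] [IsManifold (𝓡 n) ∞ M]
    {F : Type*} [NormedAddCommGroup F] [NormedSpace ℝ F] [FiniteDimensional ℝ F]
    {V : M → Type*} [TopologicalSpace (TotalSpace F V)]
    [∀ p, NormedAddCommGroup (V p)] [∀ p, InnerProductSpace ℝ (V p)]
    [FiberBundle F V] [VectorBundle ℝ F V] [ContMDiffVectorBundle ∞ F V (𝓡 n)]
    [IsContMDiffRiemannianBundle (𝓡 n) ∞ F V]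
    (B : CoherentTangentBundle n M F V) (hB : B.IsGCF) :
    IsRiemannianMetricOn (dualTensor B.inducedMetric) B.nonParabolicSet ∧
    IsConformallyFlatOn (dualTensor B.inducedMetric) B.nonParabolicSet ∧
    (∀ p ∈ B.nonParabolicSet,
      schoutenTensor (dualTensor B.inducedMetric) p = schoutenTensor B.inducedMetric p) ∧
    (∀ e ∈ IsManifold.maximalAtlas (𝓡 n) ∞ M, ∀ u ∈ e.target, e.symm u ∈ B.nonParabolicSet →
      (∀ i j, tensorCoord e (dualTensor B.inducedMetric) u i j =
        ∑ a, ∑ b, schoutenCoord (tensorCoord e B.inducedMetric) u i a *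
          schoutenCoord (tensorCoord e B.inducedMetric) u j b *
            (tensorCoord e B.inducedMetric u)⁻¹ a b) ∧
      schoutenCoord (tensorCoord e (dualTensor B.inducedMetric)) u =
        schoutenCoord (tensorCoord e B.inducedMetric) u) := by
  have hschouten : ∀ e ∈ IsManifold.maximalAtlas (𝓡 n) ∞ M, ∀ u ∈ coordSet e B.nonParabolicSet,
      schoutenCoord (tensorCoord e (dualTensor B.inducedMetric)) u =
        schoutenCoord (tensorCoord e B.inducedMetric) u := fun e he u hu => by
    obtain ⟨Ω, -, huΩ, -, h, -⟩ := hB.exists_conformal_factor hn he hu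
    exact h u huΩ
  refine ⟨hB.isMetricTensorOn_dualTensor.isRiemannianMetricOn, hB.isConformallyFlatOn_dualTensor hn,
    fun p hp => ?_, fun e he u hu hp => ⟨fun i j => ?_, hschouten e he u ⟨hu, hp⟩⟩⟩
  · exact congrArg bilinOfMatrix (hschouten _ (IsManifold.chart_mem_maximalAtlas p) _
      (IsMetricTensorOn.mem_coordSet_chartAt hp))
  · rw [hB.isMetricTensorOn.tensorCoord_dualTensor he ⟨hu, hp.1⟩, dualCoord_apply]
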